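/- Let $\overline{\mathbb C}=\mathbb C\cup\{\infty\}$ be the Riemann sphere with coordinates $\xi_+=\xi_1+i\xi_2$ on $\mathbb C$ and $w_+=1/\xi_+$ around $\infty$, and let $\partial_\pm=\frac12(\partial_{\xi_1}\mp i\,\partial_{\xi_2})$. Call $X:\overline{\mathbb C}\to\mathbb C^{N\times N}$ a *finite action solution of class $C^r$* if its components are $C^r$ in both coordinates, every value satisfies $X^2=X=X^\dagger$, $\operatorname{tr}X=1$ (a rank-1 Hermitian projector), $[\partial_+\partial_-X,X]=0$ on $\mathbb C$, and $\int_{\mathbb R^2}\operatorname{tr}(\partial_+X\,\partial_-X)\,d\xi_1d\xi_2$ converges absolutely. A rank-1 Hermitian projector function $X$ is *holomorphic* (*antiholomorphic*) if in each of the two coordinates $\zeta\in\mathbb C$ the image of $X$ is spanned by a nowhere vanishing vector function $f(\zeta)$ with $\partial_{\bar\zeta}f=0$ (resp. $\partial_\zeta f=0$). Let $$\Pi_\pm X=\frac{\partial_\pm X\,X\,\partial_\mp X}{\operatorname{tr}(\partial_\pm X\,X\,\partial_\mp X)}\quad\text{if }\partial_\pm X\,X\,\partial_\mp X\not\equiv0,\qquad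 \Pi_\pm X=0\quad\text{if }\partial_\pm X\,X\,\partial_\mp X\equiv0,$$ where the quotient is extended by continuity to the zeros of its denominator and to $\infty$ (where there is no limit, the value is that of the quotient, or $0$ where the denominator vanishes and at $\infty$); $\Pi_\pm^k$ is the $k$-fold iterate. For $e\in\mathbb C^N$ and near a point $z\in\mathbb C$ with $P(z)e\neq0$ put $$D_\pm X=\partial_\pm X-\frac{e^\dagger P^\dagger(\partial_\pm P)e}{e^\dagger Pe}\,X,\qquad H_z=\operatorname{span}\{(D_-^kP)(z)e: k\ge0\},\qquad H_z^\perp=\operatorname{span}\{(D_+^kP)(z)e: k\ge1\}.$$ **Theorem.** Let $P:\overline{\mathbb C}\to\mathbb C^{N\times N}$ be a finite action solution of class $C^{N+2}$. Then there are integers $n,m\ge0$ with $n+m\le N-1$, a holomorphic projector $P_0$ and an antiholomorphic projector $P_{m+n}$ on $\overline{\mathbb C}$ such that $$P=\Pi_+^nP_0,\qquad P=\Pi_-^mP_{m+n},\qquad P_0=\Pi_-^{m+n}P_{m+n},$$ and moreover $P_0=\Pi_-^nP$ and $P_{m+n}=\Pi_+^mP$. Furthermore: 1. $\Pi_-^kP$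 for $0\le k\le n$ and $\Pi_+^kP$ for $0\le k\le m$ are finite action solutions of class $C^{N+2-k}$, while $\Pi_-^kP=0$ for $k>n$ and $\Pi_+^kP=0$ for $k>m$. 2. These projectors are mutually orthogonal at every point: $\Pi_-^jP\,\Pi_-^kP=0$ and $\Pi_+^jP\,\Pi_+^kP=0$ for $j\ne k$, and $\Pi_-^jP\,\Pi_+^kP=0$ for $j+k\neq0$. 3. For every $e\in\mathbb C^N$ and every $z\in\mathbb C$ with $P(z)e\ne0$, one has $\dim H_z=n+1$ and $\dim H_z^\perp=m$, the spaces $H_z$ and $H_z^\perp$ are orthogonal in $\mathbb C^N$, and the sum $$\Pi_-^nP+\dots+\Pi_-P+P+\Pi_+P+\dots+\Pi_+^mP$$ at $z$ acts as the identity on $H_z\oplus H_z^\perp$. -/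

import Mathlib

open Filter Topology MeasureTheory

noncomputable section

namespace CPSigma

/-- Complex `N × N` matrices. -/
abbrev Mat (N : ℕ) : Type := Matrix (Fin N) (Fin N) ℂ

/-! ### The complex derivatives `∂₊ = (∂₁ - i ∂₂)/2` and `∂₋ = (∂₁ + i ∂₂)/2` -/

/-- `∂₊ g` for a scalar function of `ξ₊ = ξ₁ + i ξ₂ ∈ ℂ`. -/
def sdPlus (g : ℂ → ℂ) (z : ℂ) : ℂ :=
  (1 / 2 : ℂ) * (fderiv ℝ g z 1 - Complex.I * fderiv ℝ g z Complex.I)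

/-- `∂₋ g` for a scalar function of `ξ₊ = ξ₁ + i ξ₂ ∈ ℂ`. -/
def sdMinus (g : ℂ → ℂ) (z : ℂ) : ℂ :=
  (1 / 2 : ℂ) * (fderiv ℝ g z 1 + Complex.I * fderiv ℝ g z Complex.I)

/-- `∂₊ X` for a matrix function, componentwise. -/
def dPlus {N : ℕ} (X : ℂ → Mat N) (z : ℂ) : Mat N :=
  Matrix.of fun i j => sdPlus (fun ζ => X ζ i j) z

/-- `∂₋ X` for a matrix function, componentwise. -/
def dMinus {N : ℕ} (X : ℂ → Mat N) (z : ℂ) : Mat N :=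
  Matrix.of fun i j => sdMinus (fun ζ => X ζ i j) z

/-! ### Matrix functions on the Riemann sphere `OnePoint ℂ = ℂ ∪ {∞}` -/

/-- The function in the affine coordinate `ξ₊`. -/
def aff {N : ℕ} (X : OnePoint ℂ → Mat N) (z : ℂ) : Mat N := X (z : OnePoint ℂ)

open Classical in
/-- The function in the coordinate `w₊ = 1 / ξ₊` around `∞`. -/
def inv {N : ℕ} (X : OnePoint ℂ → Mat N) (w : ℂ) : Mat N :=
  if w = 0 then X OnePoint.infty else X ((w⁻¹ : ℂ) : OnePoint ℂ)

/-- The components are of class `C^r` on the whole Riemann sphere. -/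
def IsCr {N : ℕ} (r : ℕ) (X : OnePoint ℂ → Mat N) : Prop :=
  (∀ i j, ContDiff ℝ (r : WithTop ℕ∞) fun z => aff X z i j) ∧
    ∀ i j, ContDiff ℝ (r : WithTop ℕ∞) fun w => inv X w i j

/-- Rank-1 Hermitian projectors. -/
structure IsRankOneProj {N : ℕ} (A : Mat N) : Prop where
  idem : A * A = A
  herm : A.conjTranspose = A
  trace_eq : A.trace = 1

/-- The Lagrangian density `L(P) = tr(∂₊P ∂₋P)`. -/
def lagrangian {N : ℕ} (X : ℂ → Mat N) (z : ℂ) : ℂ := (dPlus X z * dMinus X z).trace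

/-- The Euler–Lagrange equation `[∂₊∂₋P, P] = 0`. -/
def EulerLagrange {N : ℕ} (X : ℂ → Mat N) : Prop :=
  ∀ z, dPlus (dMinus X) z * X z - X z * dPlus (dMinus X) z = 0

/-- A solution of class `C^r` on the Riemann sphere, with values in the rank-1 Hermitian
projectors, whose action `∫ L(P) dξ₁dξ₂` is finite. -/
structure IsFiniteActionSolution {N : ℕ} (r : ℕ) (P : OnePoint ℂ → Mat N) : Prop where
  rankOne : ∀ p, IsRankOneProj (P p)
  smooth : IsCr r P
  eulerLagrange : EulerLagrange (aff P)
  finiteAction : Integrable (lagrangian (aff P)) (volume : Measure ℂ)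

/-! ### Holomorphic and antiholomorphic projectors -/

/-- The lines onto which `X` projects are spanned by a nowhere zero vector function `f` with
`d f = 0` (holomorphic for `d = ∂₋`, antiholomorphic for `d = ∂₊`). -/
def HasRep {N : ℕ} (d : (ℂ → ℂ) → ℂ → ℂ) (X : ℂ → Mat N) : Prop :=
  ∃ f : ℂ → Fin N → ℂ,
    (∀ z, f z ≠ 0) ∧
    (∀ i, Differentiable ℝ fun z => f z i) ∧
    (∀ i z, d (fun ζ => f ζ i) z = 0) ∧
    ∀ z, LinearMap.range (Matrix.mulVecLin (X z)) = Submodule.span ℂ {f z}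

/-- Holomorphic rank-1 Hermitian projectors on the Riemann sphere (in both charts). -/
def IsHolomorphicProj {N : ℕ} (X : OnePoint ℂ → Mat N) : Prop :=
  (∀ p, IsRankOneProj (X p)) ∧ HasRep sdMinus (aff X) ∧ HasRep sdMinus (inv X)

/-- Antiholomorphic rank-1 Hermitian projectors on the Riemann sphere (in both charts). -/
def IsAntiholomorphicProj {N : ℕ} (X : OnePoint ℂ → Mat N) : Prop :=
  (∀ p, IsRankOneProj (X p)) ∧ HasRep sdPlus (aff X) ∧ HasRep sdPlus (inv X)

/-! ### Raising and lowering operators -/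

/-- The numerator `dX X d'X`. -/
def ladderNum {N : ℕ} (d d' : (ℂ → Mat N) → ℂ → Mat N) (X : ℂ → Mat N) (z : ℂ) : Mat N :=
  d X z * X z * d' X z

/-- The quotient `dX X d'X / tr(dX X d'X)`, which is `0` where the numerator is `0`. -/
def ladderQuot {N : ℕ} (d d' : (ℂ → Mat N) → ℂ → Mat N) (X : ℂ → Mat N) (z : ℂ) : Mat N :=
  (ladderNum d d' X z).trace⁻¹ • ladderNum d d' X z

/-- The finite points `z` with `dX X d'X ≠ 0`, tending to the point `p` of the sphere. -/
def ladderFilter {N : ℕ} (d d' : (ℂ → Mat N) → ℂ → Mat N) (X : ℂ → Mat N)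
    (p : OnePoint ℂ) : Filter ℂ :=
  comap ((↑) : ℂ → OnePoint ℂ) (𝓝 p) ⊓ 𝓟 {z | ladderNum d d' X z ≠ 0}

open Classical in
/-- The quotient, extended by continuity to the points of the sphere where it is not defined:
`∞` and the zeros of `dX X d'X` that are limits of points where `dX X d'X ≠ 0`.
Where there is no limit, the value is that of the quotient (and `0` at `∞`);
in particular the result is `0` if `dX X d'X` vanishes identically. -/
def ladder {N : ℕ} (d d' : (ℂ → Mat N) → ℂ → Mat N) (X : OnePoint ℂ → Mat N)
    (p : OnePoint ℂ) : Mat N :=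
  if h : (ladderFilter d d' (aff X) p).NeBot ∧
      ∃ A, Tendsto (ladderQuot d d' (aff X)) (ladderFilter d d' (aff X) p) (𝓝 A)
  then h.2.choose
  else p.elim 0 (ladderQuot d d' (aff X))

/-- The raising operator `Π₊`. -/
def raise {N : ℕ} (X : OnePoint ℂ → Mat N) : OnePoint ℂ → Mat N := ladder dPlus dMinus X

/-- The lowering operator `Π₋`. -/
def lower {N : ℕ} (X : OnePoint ℂ → Mat N) : OnePoint ℂ → Mat N := ladder dMinus dPlus X

/-! ### Covariant derivatives and the spaces `H`, `H^⊥` -/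

/-- The sesquilinear product `⟨X, Y⟩_(P) = e† X† Y e / e† P e`. -/
def sesq {N : ℕ} (P : ℂ → Mat N) (e : Fin N → ℂ) (X Y : ℂ → Mat N) (z : ℂ) : ℂ :=
  (star e ⬝ᵥ ((X z).conjTranspose * Y z).mulVec e) / (star e ⬝ᵥ (P z).mulVec e)

/-- The covariant derivative `D X = d X - ⟨P, d P⟩_(P) X`. -/
def covD {N : ℕ} (d : (ℂ → Mat N) → ℂ → Mat N) (P : ℂ → Mat N) (e : Fin N → ℂ)
    (X : ℂ → Mat N) (z : ℂ) : Mat N :=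
  d X z - sesq P e P (d P) z • X z

/-- `H = span {(D₋^k P) e | k ≥ 0}` at the point `z`. -/
def spaceH {N : ℕ} (P : ℂ → Mat N) (e : Fin N → ℂ) (z : ℂ) : Submodule ℂ (Fin N → ℂ) :=
  Submodule.span ℂ {v | ∃ k : ℕ, v = ((covD dMinus P e)^[k] P z).mulVec e}

/-- `H^⊥ = span {(D₊^k P) e | k ≥ 1}` at the point `z`. -/
def spaceHperp {N : ℕ} (P : ℂ → Mat N) (e : Fin N → ℂ) (z : ℂ) : Submodule ℂ (Fin N → ℂ) :=
  Submodule.span ℂ {v | ∃ k : ℕ, 1 ≤ k ∧ v = ((covD dPlus P e)^[k] P z).mulVec e}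

end CPSigma

end

/-!
A rank-one projector `X` is a line bundle over the sphere, and its second fundamental form is
`A = ∂₊X X` (`sff`). The Euler–Lagrange equation is equivalent to `∂₋A = [A, A†]`
(`HarmonicProj.dMinus_sff`), and the numerator of `Π₊X` is `A A†`. The argument has four parts.

*Raising a solution gives a solution.* Locally there is an invertible `G` with `∂₋G = -A† G`; it is
a Neumann series in the Cauchy transform (`exists_gauge`). Then `G⁻¹ A G` is holomorphic, so that
either `A ≡ 0` or `A = (z - p)^k B` near every point `p`, with `B` of the class of `A` and
`B p ≠ 0` (`sff_eq_pow_smul`). Hence `A A† / tr (A A†) = B B† / tr (B B†)` extends over the zeros of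
`A`. The extension `Y` loses one order of differentiability and satisfies `∂₋Y Y = -A†`
(`next_raiseExt`), which makes `Y` a solution whose lowering is `X`. All this is covariant under
`w = 1 / z`, hence holds on the sphere. Lowering is raising of the complex conjugate
(`lower_cjS`), and the action of a continuously differentiable function on the sphere is always
finite (`integrable_lagrangian`).

*The members of the sequence are orthogonal.* For consecutive solutions with second fundamental
forms `A_0, …, A_{s-1}`, the function `tr (A_{s-1} ⋯ A_0 X_0)` is holomorphic as soon as the shorter
pieces of the sequence have orthogonal ends, and it tends to `0` at `∞` because the composition is a
differential of degree `s`. By Liouville's theorem it vanishes, and so `X_0 X_s = 0`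
(`Chain.mul_eq_zero`). As there are at most `N` orthogonal lines in `ℂ^N`, both raising and lowering
terminate before the supply of derivatives is exhausted.

*The ends are holomorphic and antiholomorphic.* Lowering terminates at a projector with
`∂₋X X = 0`; such a projector is real analytic, and a suitable column of it, multiplied by a
polynomial, is a nowhere vanishing holomorphic section (`hasRep_of_holoProj`). Raising it again
shows that the whole sequence consists of smooth functions
(`SphereHarmonic.exists_completeChain`).

*The spaces `H` and `H^⊥`.* The sum `S` of the members up to `P` satisfies `∂₋S S = 0`, whence `H`
is contained in the image of `S`. Conversely, if a covector `r` annihilates `H` at a point, then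
all `∂₋`-derivatives of `r P` vanish there. This flatness passes to the previous member: `r A†` is
flat, `A†` is a power of `conj (z - p)` times a function that does not vanish at `p`, and the power
can be divided out (`Tower.flatAt_of_succ`). So `r` annihilates the image of `S`, and `H` is that
image. The space `H^⊥` is treated by conjugating the sequence and reversing its order.
-/

noncomputable section

namespace CPSigma

open scoped Matrix ComplexConjugate ContDiff

/-! ### The Cauchy transform -/

section CauchyTransform

variable {E : Type*} [NormedAddCommGroup E] [NormedSpace ℂ E]

/-- The Cauchy–Riemann operator `∂₋ = ∂/∂z̄` for functions with values in a complex normed space. -/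
def dbar (f : ℂ → E) (z : ℂ) : E :=
  (1 / 2 : ℂ) • (fderiv ℝ f z 1 + Complex.I • fderiv ℝ f z Complex.I)

/-- The Cauchy kernel `1 / (π z)`, the fundamental solution of `∂₋`. -/
def cauchyKernel (z : ℂ) : ℂ := ((Real.pi : ℂ) * z)⁻¹

/-- The Cauchy transform of `h`, the convolution of `h` with the Cauchy kernel. -/
def cauchyT (h : ℂ → E) : ℂ → E :=
  convolution cauchyKernel h (ContinuousLinearMap.lsmul ℝ ℂ) volume

lemma integrableOn_cauchyKernel : IntegrableOn cauchyKernel (Metric.ball 0 1) := by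
  have hm : Measurable cauchyKernel := by unfold cauchyKernel; fun_prop
  refine ⟨hm.aestronglyMeasurable, ?_⟩
  rw [HasFiniteIntegral, ← lintegral_indicator Metric.isOpen_ball.measurableSet]
  rw [← Complex.lintegral_comp_polarCoord_symm]
  calc _ ≤ ∫⁻ p in polarCoord.target, (Set.Iio (1:ℝ) ×ˢ Set.univ).indicator 1 p := by
        refine setLIntegral_mono' polarCoord.open_target.measurableSet fun p hp => ?_
        have hp1 : 0 < p.1 := hp.1
        have hab : |p.1| = p.1 := abs_of_pos hp1
        have hn : ‖Complex.polarCoord.symm p‖ = p.1 := by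
          rw [Complex.norm_polarCoord_symm, abs_of_pos hp1]
        by_cases h1 : p.1 < 1
        · rw [Set.indicator_of_mem (by simpa [hab] using h1), Set.indicator_of_mem (by simpa using h1)]
          simp only [cauchyKernel, Pi.one_apply, smul_eq_mul]
          rw [← ofReal_norm, ← ENNReal.ofReal_mul hp1.le, ← ENNReal.ofReal_one]
          apply ENNReal.ofReal_le_ofReal
          rw [norm_inv, norm_mul, hn, Complex.norm_real, Real.norm_of_nonneg Real.pi_pos.le]
          rw [mul_inv, ← mul_assoc, mul_comm p.1, mul_assoc, mul_inv_cancel₀ hp1.ne', mul_one]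
          exact inv_le_one_of_one_le₀ (by linarith [Real.pi_gt_three])
        · rw [Set.indicator_of_notMem (by simpa [hab] using h1)]
          simp
    _ ≤ ∫⁻ p, (Set.Ioo (0:ℝ) 1 ×ˢ Set.Ioo (-Real.pi) Real.pi).indicator 1 p := by
        rw [← lintegral_indicator polarCoord.open_target.measurableSet]
        refine lintegral_mono fun p => ?_
        simp only [Set.indicator, polarCoord_target]
        split_ifs <;> simp_all
    _ < ⊤ := by
        rw [lintegral_indicator_one (by measurability), Measure.volume_eq_prod, Measure.prod_prod]
        simp

lemma norm_cauchyKernel_le {z : ℂ} (hz : z ∉ Metric.ball (0 : ℂ) 1) : ‖cauchyKernel z‖ ≤ 1 := by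
  have h1 : 1 ≤ ‖z‖ := by simpa using hz
  rw [cauchyKernel, norm_inv, norm_mul, Complex.norm_real, Real.norm_of_nonneg Real.pi_pos.le]
  exact inv_le_one_of_one_le₀ (by nlinarith [Real.pi_gt_three])

/-- A bound for the integral of the Cauchy kernel over every disc of radius `2`. -/
def cauchyConst : ℝ :=
  (∫ z in Metric.ball (0 : ℂ) 1, ‖cauchyKernel z‖) + (volume (Metric.closedBall (0 : ℂ) 2)).toReal

lemma measurable_cauchyKernel : Measurable cauchyKernel := by unfold cauchyKernel; fun_prop

lemma locallyIntegrable_cauchyKernel : LocallyIntegrable cauchyKernel := by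
  rw [locallyIntegrable_iff]
  intro K hK
  have h1 : IntegrableOn cauchyKernel (K ∩ Metric.ball 0 1) :=
    integrableOn_cauchyKernel.mono_set Set.inter_subset_right
  have h2 : IntegrableOn cauchyKernel (K \ Metric.ball 0 1) := by
    refine Measure.integrableOn_of_bounded (M := 1) ?_ measurable_cauchyKernel.aestronglyMeasurable ?_
    · exact ((measure_mono Set.sdiff_subset).trans_lt hK.measure_lt_top).ne
    · refine (ae_restrict_iff' (hK.measurableSet.diff Metric.isOpen_ball.measurableSet)).2 ?_
      exact Eventually.of_forall fun z hz => norm_cauchyKernel_le hz.2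
  simpa [Set.inter_union_sdiff] using h1.union h2

lemma cauchyConst_nonneg : 0 ≤ cauchyConst :=
  add_nonneg (integral_nonneg fun _ => norm_nonneg _) ENNReal.toReal_nonneg

lemma integral_norm_cauchyKernel_le (x : ℂ) :
    ∫ z in Metric.closedBall x 2, ‖cauchyKernel z‖ ≤ cauchyConst := by
  have hB : MeasurableSet (Metric.ball (0 : ℂ) 1) := Metric.isOpen_ball.measurableSet
  have hK := (locallyIntegrable_cauchyKernel.integrableOn_isCompact
    (isCompact_closedBall x 2)).norm
  rw [← integral_inter_add_sdiff hB hK, cauchyConst]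
  refine add_le_add ?_ ?_
  · exact setIntegral_mono_set integrableOn_cauchyKernel.norm
      (Eventually.of_forall fun _ => norm_nonneg _) (Eventually.of_forall Set.inter_subset_right)
  · have hfin : volume (Metric.closedBall x 2 \ Metric.ball (0 : ℂ) 1) < ⊤ :=
      (measure_mono Set.sdiff_subset).trans_lt (isCompact_closedBall x 2).measure_lt_top
    calc _ ≤ ∫ z in Metric.closedBall x 2 \ Metric.ball (0 : ℂ) 1, (1 : ℝ) := by
          refine setIntegral_mono_on (IntegrableOn.mono_set hK Set.sdiff_subset)
            (integrableOn_const hfin.ne) (Metric.isClosed_closedBall.measurableSet.diff hB) ?_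
          exact fun z hz => norm_cauchyKernel_le hz.2
      _ ≤ _ := by
          rw [setIntegral_const, smul_eq_mul, mul_one, measureReal_def]
          refine ENNReal.toReal_mono (isCompact_closedBall _ _).measure_lt_top.ne ?_
          rw [← Measure.addHaar_closedBall_center volume x]
          exact measure_mono Set.sdiff_subset

lemma norm_cauchyT_le {h : ℂ → E} {b : ℝ} (hs : ∀ z, z ∉ Metric.closedBall (0 : ℂ) 2 → h z = 0)
    (hb : ∀ z, ‖h z‖ ≤ b) (x : ℂ) : ‖cauchyT h x‖ ≤ cauchyConst * b := by
  have hb0 : 0 ≤ b := (norm_nonneg _).trans (hb 0)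
  have hK := (locallyIntegrable_cauchyKernel.integrableOn_isCompact
    (isCompact_closedBall x 2)).norm
  have hs' : ∀ t, t ∉ Metric.closedBall x 2 → h (x - t) = 0 := by
    intro t ht
    apply hs
    simpa [dist_eq_norm, norm_sub_rev] using ht
  calc ‖cauchyT h x‖ = ‖∫ t in Metric.closedBall x 2, cauchyKernel t • h (x - t)‖ := by
        rw [setIntegral_eq_integral_of_forall_compl_eq_zero]
        · rfl
        · intro t ht; rw [hs' t ht, smul_zero]
    _ ≤ ∫ t in Metric.closedBall x 2, ‖cauchyKernel t‖ * b := by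
        refine norm_integral_le_of_norm_le (hK.mul_const b) (Eventually.of_forall fun t => ?_)
        rw [norm_smul]
        exact mul_le_mul_of_nonneg_left (hb _) (norm_nonneg _)
    _ ≤ _ := by
        rw [integral_mul_const]
        exact mul_le_mul_of_nonneg_right (integral_norm_cauchyKernel_le x) hb0

lemma contDiff_cauchyT {n : ℕ} {h : ℂ → E} (hs : HasCompactSupport h) (hh : ContDiff ℝ n h) :
    ContDiff ℝ n (cauchyT h) := by
  have := hs.contDiff_convolution_right (n := (n : ℕ∞)) (ContinuousLinearMap.lsmul ℝ ℂ)
    locallyIntegrable_cauchyKernel (by exact_mod_cast hh)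
  exact_mod_cast this

lemma hasFDerivAt_cauchyT {h : ℂ → E} (hs : HasCompactSupport h) (hh : ContDiff ℝ 1 h) (x : ℂ) :
    HasFDerivAt (cauchyT h) (cauchyT (fderiv ℝ h) x) x := by
  have := hs.hasFDerivAt_convolution_right (ContinuousLinearMap.lsmul ℝ ℂ)
    locallyIntegrable_cauchyKernel hh x
  exact this

/-- Differentiation commutes with the Cauchy transform, so a bound on the `i`-th derivative of
the data is a bound on the `i`-th derivative of the transform. -/
lemma norm_iteratedFDeriv_cauchyT_le (i : ℕ) : ∀ {E : Type*} [NormedAddCommGroup E]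
    [NormedSpace ℂ E] [CompleteSpace E] {h : ℂ → E} {b : ℝ},
    (∀ z, z ∉ Metric.closedBall (0 : ℂ) 2 → h z = 0) → ContDiff ℝ i h →
    (∀ z, ‖iteratedFDeriv ℝ i h z‖ ≤ b) → ∀ x,
    ‖iteratedFDeriv ℝ i (cauchyT h) x‖ ≤ cauchyConst * b := by
  induction i with
  | zero =>
    intro E _ _ _ h b hs _ hb x
    rw [norm_iteratedFDeriv_zero]
    exact norm_cauchyT_le hs (fun z => by simpa using hb z) x
  | succ i ih =>
    intro E _ _ _ h b hs hh hb x
    have hcs : HasCompactSupport h :=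
      HasCompactSupport.intro (isCompact_closedBall _ _) hs
    have hfd : fderiv ℝ (cauchyT h) = cauchyT (fderiv ℝ h) := by
      funext y
      exact (hasFDerivAt_cauchyT hcs (hh.of_le (by norm_cast; omega)) y).fderiv
    rw [← norm_iteratedFDeriv_fderiv, hfd]
    refine ih (fun z hz => ?_) ?_ (fun z => ?_) x
    · have hsub : Function.support h ⊆ Metric.closedBall (0 : ℂ) 2 :=
        fun y hy => by_contra fun hy' => hy (hs y hy')
      exact fderiv_of_notMem_tsupport (𝕜 := ℝ)
        fun hz' => hz (closure_minimal hsub Metric.isClosed_closedBall hz')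
    · exact hh.fderiv_right (by norm_cast)
    · rw [norm_iteratedFDeriv_fderiv]; exact hb z

variable [CompleteSpace E]

/-- In polar coordinates `t = r e^{iθ}` the integrand is `(∂_r g + (i / r) ∂_θ g) / (2π)`; the
radial part integrates to `- g 0` and the angular one to `0`. -/
lemma integral_cauchyKernel_smul_dbar {g : ℂ → E} (hs : HasCompactSupport g)
    (hg : ContDiff ℝ 1 g) : ∫ t, cauchyKernel t • dbar g t = - g 0 := by
  have hD : Continuous (fderiv ℝ g) := hg.continuous_fderiv (by norm_num)
  let u : ℝ → ℂ := fun θ => Complex.exp (θ * Complex.I)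
  have hu : Continuous u := by fun_prop
  let F : ℂ → ℝ × ℝ → E := fun c p => fderiv ℝ g (p.1 * u p.2) (c * u p.2)
  have hF : ∀ c, Continuous (F c) := fun c => by
    have h1 : Continuous fun p : ℝ × ℝ => fderiv ℝ g (p.1 * u p.2) := by fun_prop
    have h2 : Continuous fun p : ℝ × ℝ => c * u p.2 := by fun_prop
    exact h1.clm_apply h2
  obtain ⟨R, hR0, hR⟩ : ∃ R : ℝ, 0 ≤ R ∧ ∀ z : ℂ, R < ‖z‖ → fderiv ℝ g z = 0 := by
    obtain ⟨R, hR⟩ := (hs.fderiv (𝕜 := ℝ)).isCompact.isBounded.exists_norm_le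
    refine ⟨max R 0, le_max_right _ _, fun z hz => image_eq_zero_of_notMem_tsupport fun hz' => ?_⟩
    exact absurd (hR z hz') (not_le.2 ((le_max_left _ _).trans_lt hz))
  have hu1 : ∀ θ, ‖u θ‖ = 1 := fun θ => Complex.norm_exp_ofReal_mul_I θ
  have hFint : ∀ c, IntegrableOn (F c) (Set.Ioi (0:ℝ) ×ˢ Set.Ioo (-Real.pi) Real.pi) := by
    intro c
    have h1 : IntegrableOn (F c) (Set.Icc (0:ℝ) R ×ˢ Set.Icc (-Real.pi) Real.pi) :=
      (hF c).continuousOn.integrableOn_compact (isCompact_Icc.prod isCompact_Icc)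
    refine h1.of_forall_sdiff_eq_zero (by measurability) fun p hp => ?_
    have : R < p.1 := by
      by_contra hle
      exact hp.2 ⟨⟨hp.1.1.le, not_lt.1 hle⟩, ⟨hp.1.2.1.le, hp.1.2.2.le⟩⟩
    simp only [F]
    rw [hR]
    · rfl
    · rw [norm_mul, hu1, mul_one, Complex.norm_real]
      exact this.trans_le (le_abs_self _)
  have key : ∀ (L : ℂ →L[ℝ] E) (v : ℂ), ‖v‖ = 1 →
      v⁻¹ • (L 1 + Complex.I • L Complex.I) = L v + Complex.I • L (Complex.I * v) := by
    intro L v hv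
    have hlin : ∀ w : ℂ, L w = (w.re : ℂ) • L 1 + (w.im : ℂ) • L Complex.I := by
      intro w
      conv_lhs => rw [show w = w.re • (1 : ℂ) + w.im • Complex.I by
        simp [Complex.re_add_im]]
      rw [map_add, map_smul, map_smul, Complex.coe_smul, Complex.coe_smul]
    have hinv : v⁻¹ = (v.re : ℂ) - v.im * Complex.I := by
      rw [Complex.inv_def, Complex.normSq_eq_norm_sq, hv]
      apply Complex.ext <;> simp
    rw [hlin v, hlin (Complex.I * v), hinv]
    simp only [Complex.mul_re, Complex.mul_im, Complex.I_re, Complex.I_im, zero_mul, one_mul,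
      zero_sub, zero_add, Complex.ofReal_neg, smul_add, smul_smul, sub_smul]
    rw [show ((v.re : ℂ) - v.im * Complex.I) * Complex.I = v.im + v.re * Complex.I by
      linear_combination (-(v.im : ℂ)) * Complex.I_mul_I]
    module
  rw [← Complex.integral_comp_polarCoord_symm, polarCoord_target]
  have hpi : (Real.pi : ℂ) ≠ 0 := by exact_mod_cast Real.pi_ne_zero
  have heq : ∀ p ∈ Set.Ioi (0:ℝ) ×ˢ Set.Ioo (-Real.pi) Real.pi,
      p.1 • (cauchyKernel (Complex.polarCoord.symm p) • dbar g (Complex.polarCoord.symm p)) =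
        (1 / (2 * Real.pi) : ℂ) • F 1 p + (Complex.I / (2 * Real.pi)) • F Complex.I p := by
    intro p hp
    have hp1 : (p.1 : ℂ) ≠ 0 := by
      have : 0 < p.1 := hp.1
      exact_mod_cast this.ne'
    have hsym : Complex.polarCoord.symm p = p.1 * u p.2 := by
      rw [Complex.polarCoord_symm_apply]; simp only [u, Complex.exp_mul_I]
      push_cast; ring
    have hu0 : u p.2 ≠ 0 := Complex.exp_ne_zero _
    have := key (fderiv ℝ g (p.1 * u p.2)) (u p.2) (hu1 _)
    rw [hsym, dbar]
    simp only [F]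
    rw [one_mul, ← Complex.coe_smul, smul_smul, smul_smul, cauchyKernel,
      show (p.1 : ℂ) * ((Real.pi : ℂ) * (p.1 * u p.2))⁻¹ * (1 / 2) =
        (1 / (2 * Real.pi)) * (u p.2)⁻¹ by field_simp, ← smul_smul, this, smul_add, smul_smul]
    congr 2
    ring
  have hFc : ∀ c a : ℂ, Integrable (fun p => a • F c p)
      (volume.restrict (Set.Ioi (0:ℝ) ×ˢ Set.Ioo (-Real.pi) Real.pi)) :=
    fun c a => (hFint c).integrable.smul a
  rw [setIntegral_congr_fun (by measurability) heq, integral_add (hFc _ _) (hFc _ _),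
    integral_smul, integral_smul, Measure.volume_eq_prod]
  -- the radial part, by the fundamental theorem of calculus on each ray
  have hrad : ∫ p in Set.Ioi (0:ℝ) ×ˢ Set.Ioo (-Real.pi) Real.pi, F 1 p ∂(volume.prod volume) =
      -((2 * Real.pi : ℂ) • g 0) := by
    have hint := hFint 1
    rw [IntegrableOn, Measure.volume_eq_prod, ← Measure.prod_restrict] at hint
    rw [← Measure.prod_restrict, integral_prod_symm _ hint]
    have hr : ∀ θ : ℝ, ∫ r in Set.Ioi (0:ℝ), F 1 (r, θ) = -g 0 := by
      intro θ
      let f : ℝ → E := fun r => g (r * u θ)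
      have hl : ContDiff ℝ 1 fun r : ℝ => (r : ℂ) * u θ :=
        Complex.ofRealCLM.contDiff.mul contDiff_const
      have hf : ContDiff ℝ 1 f := hg.comp hl
      have hfs : HasCompactSupport f := by
        obtain ⟨R', hR'⟩ := hs.isCompact.isBounded.exists_norm_le
        refine HasCompactSupport.intro (isCompact_Icc (a := -R') (b := R')) fun r hr => ?_
        refine image_eq_zero_of_notMem_tsupport (f := g) fun hmem => hr ?_
        have := hR' _ hmem
        rw [norm_mul, hu1, mul_one, Complex.norm_real] at this
        exact abs_le.1 this
      have hd : ∀ r : ℝ, deriv f r = F 1 (r, θ) := by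
        intro r
        have h1 : HasDerivAt (fun r : ℝ => (r : ℂ) * u θ) (1 * u θ) r :=
          (Complex.ofRealCLM.hasDerivAt (x := r)).mul_const (u θ)
        exact ((hg.differentiable (by norm_num) (r * u θ)).hasFDerivAt.comp_hasDerivAt r h1).deriv
      have := HasCompactSupport.integral_Ioi_deriv_eq hf hfs 0
      simp only [hd] at this
      rw [this]
      simp [f]
    simp only [hr]
    rw [setIntegral_const, measureReal_def, Real.volume_Ioo, ← Complex.coe_smul, smul_neg]
    rw [ENNReal.toReal_ofReal (by linarith [Real.pi_pos])]
    congr 2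
    push_cast; ring
  -- the angular part, an integral of a derivative over each circle
  have hang : ∫ p in Set.Ioi (0:ℝ) ×ˢ Set.Ioo (-Real.pi) Real.pi,
      F Complex.I p ∂(volume.prod volume) = 0 := by
    rw [setIntegral_prod _ (hFint _)]
    refine setIntegral_eq_zero_of_forall_eq_zero fun r hr => ?_
    have hr0 : (0:ℝ) < r := hr
    rw [← integral_Ioc_eq_integral_Ioo, ← intervalIntegral.integral_of_le
      (by linarith [Real.pi_pos])]
    have hd : ∀ θ : ℝ, HasDerivAt (fun θ : ℝ => r⁻¹ • g (r * u θ)) (F Complex.I (r, θ)) θ := by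
      intro θ
      have h1 : HasDerivAt u (u θ * Complex.I) θ := by
        have := ((Complex.ofRealCLM.hasDerivAt (x := θ)).mul_const Complex.I).cexp
        simpa [u] using this
      have h2 := (hg.differentiable (by norm_num) (r * u θ)).hasFDerivAt.comp_hasDerivAt θ
        (h1.const_mul (r : ℂ))
      refine (h2.const_smul r⁻¹).congr_deriv ?_
      change r⁻¹ • fderiv ℝ g (r * u θ) _ = fderiv ℝ g (r * u θ) (Complex.I * u θ)
      rw [← map_smul]
      congr 1
      rw [Complex.real_smul]
      have : (r : ℂ) ≠ 0 := by exact_mod_cast hr0.ne'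
      push_cast
      field_simp
    rw [intervalIntegral.integral_eq_sub_of_hasDerivAt (fun θ _ => hd θ)]
    · have : u Real.pi = u (-Real.pi) := by simp [u, Complex.exp_neg]
      rw [this, sub_self]
    · have hc : Continuous fun θ : ℝ => F Complex.I (r, θ) := (hF _).comp (by fun_prop)
      exact hc.intervalIntegrable _ _
  rw [hrad, hang, smul_zero, add_zero, smul_neg, smul_smul]
  rw [one_div, inv_mul_cancel₀ (by simp [hpi]), one_smul]

/-- The Cauchy–Pompeiu formula: the Cauchy transform solves `∂₋ u = h`. -/
lemma dbar_cauchyT {h : ℂ → E} (hs : HasCompactSupport h) (hh : ContDiff ℝ 1 h) (x : ℂ) :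
    dbar (cauchyT h) x = h x := by
  let g : ℂ → E := fun t => h (x - t)
  have hgs : HasCompactSupport g := hs.comp_homeomorph (Homeomorph.subLeft x)
  have hg : ContDiff ℝ 1 g := hh.comp (contDiff_const.sub contDiff_id)
  have hgd : ∀ t, fderiv ℝ g t = -fderiv ℝ h (x - t) := by
    intro t
    have h1 := (hh.differentiable (by norm_num) (x - t)).hasFDerivAt.comp t
      ((hasFDerivAt_id t).const_sub x)
    have : HasFDerivAt g (-fderiv ℝ h (x - t)) t := by
      have h2 : -fderiv ℝ h (x - t) =
          (fderiv ℝ h (x - t)).comp (-ContinuousLinearMap.id ℝ ℂ) := by ext v; simp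
      rw [h2]
      exact h1
    exact this.fderiv
  have key := integral_cauchyKernel_smul_dbar hgs hg
  have hci : ∀ v : ℂ, Integrable fun t => cauchyKernel t • fderiv ℝ h (x - t) v := by
    intro v
    have h1 : HasCompactSupport fun y => fderiv ℝ h y v := (hs.fderiv (𝕜 := ℝ)).comp_left
      (g := fun L : ℂ →L[ℝ] E => L v) rfl
    have h2 : Continuous fun y => fderiv ℝ h y v :=
      (hh.continuous_fderiv (by norm_num)).clm_apply continuous_const
    exact h1.convolutionExists_right (ContinuousLinearMap.lsmul ℝ ℂ)
      locallyIntegrable_cauchyKernel h2 x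
  have happ : ∀ v : ℂ, fderiv ℝ (cauchyT h) x v = ∫ t, cauchyKernel t • fderiv ℝ h (x - t) v := by
    intro v
    rw [(hasFDerivAt_cauchyT hs hh x).fderiv]
    have h2 : ConvolutionExistsAt cauchyKernel (fderiv ℝ h) x
        (ContinuousLinearMap.lsmul ℝ ℂ) volume :=
      (hs.fderiv (𝕜 := ℝ)).convolutionExists_right _ locallyIntegrable_cauchyKernel
        (hh.continuous_fderiv (by norm_num)) x
    exact ContinuousLinearMap.integral_apply h2 v
  have hciI : Integrable fun t => Complex.I • cauchyKernel t • fderiv ℝ h (x - t) Complex.I :=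
    (hci _).smul Complex.I
  rw [dbar, happ, happ, ← integral_smul, ← integral_add (hci 1) hciI,
    ← integral_smul]
  rw [show h x = g 0 by simp [g], ← neg_neg (g 0), ← key, ← integral_neg]
  congr 1
  funext t
  simp only [dbar, hgd, neg_apply]
  rw [smul_comm Complex.I (cauchyKernel t), ← smul_add, smul_comm]
  module

end CauchyTransform

/-! ### Local gauges and zeros of solutions of `∂₋ A = [A, C]` -/

section Gauge

variable {𝔸 : Type*} [NormedRing 𝔸] [NormedAlgebra ℂ 𝔸]

lemma dbar_mul {f g : ℂ → 𝔸} {z : ℂ} (hf : DifferentiableAt ℝ f z)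
    (hg : DifferentiableAt ℝ g z) :
    dbar (fun y => f y * g y) z = dbar f z * g z + f z * dbar g z := by
  have h : fderiv ℝ (fun y => f y * g y) z = _ := fderiv_mul' hf hg
  simp only [dbar, h, add_apply, smul_apply, smul_eq_mul,
    MulOpposite.smul_eq_mul_unop, MulOpposite.unop_op]
  simp only [smul_add, add_mul, mul_add, smul_mul_assoc, mul_smul_comm]
  abel

/-- The terms `G_{j+1} = T (M G_j)`, `G_0 = 1`, of the Neumann series that solves `∂₋ G = M G`. -/
def gaugeTerm (M : ℂ → 𝔸) : ℕ → ℂ → 𝔸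
  | 0 => fun _ => 1
  | j + 1 => cauchyT fun z => M z * gaugeTerm M j z

lemma contDiff_gaugeTerm {r : ℕ} {M : ℂ → 𝔸} (hM : ContDiff ℝ r M)
    (hs : ∀ z, z ∉ Metric.closedBall (0 : ℂ) 2 → M z = 0) (j : ℕ) :
    ContDiff ℝ r (gaugeTerm M j) := by
  induction j with
  | zero => exact contDiff_const
  | succ j ih =>
    refine contDiff_cauchyT ?_ (hM.mul ih)
    exact HasCompactSupport.intro (isCompact_closedBall _ _) fun z hz => by rw [hs z hz, zero_mul]

/-- The cut-off rescalings `y ↦ χ(y) M(p + t y)`, `0 ≤ t ≤ 1`, of a function are bounded with their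
derivatives, uniformly in `t`. -/
lemma exists_rescale_bound (r : ℕ) {M : ℂ → 𝔸} (hM : ContDiff ℝ r M) (p : ℂ)
    (χ : ContDiffBump (0 : ℂ)) (hχ : χ.rOut = 2) :
    ∃ B : ℝ, 0 ≤ B ∧ ∀ t ∈ Set.Icc (0 : ℝ) 1, ∀ i ≤ r, ∀ y : ℂ,
      ‖iteratedFDeriv ℝ i (fun y => (χ y) • M (p + t * y)) y‖ ≤ B := by
  let F : ℝ × ℂ → 𝔸 := fun x => (χ x.2) • M (p + x.1 * x.2)
  have hF : ContDiff ℝ r F := by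
    refine (χ.contDiff.comp contDiff_snd).smul (hM.comp ?_)
    exact contDiff_const.add ((Complex.ofRealCLM.contDiff.comp contDiff_fst).mul contDiff_snd)
  have hK : IsCompact (Set.Icc (0 : ℝ) 1 ×ˢ Metric.closedBall (0 : ℂ) 2) :=
    isCompact_Icc.prod (isCompact_closedBall _ _)
  have hb : ∀ i : ℕ, ∃ b : ℝ, 0 ≤ b ∧ (i ≤ r → ∀ x ∈ Set.Icc (0 : ℝ) 1 ×ˢ
      Metric.closedBall (0 : ℂ) 2, ‖iteratedFDeriv ℝ i F x‖ ≤ b) := by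
    intro i
    by_cases hi : i ≤ r
    · obtain ⟨b, hb⟩ := hK.exists_bound_of_continuousOn
        (hF.continuous_iteratedFDeriv (m := i) (by exact_mod_cast hi)).continuousOn
      exact ⟨max b 0, le_max_right _ _, fun _ x hx => (hb x hx).trans (le_max_left _ _)⟩
    · exact ⟨0, le_rfl, fun h => absurd h hi⟩
  choose b hb0 hb using hb
  refine ⟨∑ i ∈ Finset.range (r + 1), b i, Finset.sum_nonneg fun i _ => hb0 i, ?_⟩
  intro t ht i hi y
  by_cases hy : y ∈ Metric.closedBall (0 : ℂ) 2
  · have hcomp : (fun y : ℂ => (χ y) • M (p + t * y)) =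
        (fun x => F ((t, 0) + x)) ∘ ContinuousLinearMap.inr ℝ ℝ ℂ := by
      funext y; simp [F]
    have hF' : ContDiff ℝ r fun x => F ((t, 0) + x) := hF.comp (contDiff_const.add contDiff_id)
    rw [hcomp, ContinuousLinearMap.iteratedFDeriv_comp_right _ hF' y (by exact_mod_cast hi),
      iteratedFDeriv_comp_add_left]
    refine (ContinuousMultilinearMap.norm_compContinuousLinearMap_le _ _).trans ?_
    have h1 : ∏ _j : Fin i, ‖ContinuousLinearMap.inr ℝ ℝ ℂ‖ ≤ 1 :=
      Finset.prod_le_one (fun _ _ => norm_nonneg _)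
        fun _ _ => ContinuousLinearMap.norm_inr_le_one ℝ ℝ ℂ
    refine (mul_le_of_le_one_right (norm_nonneg _) h1).trans ?_
    refine (hb i hi _ (by simpa using ⟨ht, by simpa using hy⟩)).trans ?_
    exact Finset.single_le_sum (f := b) (fun j _ => hb0 j) (Finset.mem_range_succ_iff.2 hi)
  · have hz : y ∉ tsupport fun y : ℂ => (χ y) • M (p + t * y) := by
      have hsub : Function.support (fun y : ℂ => (χ y) • M (p + t * y)) ⊆
          Metric.closedBall (0 : ℂ) 2 := fun x hx => by
        by_contra hx'
        refine hx ?_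
        change (χ x) • M (p + t * x) = 0
        rw [χ.zero_of_le_dist (hχ ▸ (not_le.1 hx').le), zero_smul]
      exact fun hy' => hy (closure_minimal hsub Metric.isClosed_closedBall hy')
    have := image_eq_zero_of_notMem_tsupport fun h => hz (tsupport_iteratedFDeriv_subset (𝕜 := ℝ) i h)
    rw [this, norm_zero]
    exact Finset.sum_nonneg fun i _ => hb0 i

variable [CompleteSpace 𝔸]

lemma norm_iteratedFDeriv_gaugeTerm_le {r : ℕ} {M : ℂ → 𝔸} {ε q : ℝ} (hM : ContDiff ℝ r M)
    (hs : ∀ z, z ∉ Metric.closedBall (0 : ℂ) 2 → M z = 0)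
    (hε : ∀ i ≤ r, ∀ z, ‖iteratedFDeriv ℝ i M z‖ ≤ ε)
    (hq : cauchyConst * (2 ^ r * ε) ≤ q) (j : ℕ) :
    ∀ i ≤ r, ∀ z, ‖iteratedFDeriv ℝ i (gaugeTerm M j) z‖ ≤ ‖(1 : 𝔸)‖ * q ^ j := by
  have hε0 : 0 ≤ ε := (norm_nonneg _).trans (hε 0 (Nat.zero_le _) 0)
  have hq0 : 0 ≤ q := (mul_nonneg cauchyConst_nonneg (by positivity)).trans hq
  induction j with
  | zero =>
    intro i _ z
    rcases Nat.eq_zero_or_pos i with rfl | hi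
    · simp [gaugeTerm]
    · have : gaugeTerm M 0 = fun _ => (1 : 𝔸) := rfl
      rw [this, iteratedFDeriv_const_of_ne hi.ne']
      simp
  | succ j ih =>
    intro i hi z
    have hG := contDiff_gaugeTerm hM hs j
    have hir : (i : WithTop ℕ∞) ≤ r := by exact_mod_cast hi
    have hb : ∀ y, ‖iteratedFDeriv ℝ i (fun z => M z * gaugeTerm M j z) y‖ ≤
        2 ^ r * ε * (‖(1 : 𝔸)‖ * q ^ j) := by
      intro y
      refine (norm_iteratedFDeriv_mul_le hM hG y hir).trans ?_
      calc _ ≤ ∑ l ∈ Finset.range (i + 1), (i.choose l : ℝ) * ε * (‖(1 : 𝔸)‖ * q ^ j) := by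
            refine Finset.sum_le_sum fun l hl => ?_
            have hl' : l ≤ r := (Finset.mem_range_succ_iff.1 hl).trans hi
            gcongr
            · exact hε l hl' y
            · exact ih _ ((Nat.sub_le _ _).trans hi) y
        _ = 2 ^ i * ε * (‖(1 : 𝔸)‖ * q ^ j) := by
            rw [← Finset.sum_mul, ← Finset.sum_mul]
            congr 2
            exact_mod_cast Nat.sum_range_choose i
        _ ≤ _ := by gcongr; norm_num
    refine (norm_iteratedFDeriv_cauchyT_le i (fun y hy => by rw [hs y hy, zero_mul])
      ((hM.mul hG).of_le hir) hb z).trans ?_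
    calc _ = (cauchyConst * (2 ^ r * ε)) * (‖(1 : 𝔸)‖ * q ^ j) := by ring
      _ ≤ q * (‖(1 : 𝔸)‖ * q ^ j) := by gcongr
      _ = _ := by ring

/-- The equation `∂₋ G = M G` has an invertible solution if `M` is small with its derivatives:
the Neumann series converges with all derivatives up to order `r`. -/
lemma exists_gauge_of_small {r : ℕ} (hr : 1 ≤ r) {M : ℂ → 𝔸} {ε q : ℝ} (hM : ContDiff ℝ r M)
    (hs : ∀ z, z ∉ Metric.closedBall (0 : ℂ) 2 → M z = 0)
    (hε : ∀ i ≤ r, ∀ z, ‖iteratedFDeriv ℝ i M z‖ ≤ ε)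
    (hq : cauchyConst * (2 ^ r * ε) ≤ q) (hq1 : q < 1) (hq2 : ‖(1 : 𝔸)‖ * q < 1 - q) :
    ∃ G : ℂ → 𝔸, ContDiff ℝ r G ∧ (∀ z, dbar G z = M z * G z) ∧ ∀ z, IsUnit (G z) := by
  have hε0 : 0 ≤ ε := (norm_nonneg _).trans (hε 0 (Nat.zero_le _) 0)
  have hq0 : 0 ≤ q := (mul_nonneg cauchyConst_nonneg (by positivity)).trans hq
  have hgeo : Summable fun j => ‖(1 : 𝔸)‖ * q ^ j :=
    (summable_geometric_of_lt_one hq0 hq1).mul_left _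
  have hbd := norm_iteratedFDeriv_gaugeTerm_le hM hs hε hq
  have hcd := contDiff_gaugeTerm hM hs
  have hr1 : (1 : WithTop ℕ∞) ≤ (r : WithTop ℕ∞) := by exact_mod_cast hr
  have h0 : ∀ j z, ‖gaugeTerm M j z‖ ≤ ‖(1 : 𝔸)‖ * q ^ j := fun j z => by
    simpa using hbd j 0 (Nat.zero_le _) z
  have h1 : ∀ j z, ‖fderiv ℝ (gaugeTerm M j) z‖ ≤ ‖(1 : 𝔸)‖ * q ^ j := fun j z => by
    simpa [norm_iteratedFDeriv_one] using hbd j 1 hr z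
  have hsum0 : ∀ z, Summable fun j => gaugeTerm M j z := fun z => .of_norm_bounded hgeo (h0 · z)
  have hsum1 : ∀ z, Summable fun j => fderiv ℝ (gaugeTerm M j) z :=
    fun z => .of_norm_bounded hgeo (h1 · z)
  refine ⟨fun z => ∑' j, gaugeTerm M j z, ?_, fun z => ?_, fun z => ?_⟩
  · have := contDiff_tsum (𝕜 := ℝ) (N := (r : ℕ∞)) (f := gaugeTerm M)
      (v := fun _ j => ‖(1 : 𝔸)‖ * q ^ j) (fun j => by exact_mod_cast hcd j) (fun _ _ => hgeo)
      (fun k j x hk => hbd j k (by exact_mod_cast hk) x)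
    exact_mod_cast this
  · have hfd := fderiv_tsum_apply (𝕜 := ℝ) hgeo (fun j => (hcd j).differentiable (by positivity))
      h1 (hsum0 0) z
    have happ : ∀ v : ℂ, (∑' j, fderiv ℝ (gaugeTerm M j) z) v =
        ∑' j, fderiv ℝ (gaugeTerm M j) z v := fun v =>
      (ContinuousLinearMap.apply ℝ 𝔸 v).map_tsum (hsum1 z)
    have hsv : ∀ v : ℂ, Summable fun j => fderiv ℝ (gaugeTerm M j) z v := fun v =>
      (ContinuousLinearMap.apply ℝ 𝔸 v).summable (hsum1 z)
    have hterm : dbar (fun z => ∑' j, gaugeTerm M j z) z = ∑' j, dbar (gaugeTerm M j) z := by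
      simp only [dbar]
      rw [hfd, happ, happ, ← (hsv _).tsum_const_smul, ← (hsv 1).tsum_add ((hsv _).const_smul _),
        ← ((hsv 1).add ((hsv _).const_smul _)).tsum_const_smul]
    have hds : Summable fun j => dbar (gaugeTerm M j) z :=
      ((hsv 1).add ((hsv _).const_smul _)).const_smul _
    rw [hterm, hds.tsum_eq_zero_add]
    have hz : dbar (gaugeTerm M 0) z = 0 := by
      have : gaugeTerm M 0 = fun _ => (1 : 𝔸) := rfl
      simp [dbar, this]
    have hsucc : ∀ j, dbar (gaugeTerm M (j + 1)) z = M z * gaugeTerm M j z := fun j =>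
      dbar_cauchyT (HasCompactSupport.intro (isCompact_closedBall 0 2)
        fun z hz => by rw [hs z hz, zero_mul]) ((hM.mul (hcd j)).of_le hr1) z
    simp only [hz, zero_add, hsucc]
    exact (hsum0 z).tsum_mul_left _
  · have hle : ‖∑' j, gaugeTerm M (j + 1) z‖ ≤ ‖(1 : 𝔸)‖ * q * (1 - q)⁻¹ := by
      refine tsum_of_norm_bounded (g := fun j => ‖(1 : 𝔸)‖ * q * q ^ j) ?_ fun j => ?_
      · exact (hasSum_geometric_of_lt_one hq0 hq1).mul_left _
      · exact (h0 (j + 1) z).trans_eq (by ring)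
    have hlt : ‖∑' j, gaugeTerm M (j + 1) z‖ < 1 := by
      refine hle.trans_lt ?_
      rw [← div_eq_mul_inv, div_lt_one (by linarith)]
      exact hq2
    change IsUnit (∑' j, gaugeTerm M j z)
    rw [(hsum0 z).tsum_eq_zero_add]
    have := isUnit_one_sub_of_norm_lt_one (x := -∑' j, gaugeTerm M (j + 1) z) (by rwa [norm_neg])
    simpa [gaugeTerm] using this

/-- Local solvability of `∂₋ G = M G` near every point, with `G` invertible and of the class of
`M`: a trivialization of the holomorphic structure `∂₋ - M`. -/
theorem exists_gauge {r : ℕ} (hr : 1 ≤ r) {M : ℂ → 𝔸} (hM : ContDiff ℝ r M) (p : ℂ) :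
    ∃ G : ℂ → 𝔸, ContDiff ℝ r G ∧ (∀ᶠ z in 𝓝 p, dbar G z = M z * G z) ∧
      ∀ z, IsUnit (G z) := by
  -- in the coordinate `y = (z - p) / t` the coefficient becomes `t M`, which is small for small `t`
  let χ : ContDiffBump (0 : ℂ) := ⟨1, 2, one_pos, one_lt_two⟩
  obtain ⟨B, hB0, hB⟩ := exists_rescale_bound r hM p χ rfl
  let q : ℝ := 1 / (2 * (‖(1 : 𝔸)‖ + 1))
  have hq0 : 0 < q := by positivity
  have hq1 : (‖(1 : 𝔸)‖ + 1) * q = 1 / 2 := by simp only [q]; field_simp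
  let D : ℝ := cauchyConst * (2 ^ r * B) + 1
  have hD : 1 ≤ D := by
    have := mul_nonneg cauchyConst_nonneg (show 0 ≤ 2 ^ r * B by positivity)
    simp only [D]; linarith
  let t : ℝ := min 1 (q / D)
  have ht0 : 0 < t := lt_min one_pos (by positivity)
  have ht1 : t ≤ 1 := min_le_left _ _
  have htD : t * D ≤ q := by
    have := min_le_right 1 (q / D)
    calc t * D ≤ q / D * D := by gcongr
      _ = q := by field_simp
  let M₀ : ℂ → 𝔸 := fun y => (χ y) • M (p + t * y)
  have hM₀ : ContDiff ℝ r M₀ := χ.contDiff.smul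
    (hM.comp (contDiff_const.add (contDiff_const.mul contDiff_id)))
  let M₁ : ℂ → 𝔸 := fun y => t • M₀ y
  have hM₁ : ContDiff ℝ r M₁ := contDiff_const.smul hM₀
  have hs₁ : ∀ z, z ∉ Metric.closedBall (0 : ℂ) 2 → M₁ z = 0 := by
    intro y hy
    simp only [M₁, M₀]
    rw [χ.zero_of_le_dist (not_le.1 hy).le, zero_smul, smul_zero]
  have hb₁ : ∀ i ≤ r, ∀ z, ‖iteratedFDeriv ℝ i M₁ z‖ ≤ t * B := by
    intro i hi z
    have hc : ContDiffAt ℝ i M₀ z := (hM₀.of_le (by exact_mod_cast hi)).contDiffAt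
    have : iteratedFDeriv ℝ i M₁ z = t • iteratedFDeriv ℝ i M₀ z :=
      iteratedFDeriv_const_smul_apply hc
    rw [this, norm_smul, Real.norm_of_nonneg ht0.le]
    exact mul_le_mul_of_nonneg_left (hB t ⟨ht0.le, ht1⟩ i hi z) ht0.le
  have hq₁ : cauchyConst * (2 ^ r * (t * B)) ≤ q := by
    refine le_trans ?_ htD
    simp only [D]
    nlinarith
  obtain ⟨G, hG, hGd, hGu⟩ := exists_gauge_of_small hr hM₁ hs₁ hb₁ hq₁
    (by nlinarith [norm_nonneg (1 : 𝔸)]) (by nlinarith [norm_nonneg (1 : 𝔸)])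
  let φ : ℂ → ℂ := fun z => (t : ℂ)⁻¹ * (z - p)
  have hφ : ContDiff ℝ r φ := contDiff_const.mul (contDiff_id.sub contDiff_const)
  refine ⟨G ∘ φ, hG.comp hφ, ?_, fun z => hGu _⟩
  have htc : (t : ℂ) ≠ 0 := by exact_mod_cast ht0.ne'
  filter_upwards [Metric.ball_mem_nhds p ht0] with z hz
  have hφ1 : χ (φ z) = 1 := by
    apply χ.one_of_mem_closedBall
    change dist (φ z) 0 ≤ 1
    rw [dist_zero_right, norm_mul, norm_inv, Complex.norm_real, Real.norm_of_nonneg ht0.le,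
      inv_mul_le_iff₀ ht0, mul_one, ← dist_eq_norm]
    exact (Metric.mem_ball.1 hz).le
  have hφd : HasFDerivAt φ ((t : ℝ)⁻¹ • ContinuousLinearMap.id ℝ ℂ) z := by
    have h1 := ((hasFDerivAt_id (𝕜 := ℝ) z).sub_const p).const_mul (t : ℂ)⁻¹
    refine h1.congr_fderiv ?_
    ext v
    simp
  have hr0 : ((r : ℕ) : WithTop ℕ∞) ≠ 0 := by
    have : r ≠ 0 := by omega
    exact_mod_cast this
  have hd : fderiv ℝ (G ∘ φ) z = t⁻¹ • fderiv ℝ G (φ z) := by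
    rw [((hG.differentiable hr0 (φ z)).hasFDerivAt.comp z hφd).fderiv]
    ext v
    simp
  have hd2 : dbar (G ∘ φ) z = (t : ℂ)⁻¹ • dbar G (φ z) := by
    simp only [dbar, hd, smul_apply]
    rw [← Complex.coe_smul, ← Complex.coe_smul, Complex.ofReal_inv]
    module
  rw [hd2, hGd]
  simp only [M₁, M₀, hφ1, one_smul, Function.comp]
  rw [← Complex.coe_smul, smul_mul_assoc, smul_smul, inv_mul_cancel₀ htc, one_smul]
  congr 2
  simp only [φ]
  rw [mul_inv_cancel_left₀ htc, add_sub_cancel]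

lemma differentiableAt_of_dbar_eq_zero {E : Type*} [NormedAddCommGroup E] [NormedSpace ℂ E]
    {f : ℂ → E} {z : ℂ} (hf : DifferentiableAt ℝ f z) (h : dbar f z = 0) :
    DifferentiableAt ℂ f z := by
  rw [differentiableAt_complex_iff_differentiableAt_real]
  refine ⟨hf, ?_⟩
  rw [dbar, smul_eq_zero_iff_right (by norm_num)] at h
  have : Complex.I • (fderiv ℝ f z 1 + Complex.I • fderiv ℝ f z Complex.I) = 0 := by
    rw [h, smul_zero]
  rw [smul_add, smul_smul, Complex.I_mul_I, neg_one_smul, ← sub_eq_add_neg, sub_eq_zero] at this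
  exact this.symm

/-- A solution of `∂₋ A = [A, C]` either vanishes near `p`, or it is `(z - p) ^ k` times a function
of the same class that does not vanish at `p`: in a gauge `∂₋ G = - C G`, the function
`G⁻¹ A G` is holomorphic. -/
theorem eventually_zero_or_eq_pow_smul {r : ℕ} (hr : 1 ≤ r) {A C : ℂ → 𝔸} (hA : ContDiff ℝ r A)
    (hC : ContDiff ℝ r C) (h : ∀ z, dbar A z = A z * C z - C z * A z) (p : ℂ) :
    (∀ᶠ z in 𝓝 p, A z = 0) ∨ ∃ (k : ℕ) (B : ℂ → 𝔸), ContDiffAt ℝ r B p ∧ B p ≠ 0 ∧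
      ∀ᶠ z in 𝓝 p, A z = (z - p) ^ k • B z := by
  obtain ⟨G, hG, hGd, hGu⟩ := exists_gauge hr hC.neg p
  have hinv : ∀ z, Ring.inverse (G z) * G z = 1 := fun z => Ring.inverse_mul_cancel _ (hGu z)
  have hinv' : ∀ z, G z * Ring.inverse (G z) = 1 := fun z => Ring.mul_inverse_cancel _ (hGu z)
  have hGi : ContDiff ℝ r fun z => Ring.inverse (G z) := by
    rw [contDiff_iff_contDiffAt]
    intro z
    obtain ⟨u, hu⟩ := hGu z
    have := contDiffAt_ringInverse ℝ (n := r) u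
    rw [hu] at this
    exact this.comp z hG.contDiffAt
  let F : ℂ → 𝔸 := fun z => Ring.inverse (G z) * A z * G z
  have hF : ContDiff ℝ r F := (hGi.mul hA).mul hG
  have hr0 : ((r : ℕ) : WithTop ℕ∞) ≠ 0 := by
    have : r ≠ 0 := by omega
    exact_mod_cast this
  have hGF : ∀ z, G z * F z = A z * G z := fun z => by
    simp only [F]; rw [← mul_assoc, ← mul_assoc, hinv', one_mul]
  have hFd : ∀ᶠ z in 𝓝 p, dbar F z = 0 := by
    filter_upwards [hGd] with z hz
    have h1 := dbar_mul (hG.differentiable hr0 z) (hF.differentiable hr0 z)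
    have h2 := dbar_mul (hA.differentiable hr0 z) (hG.differentiable hr0 z)
    simp only [hGF] at h1
    rw [h1, h, hz] at h2
    have h3 : G z * dbar F z = 0 := by
      have h4 : -C z * G z * F z = -(C z * A z * G z) := by
        rw [mul_assoc, hGF, neg_mul, mul_assoc]
      have h2' : -C z * G z * F z + G z * dbar F z =
        (A z * C z - C z * A z) * G z + A z * (-C z * G z) := h2
      rw [h4] at h2'
      have : (A z * C z - C z * A z) * G z + A z * (-C z * G z) = -(C z * A z * G z) := by
        noncomm_ring
      rw [this] at h2'
      exact add_eq_left.1 h2'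
    rw [← one_mul (dbar F z), ← hinv z, mul_assoc, h3, mul_zero]
  have hFan : AnalyticAt ℂ F p := by
    obtain ⟨U, hU, hUo, hpU⟩ := eventually_nhds_iff.1 hFd
    refine DifferentiableOn.analyticAt (s := U) (fun z hz => ?_) (hUo.mem_nhds hpU)
    exact (differentiableAt_of_dbar_eq_zero (hF.differentiable hr0 z)
      (hU z hz)).differentiableWithinAt
  have hAF : ∀ z, A z = G z * F z * Ring.inverse (G z) := fun z => by
    rw [hGF, mul_assoc, hinv', mul_one]
  by_cases h0 : ∀ᶠ z in 𝓝 p, F z = 0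
  · left
    filter_upwards [h0] with z hz
    rw [hAF, hz, mul_zero, zero_mul]
  · right
    obtain ⟨k, g, hg, hg0, hFg⟩ := hFan.exists_eventuallyEq_pow_smul_nonzero_iff.2 h0
    refine ⟨k, fun z => G z * g z * Ring.inverse (G z), ?_, ?_, ?_⟩
    · exact (hG.contDiffAt.mul (hg.contDiffAt.restrict_scalars ℝ)).mul hGi.contDiffAt
    · intro h0
      apply hg0
      have : Ring.inverse (G p) * (G p * g p * Ring.inverse (G p)) * G p = g p := by
        rw [← mul_assoc, ← mul_assoc, hinv, one_mul, mul_assoc, hinv, mul_one]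
      have h0' : G p * g p * Ring.inverse (G p) = 0 := h0
      rw [← this, h0', mul_zero, zero_mul]
    · filter_upwards [hFg] with z hz
      rw [hAF, hz, mul_smul_comm, smul_mul_assoc]

end Gauge

/-! ### Calculus with the operators `∂₊` and `∂₋` -/

section Calculus

variable {N : ℕ}

/-- The operator `(∂₁ + c ∂₂) / 2` on scalar functions; it is `∂₋` for `c = i` and `∂₊` for
`c = -i`. -/
def sd (c : ℂ) (g : ℂ → ℂ) (z : ℂ) : ℂ :=
  (1 / 2 : ℂ) * (fderiv ℝ g z 1 + c * fderiv ℝ g z Complex.I)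

/-- The operator `(∂₁ + c ∂₂) / 2` on matrix functions. -/
def dd (c : ℂ) (X : ℂ → Mat N) (z : ℂ) : Mat N :=
  Matrix.of fun i j => sd c (fun ζ => X ζ i j) z

lemma sdPlus_eq : sdPlus = sd (-Complex.I) := by
  funext g z; simp only [sdPlus, sd]; ring

lemma dMinus_eq : dMinus (N := N) = dd Complex.I := rfl

lemma dPlus_eq : dPlus (N := N) = dd (-Complex.I) := by
  funext X z; simp only [dPlus, dd, sdPlus_eq]

/-- The components are real differentiable at `z`. -/
def MDiffAt (X : ℂ → Mat N) (z : ℂ) : Prop := ∀ i j, DifferentiableAt ℝ (fun ζ => X ζ i j) z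

/-- The components are of class `C^r` at `z`. -/
def MSmoothAt (r : WithTop ℕ∞) (X : ℂ → Mat N) (z : ℂ) : Prop :=
  ∀ i j, ContDiffAt ℝ r (fun ζ => X ζ i j) z

lemma sd_congr {c : ℂ} {f g : ℂ → ℂ} {z : ℂ} (h : f =ᶠ[𝓝 z] g) : sd c f z = sd c g z := by
  simp only [sd, h.fderiv_eq]

lemma sd_const (c a : ℂ) (z : ℂ) : sd c (fun _ => a) z = 0 := by simp [sd]

lemma sd_add {c : ℂ} {f g : ℂ → ℂ} {z : ℂ} (hf : DifferentiableAt ℝ f z)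
    (hg : DifferentiableAt ℝ g z) : sd c (fun y => f y + g y) z = sd c f z + sd c g z := by
  simp only [sd, fderiv_fun_add hf hg, add_apply]; ring

lemma sd_neg {c : ℂ} {f : ℂ → ℂ} {z : ℂ} : sd c (fun y => -f y) z = -sd c f z := by
  simp only [sd, fderiv_fun_neg, neg_apply]; ring

lemma sd_mul {c : ℂ} {f g : ℂ → ℂ} {z : ℂ} (hf : DifferentiableAt ℝ f z)
    (hg : DifferentiableAt ℝ g z) :
    sd c (fun y => f y * g y) z = sd c f z * g z + f z * sd c g z := by
  simp only [sd, fderiv_fun_mul hf hg, add_apply, smul_apply, smul_eq_mul]; ring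

lemma sd_sum {c : ℂ} {ι : Type*} (s : Finset ι) {f : ι → ℂ → ℂ} {z : ℂ}
    (hf : ∀ i ∈ s, DifferentiableAt ℝ (f i) z) :
    sd c (fun y => ∑ i ∈ s, f i y) z = ∑ i ∈ s, sd c (f i) z := by
  simp only [sd, fderiv_fun_sum hf, sum_apply, Finset.mul_sum, ← Finset.sum_add_distrib]

lemma sd_conj {c : ℂ} {f : ℂ → ℂ} {z : ℂ} :
    sd c (fun y => conj (f y)) z = conj (sd (conj c) f z) := by
  have h : fderiv ℝ (fun y => conj (f y)) z =
      (Complex.conjCLE : ℂ →L[ℝ] ℂ).comp (fderiv ℝ f z) := Complex.conjCLE.comp_fderiv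
  simp only [sd, h, ContinuousLinearMap.comp_apply, map_mul, map_add, map_div₀, map_one, map_ofNat,
    Complex.conj_conj]
  rfl

lemma contDiffAt_sd {c : ℂ} {f : ℂ → ℂ} {z : ℂ} {r s : WithTop ℕ∞} (hf : ContDiffAt ℝ r f z)
    (h : s + 1 ≤ r) : ContDiffAt ℝ s (sd c f) z := by
  have h1 := hf.fderiv_right h
  exact contDiffAt_const.mul ((h1.clm_apply contDiffAt_const).add
    (contDiffAt_const.mul (h1.clm_apply contDiffAt_const)))

lemma sd_comm {c d : ℂ} {f : ℂ → ℂ} {z : ℂ} (hf : ContDiffAt ℝ 2 f z) :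
    sd c (sd d f) z = sd d (sd c f) z := by
  have hsymm := hf.isSymmSndFDerivAt (by simp)
  have hd : DifferentiableAt ℝ (fderiv ℝ f) z :=
    (hf.fderiv_right (m := 1) (by norm_num)).differentiableAt (by norm_num)
  have key : ∀ d : ℂ, ∀ v : ℂ, fderiv ℝ (sd d f) z v =
      (1 / 2 : ℂ) * (fderiv ℝ (fderiv ℝ f) z v 1 + d * fderiv ℝ (fderiv ℝ f) z v Complex.I) := by
    intro d v
    have h1 : ∀ w : ℂ, HasFDerivAt (fun y => fderiv ℝ f y w)
        ((fderiv ℝ (fderiv ℝ f) z).flip w) z := fun w => by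
      refine (hd.hasFDerivAt.clm_apply (hasFDerivAt_const w z)).congr_fderiv ?_
      ext; simp
    have h2 : HasFDerivAt (sd d f) _ z := ((h1 1).add ((h1 Complex.I).const_mul d)).const_mul (1 / 2)
    rw [h2.fderiv]
    simp only [smul_apply, add_apply, ContinuousLinearMap.flip_apply, smul_eq_mul]
  have hs : fderiv ℝ (fderiv ℝ f) z 1 Complex.I = fderiv ℝ (fderiv ℝ f) z Complex.I 1 :=
    hsymm 1 Complex.I
  simp only [sd, key] at *
  simp only [hs]
  ring

lemma MSmoothAt.mdiffAt {r : WithTop ℕ∞} {X : ℂ → Mat N} {z : ℂ} (h : MSmoothAt r X z)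
    (hr : r ≠ 0) : MDiffAt X z := fun i j => (h i j).differentiableAt hr

lemma MSmoothAt.of_le {r s : WithTop ℕ∞} {X : ℂ → Mat N} {z : ℂ} (h : MSmoothAt r X z)
    (hs : s ≤ r) : MSmoothAt s X z := fun i j => (h i j).of_le hs

lemma MSmoothAt.congr {r : WithTop ℕ∞} {X Y : ℂ → Mat N} {z : ℂ} (h : MSmoothAt r X z)
    (he : Y =ᶠ[𝓝 z] X) : MSmoothAt r Y z := fun i j =>
  (h i j).congr_of_eventuallyEq (he.mono fun y hy => by simp only [hy])

lemma MSmoothAt.mul {r : WithTop ℕ∞} {X Y : ℂ → Mat N} {z : ℂ} (hX : MSmoothAt r X z)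
    (hY : MSmoothAt r Y z) : MSmoothAt r (fun ζ => X ζ * Y ζ) z := fun i j => by
  simp only [Matrix.mul_apply]
  exact ContDiffAt.sum fun k _ => (hX i k).mul (hY k j)

lemma MSmoothAt.add {r : WithTop ℕ∞} {X Y : ℂ → Mat N} {z : ℂ} (hX : MSmoothAt r X z)
    (hY : MSmoothAt r Y z) : MSmoothAt r (fun ζ => X ζ + Y ζ) z := fun i j =>
  (hX i j).add (hY i j)

lemma MSmoothAt.smul {r : WithTop ℕ∞} {f : ℂ → ℂ} {X : ℂ → Mat N} {z : ℂ}
    (hf : ContDiffAt ℝ r f z) (hX : MSmoothAt r X z) : MSmoothAt r (fun ζ => f ζ • X ζ) z :=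
  fun i j => hf.mul (hX i j)

lemma contDiffAt_conj {r : WithTop ℕ∞} {f : ℂ → ℂ} {z : ℂ} (hf : ContDiffAt ℝ r f z) :
    ContDiffAt ℝ r (fun y => conj (f y)) z :=
  (Complex.conjCLE : ℂ →L[ℝ] ℂ).contDiff.contDiffAt.comp z hf

lemma MSmoothAt.conjTranspose {r : WithTop ℕ∞} {X : ℂ → Mat N} {z : ℂ} (hX : MSmoothAt r X z) :
    MSmoothAt r (fun ζ => (X ζ)ᴴ) z := fun i j => contDiffAt_conj (hX j i)

lemma MSmoothAt.trace {r : WithTop ℕ∞} {X : ℂ → Mat N} {z : ℂ} (hX : MSmoothAt r X z) :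
    ContDiffAt ℝ r (fun ζ => (X ζ).trace) z := ContDiffAt.sum fun i _ => hX i i

lemma MSmoothAt.dd {c : ℂ} {r s : WithTop ℕ∞} {X : ℂ → Mat N} {z : ℂ} (hX : MSmoothAt r X z)
    (h : s + 1 ≤ r) : MSmoothAt s (dd c X) z := fun i j => contDiffAt_sd (hX i j) h

lemma MSmoothAt.continuousAt {r : WithTop ℕ∞} {X : ℂ → Mat N} {z : ℂ} (hX : MSmoothAt r X z) :
    ContinuousAt X z :=
  continuousAt_pi.2 fun i => continuousAt_pi.2 fun j => (hX i j).continuousAt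

lemma MSmoothAt.eventually {r : ℕ} {X : ℂ → Mat N} {z : ℂ} (hX : MSmoothAt r X z) :
    ∀ᶠ y in 𝓝 z, MSmoothAt r X y :=
  eventually_all.2 fun i => eventually_all.2 fun j => (hX i j).eventually (by simp)

lemma dd_congr {c : ℂ} {X Y : ℂ → Mat N} {z : ℂ} (h : X =ᶠ[𝓝 z] Y) : dd c X z = dd c Y z := by
  ext i j
  exact sd_congr (h.mono fun y hy => by simp only [hy])

lemma dd_const (c : ℂ) (A : Mat N) (z : ℂ) : dd c (fun _ => A) z = 0 := by
  ext i j; exact sd_const _ _ _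

lemma dd_mul {c : ℂ} {X Y : ℂ → Mat N} {z : ℂ} (hX : MDiffAt X z) (hY : MDiffAt Y z) :
    dd c (fun ζ => X ζ * Y ζ) z = dd c X z * Y z + X z * dd c Y z := by
  ext i j
  simp only [dd, Matrix.of_apply, Matrix.add_apply, Matrix.mul_apply, ← Finset.sum_add_distrib]
  refine (sd_sum Finset.univ (f := fun k y => X y i k * Y y k j)
    fun k _ => (hX i k).mul (hY k j)).trans ?_
  exact Finset.sum_congr rfl fun k _ => sd_mul (hX i k) (hY k j)

lemma dd_add {c : ℂ} {X Y : ℂ → Mat N} {z : ℂ} (hX : MDiffAt X z) (hY : MDiffAt Y z) :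
    dd c (fun ζ => X ζ + Y ζ) z = dd c X z + dd c Y z := by
  ext i j; exact sd_add (hX i j) (hY i j)

lemma dd_conjTranspose {c : ℂ} {X : ℂ → Mat N} {z : ℂ} :
    dd c (fun ζ => (X ζ)ᴴ) z = (dd (conj c) X z)ᴴ := by
  ext i j; exact sd_conj

lemma dd_trace {c : ℂ} {X : ℂ → Mat N} {z : ℂ} (hX : MDiffAt X z) :
    sd c (fun ζ => (X ζ).trace) z = (dd c X z).trace :=
  sd_sum _ fun i _ => hX i i

lemma dd_comm {c d : ℂ} {X : ℂ → Mat N} {z : ℂ} (hX : MSmoothAt 2 X z) :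
    dd c (dd d X) z = dd d (dd c X) z := by
  ext i j; exact sd_comm (hX i j)

end Calculus

/-! ### Rank-one projectors -/

section RankOne

variable {N : ℕ}

lemma IsRankOneProj.exists_span {P : Mat N} (h : IsRankOneProj P) :
    ∃ v : Fin N → ℂ, v ≠ 0 ∧ P *ᵥ v = v ∧ ∀ x, ∃ c : ℂ, P *ᵥ x = c • v := by
  have hproj : LinearMap.IsProj (LinearMap.range P.mulVecLin) P.mulVecLin := by
    refine ⟨fun x => LinearMap.mem_range_self _ _, ?_⟩
    rintro _ ⟨x, rfl⟩
    simp [h.idem]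
  have htr := hproj.trace
  have h1 : LinearMap.trace ℂ (Fin N → ℂ) P.mulVecLin = 1 := by
    rw [← h.trace_eq, ← Matrix.trace_toLin'_eq]
    rfl
  rw [h1] at htr
  have hfr : Module.finrank ℂ (LinearMap.range P.mulVecLin) = 1 := by exact_mod_cast htr.symm
  obtain ⟨⟨v, hv⟩, hv0, hspan⟩ := finrank_eq_one_iff'.1 hfr
  refine ⟨v, fun h0 => hv0 (Subtype.ext h0), ?_, fun x => ?_⟩
  · exact hproj.map_id v hv
  · obtain ⟨c, hc⟩ := hspan ⟨P *ᵥ x, ⟨x, rfl⟩⟩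
    exact ⟨c, (congrArg Subtype.val hc).symm⟩

/-- Compressing to the image of a rank-one projector gives a multiple of the projector. -/
lemma IsRankOneProj.mul_mul {P : Mat N} (h : IsRankOneProj P) (M : Mat N) :
    P * M * P = (P * M).trace • P := by
  obtain ⟨v, -, hv, hspan⟩ := h.exists_span
  obtain ⟨c, hc⟩ := hspan (M *ᵥ v)
  have key : P * M * P = c • P := by
    refine Matrix.ext_of_mulVec_single fun i => ?_
    obtain ⟨a, ha⟩ := hspan (Pi.single i 1)
    rw [← Matrix.mulVec_mulVec, ← Matrix.mulVec_mulVec, Matrix.smul_mulVec, ha,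
      Matrix.mulVec_smul, Matrix.mulVec_smul, hc, smul_comm]
  have htr := congrArg Matrix.trace key
  rw [Matrix.trace_mul_comm, ← mul_assoc, h.idem, Matrix.trace_smul, h.trace_eq, smul_eq_mul,
    mul_one] at htr
  rw [key, htr]

end RankOne

/-! ### Harmonic projectors in one chart -/

section Chart

variable {N : ℕ}

/-- The algebra behind `∂₋A = [A, A†]` for `x = X`, `p = ∂₊X`, `m = ∂₋X`, `S = ∂₊∂₋X`. -/
lemma ring_identity_of_commute {R : Type*} [Ring R] {S p m x : R}
    (e2 : S = S * x + m * p + (p * m + x * S)) (e3 : S * x = x * S) (e4 : p = p * x + x * p)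
    (e5 : m = m * x + x * m) (e6 : x * p * x = 0) (e8 : x * x = x) :
    S * x + p * m = p * x * (x * m) - x * m * (p * x) := by
  have h2 : x * S * x + x * m * p * x + x * p * m * x = 0 := by
    linear_combination (norm := noncomm_ring) -(x * e2 * x) - x * S * e8 - e8 * S * x
  have h1 : S * x = x * S * x := by
    linear_combination (norm := noncomm_ring) e3 * x - S * e8
  have h3 : x * p * m = x * p * m * x := by
    linear_combination (norm := noncomm_ring) x * p * e5 + e6 * m
  have h4 : p * m = p * x * m + x * p * m := by
    linear_combination (norm := noncomm_ring) e4 * m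
  have h5 : p * x * (x * m) = p * x * m := by
    linear_combination (norm := noncomm_ring) p * e8 * m
  rw [h1, h4, h5, h3]
  linear_combination (norm := noncomm_ring) h2

/-- The algebra behind `eulerLagrange_of_dPlus`, in the same notation. -/
lemma mul_eq_of_compl_mul {R : Type*} [Ring R] {S p m x : R} (h : (1 - x) * (S * x + m * p) * x = 0)
    (e5 : m = m * x + x * m) (e6 : x * p * x = 0) (e8 : x * x = x) : S * x = x * S * x := by
  have h1 : m * p * x = x * m * p * x := by
    linear_combination (norm := noncomm_ring) e5 * p * x + m * e6
  have h2 : S * x * x = S * x := by rw [mul_assoc, e8]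
  linear_combination (norm := noncomm_ring) h - h1 - h2 + x * h2

/-- A harmonic projector function of class `C^r` in one chart: its values are rank-one Hermitian
projectors and it satisfies the Euler–Lagrange equation. -/
structure HarmonicProj (r : ℕ) (X : ℂ → Mat N) : Prop where
  rankOne : ∀ z, IsRankOneProj (X z)
  smoothAt : ∀ z, MSmoothAt r X z
  eulerLagrange : EulerLagrange X

/-- The second fundamental form `A = ∂₊X X` of the line bundle onto which `X` projects; it maps
the image of `X` to its orthogonal complement. -/
def sff (X : ℂ → Mat N) (z : ℂ) : Mat N := dPlus X z * X z

lemma dMinus_eq_conjTranspose {X : ℂ → Mat N} (hX : ∀ z, IsRankOneProj (X z)) (z : ℂ) :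
    dMinus X z = (dPlus X z)ᴴ := by
  have h : X = fun ζ => (X ζ)ᴴ := funext fun ζ => (hX ζ).herm.symm
  conv_lhs => rw [h]
  rw [dMinus_eq, dPlus_eq, dd_conjTranspose, Complex.conj_I]

lemma sff_conjTranspose {X : ℂ → Mat N} (hX : ∀ z, IsRankOneProj (X z)) (z : ℂ) :
    (sff X z)ᴴ = X z * dMinus X z := by
  rw [sff, Matrix.conjTranspose_mul, (hX z).herm, dMinus_eq_conjTranspose hX]

lemma sff_mul_self {X : ℂ → Mat N} (hX : ∀ z, IsRankOneProj (X z)) (z : ℂ) :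
    sff X z * X z = sff X z := by rw [sff, mul_assoc, (hX z).idem]

lemma mul_sff_conjTranspose {X : ℂ → Mat N} (hX : ∀ z, IsRankOneProj (X z)) (z : ℂ) :
    X z * (sff X z)ᴴ = (sff X z)ᴴ := by
  rw [sff_conjTranspose hX, ← mul_assoc, (hX z).idem]

lemma ladderNum_eq {X : ℂ → Mat N} (hX : ∀ z, IsRankOneProj (X z)) (z : ℂ) :
    ladderNum dPlus dMinus X z = sff X z * (sff X z)ᴴ := by
  rw [sff_conjTranspose hX, sff, ladderNum, mul_assoc (dPlus X z) (X z) (X z * _),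
    ← mul_assoc (X z) (X z), (hX z).idem, mul_assoc]

/-- Differentiating `X² = X`. -/
lemma dd_eq_add {X : ℂ → Mat N} (hX : ∀ z, IsRankOneProj (X z)) {z : ℂ} (hd : MDiffAt X z)
    (c : ℂ) : dd c X z = dd c X z * X z + X z * dd c X z := by
  rw [← dd_mul hd hd]
  congr 1
  exact funext fun ζ => (hX ζ).idem.symm

lemma mul_dd_mul {X : ℂ → Mat N} (hX : ∀ z, IsRankOneProj (X z)) {z : ℂ} (hd : MDiffAt X z)
    (c : ℂ) : X z * dd c X z * X z = 0 := by
  have h := congrArg (fun M => X z * M * X z) (dd_eq_add hX hd c)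
  simp only [mul_add, add_mul] at h
  rw [← mul_assoc (X z) (X z), (hX z).idem, ← mul_assoc (X z) (dd c X z),
    mul_assoc _ (X z) (X z), (hX z).idem] at h
  exact add_eq_right.1 h.symm

lemma mul_sff {X : ℂ → Mat N} (hX : ∀ z, IsRankOneProj (X z)) {z : ℂ} (hd : MDiffAt X z) :
    X z * sff X z = 0 := by
  rw [sff, ← mul_assoc, dPlus_eq, mul_dd_mul hX hd]

lemma sff_conjTranspose_mul {X : ℂ → Mat N} (hX : ∀ z, IsRankOneProj (X z)) {z : ℂ}
    (hd : MDiffAt X z) : (sff X z)ᴴ * X z = 0 := by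
  have := congrArg Matrix.conjTranspose (mul_sff hX hd)
  rwa [Matrix.conjTranspose_mul, (hX z).herm, Matrix.conjTranspose_zero] at this

/-- Harmonicity says that the second fundamental form satisfies `∂₋A = [A, A†]`. -/
lemma HarmonicProj.dMinus_sff {r : ℕ} (hr : 2 ≤ r) {X : ℂ → Mat N} (hX : HarmonicProj r X)
    (z : ℂ) : dMinus (sff X) z = sff X z * (sff X z)ᴴ - (sff X z)ᴴ * sff X z := by
  have h2 : (2 : WithTop ℕ∞) ≤ (r : WithTop ℕ∞) := by exact_mod_cast hr
  have hs : ∀ z, MSmoothAt 2 X z := fun z => (hX.smoothAt z).of_le h2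
  have hd : ∀ z, MDiffAt X z := fun z => (hs z).mdiffAt (by norm_num)
  have hdd : ∀ c z, MDiffAt (dd c X) z := fun c z =>
    ((hs z).dd (s := 1) (by norm_num)).mdiffAt (by norm_num)
  rw [sff_conjTranspose hX.rankOne]
  have e1 : dMinus (sff X) z =
      dPlus (dMinus X) z * X z + dPlus X z * dMinus X z := by
    change dMinus (fun ζ => dPlus X ζ * X ζ) z = _
    simp only [dMinus_eq, dPlus_eq]
    rw [dd_mul (hdd _ z) (hd z), dd_comm (hs z)]
  have e2 : dPlus (dMinus X) z = dPlus (dMinus X) z * X z + dMinus X z * dPlus X z +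
      (dPlus X z * dMinus X z + X z * dPlus (dMinus X) z) := by
    have : dMinus X = fun ζ => dMinus X ζ * X ζ + X ζ * dMinus X ζ := funext fun ζ =>
      dd_eq_add hX.rankOne (hd ζ) _
    conv_lhs => rw [this]
    simp only [dMinus_eq, dPlus_eq]
    rw [dd_add (((hs z).dd (s := 1) (by norm_num)).mul ((hs z).of_le (by norm_num))
        |>.mdiffAt (by norm_num)) ((((hs z).of_le (by norm_num)).mul
        ((hs z).dd (s := 1) (by norm_num))).mdiffAt (by norm_num)),
      dd_mul (hdd _ z) (hd z), dd_mul (hd z) (hdd _ z)]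
  have e3 := sub_eq_zero.1 (hX.eulerLagrange z)
  have e4 : dPlus X z = dPlus X z * X z + X z * dPlus X z := by
    rw [dPlus_eq]; exact dd_eq_add hX.rankOne (hd z) _
  have e5 : dMinus X z = dMinus X z * X z + X z * dMinus X z := dd_eq_add hX.rankOne (hd z) _
  have e6 : X z * dPlus X z * X z = 0 := by rw [dPlus_eq]; exact mul_dd_mul hX.rankOne (hd z) _
  rw [e1]
  exact ring_identity_of_commute e2 e3 e4 e5 e6 (hX.rankOne z).idem

/-- The Euler–Lagrange equation expressed by the second fundamental form `∂₋X X`. -/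
lemma eulerLagrange_of_dPlus {X : ℂ → Mat N} (hX : ∀ z, IsRankOneProj (X z)) {z : ℂ}
    (hs : ∀ z, MSmoothAt 2 X z)
    (h : (1 - X z) * dPlus (fun ζ => dMinus X ζ * X ζ) z * X z = 0) :
    dPlus (dMinus X) z * X z - X z * dPlus (dMinus X) z = 0 := by
  have hd : ∀ z, MDiffAt X z := fun z => (hs z).mdiffAt (by norm_num)
  have hdd : ∀ c z, MDiffAt (dd c X) z := fun c z =>
    ((hs z).dd (s := 1) (by norm_num)).mdiffAt (by norm_num)
  have e1 : dPlus (fun ζ => dMinus X ζ * X ζ) z =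
      dPlus (dMinus X) z * X z + dMinus X z * dPlus X z := by
    simp only [dMinus_eq, dPlus_eq]
    rw [dd_mul (hdd _ z) (hd z)]
  rw [e1] at h
  have e5 : dMinus X z = dMinus X z * X z + X z * dMinus X z := dd_eq_add hX (hd z) _
  have e6 : X z * dPlus X z * X z = 0 := by rw [dPlus_eq]; exact mul_dd_mul hX (hd z) _
  have e8 := (hX z).idem
  have hS : (dPlus (dMinus X) z)ᴴ = dPlus (dMinus X) z := by
    have : dMinus X = fun ζ => (dPlus X ζ)ᴴ := funext fun ζ => dMinus_eq_conjTranspose hX ζ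
    conv_rhs => rw [this]
    rw [dPlus_eq, dd_conjTranspose, dMinus_eq, dd_comm (hs z), map_neg, Complex.conj_I, neg_neg]
  have hSX : dPlus (dMinus X) z * X z = X z * dPlus (dMinus X) z * X z :=
    mul_eq_of_compl_mul h e5 e6 e8
  have hXS := congrArg Matrix.conjTranspose hSX
  simp only [Matrix.conjTranspose_mul, hS, (hX z).herm] at hXS
  rw [sub_eq_zero, hXS, ← mul_assoc, hSX]

end Chart

/-! ### Zeros of the second fundamental form -/

section MatrixNorm

variable {N : ℕ}

attribute [local instance] Matrix.linftyOpNormedRing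
attribute [local instance] Matrix.linftyOpNormedAlgebra

/-- The matrix entry as a continuous real linear map. -/
def entryCLM (i j : Fin N) : Mat N →L[ℝ] ℂ :=
  (LinearMap.toContinuousLinearMap (Matrix.entryLinearMap ℂ ℂ i j)).restrictScalars ℝ

lemma contDiffAt_iff_mSmoothAt {r : WithTop ℕ∞} {X : ℂ → Mat N} {z : ℂ} :
    ContDiffAt ℝ r X z ↔ MSmoothAt r X z := by
  refine ⟨fun h i j => (entryCLM i j).contDiff.contDiffAt.comp z h, fun h => ?_⟩
  have : X = fun ζ => ∑ i, ∑ j, X ζ i j • Matrix.single i j (1 : ℂ) := by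
    funext ζ
    conv_lhs => rw [Matrix.matrix_eq_sum_single (X ζ)]
    simp
  rw [this]
  exact ContDiffAt.sum fun i _ => ContDiffAt.sum fun j _ => (h i j).smul contDiffAt_const

lemma dbar_eq_dMinus {X : ℂ → Mat N} {z : ℂ} (h : MSmoothAt 1 X z) : dbar X z = dMinus X z := by
  have hd := (contDiffAt_iff_mSmoothAt.2 h).differentiableAt (by norm_num)
  ext i j
  have h1 : HasFDerivAt (fun ζ => X ζ i j) ((entryCLM i j).comp (fderiv ℝ X z)) z :=
    (entryCLM i j).hasFDerivAt.comp z hd.hasFDerivAt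
  simp only [dMinus, Matrix.of_apply, sdMinus, h1.fderiv]
  rfl

/-- Near every point, the second fundamental form of a harmonic projector vanishes identically or
has a zero of finite order with a nonvanishing leading factor. -/
theorem sff_eventually_zero_or_eq_pow_smul {s : ℕ} (hs : 1 ≤ s) {X : ℂ → Mat N}
    (hX : HarmonicProj (s + 1) X) (p : ℂ) :
    (∀ᶠ z in 𝓝 p, sff X z = 0) ∨ ∃ (k : ℕ) (B : ℂ → Mat N), MSmoothAt s B p ∧ B p ≠ 0 ∧
      ∀ᶠ z in 𝓝 p, sff X z = (z - p) ^ k • B z := by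
  have hle : (s : WithTop ℕ∞) ≤ ((s + 1 : ℕ) : WithTop ℕ∞) := by exact_mod_cast Nat.le_succ s
  have hA : ∀ z, MSmoothAt s (sff X) z := fun z => by
    have h1 : MSmoothAt s (dPlus X) z := by
      rw [dPlus_eq]; exact (hX.smoothAt z).dd (by norm_cast)
    exact h1.mul ((hX.smoothAt z).of_le hle)
  have h1 : (1 : WithTop ℕ∞) ≤ (s : WithTop ℕ∞) := by exact_mod_cast hs
  have key := eventually_zero_or_eq_pow_smul hs (A := sff X) (C := fun z => (sff X z)ᴴ)
    (contDiff_iff_contDiffAt.2 fun z => contDiffAt_iff_mSmoothAt.2 (hA z))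
    (contDiff_iff_contDiffAt.2 fun z => contDiffAt_iff_mSmoothAt.2 (hA z).conjTranspose)
    (fun z => by rw [dbar_eq_dMinus ((hA z).of_le h1), hX.dMinus_sff (by omega)]) p
  refine key.imp id ?_
  rintro ⟨k, B, hB, hB0, hE⟩
  exact ⟨k, B, contDiffAt_iff_mSmoothAt.1 hB, hB0, hE⟩

end MatrixNorm

/-! ### Raising a harmonic projector in one chart -/

section Step

variable {N : ℕ}

open scoped ComplexOrder in
lemma trace_mul_conjTranspose_ne_zero {A : Mat N} (h : A ≠ 0) : (A * Aᴴ).trace ≠ 0 := fun h0 =>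
  h (Matrix.trace_mul_conjTranspose_self_eq_zero_iff.1 h0)

lemma mul_conjTranspose_ne_zero {A : Mat N} (h : A ≠ 0) : A * Aᴴ ≠ 0 := fun h0 =>
  trace_mul_conjTranspose_ne_zero h (by rw [h0, Matrix.trace_zero])

lemma ladderNum_ne_zero_iff {X : ℂ → Mat N} (hX : ∀ z, IsRankOneProj (X z)) (z : ℂ) :
    ladderNum dPlus dMinus X z ≠ 0 ↔ sff X z ≠ 0 := by
  rw [ladderNum_eq hX]
  refine ⟨fun h h0 => h (by rw [h0, zero_mul]), mul_conjTranspose_ne_zero⟩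

/-- Unique continuation for a function whose zeros are isolated or interior. -/
lemma eventually_ne_zero_of_dichotomy {E : Type*} [Zero E] {f : ℂ → E}
    (h : ∀ p, (∀ᶠ z in 𝓝 p, f z = 0) ∨ ∀ᶠ z in 𝓝[≠] p, f z ≠ 0) (hne : ∃ z, f z ≠ 0) (p : ℂ) :
    ∀ᶠ z in 𝓝[≠] p, f z ≠ 0 := by
  refine (h p).resolve_left fun hp => ?_
  have hclopen : IsClopen {p : ℂ | ∀ᶠ z in 𝓝 p, f z = 0} := by
    refine ⟨?_, isOpen_setOfPred_eventually_nhds⟩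
    rw [← isOpen_compl_iff, isOpen_iff_mem_nhds]
    intro q hq
    have h1 : ∀ᶠ z in 𝓝 q, z ≠ q → f z ≠ 0 := eventually_nhdsWithin_iff.1 ((h q).resolve_left hq)
    filter_upwards [h1.eventually_nhds] with y hy h0
    have : (𝓝[{q}ᶜ] y).NeBot := mem_closure_iff_nhdsWithin_neBot.1 (dense_compl_singleton q y)
    obtain ⟨z, ⟨h2, h3⟩, h4⟩ := (((h0.and hy).filter_mono nhdsWithin_le_nhds).and
      (self_mem_nhdsWithin (s := {q}ᶜ))).exists
    exact h3 h4 h2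
  obtain ⟨z, hz⟩ := hne
  have : z ∈ {p : ℂ | ∀ᶠ z in 𝓝 p, f z = 0} := by
    rw [hclopen.eq_univ ⟨p, hp⟩]; trivial
  exact hz this.self_of_nhds

/-- If the second fundamental form does not vanish identically, its zeros are of finite order. -/
lemma sff_eq_pow_smul {s : ℕ} (hs : 1 ≤ s) {X : ℂ → Mat N} (hX : HarmonicProj (s + 1) X)
    (hne : ∃ z, sff X z ≠ 0) (p : ℂ) :
    ∃ (k : ℕ) (B : ℂ → Mat N), MSmoothAt s B p ∧ B p ≠ 0 ∧
      ∀ᶠ z in 𝓝 p, sff X z = (z - p) ^ k • B z := by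
  refine (sff_eventually_zero_or_eq_pow_smul hs hX p).resolve_left fun hp => ?_
  have hdich : ∀ q, (∀ᶠ z in 𝓝 q, sff X z = 0) ∨ ∀ᶠ z in 𝓝[≠] q, sff X z ≠ 0 := fun q =>
    (sff_eventually_zero_or_eq_pow_smul hs hX q).imp id fun ⟨k, B, hB, hB0, hE⟩ => by
      filter_upwards [nhdsWithin_le_nhds hE, nhdsWithin_le_nhds (hB.continuousAt.eventually_ne hB0),
        self_mem_nhdsWithin] with z h1 h2 h3
      rw [h1]
      exact smul_ne_zero (pow_ne_zero k (sub_ne_zero.2 h3)) h2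
  obtain ⟨z, h1, h2⟩ := ((eventually_ne_zero_of_dichotomy hdich hne p).and
    (nhdsWithin_le_nhds hp)).exists
  exact h1 h2

/-- Filling in removable singularities by punctured limits. -/
lemma limUnder_punctured_eventuallyEq {E : Type*} [TopologicalSpace E] [T2Space E] [Nonempty E]
    {f g : ℂ → E} {p : ℂ} (h : ∀ᶠ z in 𝓝[≠] p, f z = g z)
    (hg : ∀ᶠ z in 𝓝 p, ContinuousAt g z) :
    (fun z => limUnder (𝓝[≠] z) f) =ᶠ[𝓝 p] g := by
  have h' : ∀ᶠ z in 𝓝 p, z ≠ p → f z = g z := eventually_nhdsWithin_iff.1 h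
  filter_upwards [h'.eventually_nhds, hg] with y hy hc
  refine Tendsto.limUnder_eq ((hc.tendsto.mono_left nhdsWithin_le_nhds).congr' ?_)
  by_cases hyp : y = p
  · subst hyp
    filter_upwards [nhdsWithin_le_nhds hy, self_mem_nhdsWithin] with z h1 h2 using (h1 h2).symm
  · filter_upwards [nhdsWithin_le_nhds hy, nhdsWithin_le_nhds (eventually_ne_nhds hyp)]
      with z h1 h2 using (h1 h2).symm

/-- The quotient `A A† / tr (A A†)` extended by continuity in one chart. -/
def raiseExt (X : ℂ → Mat N) (z : ℂ) : Mat N :=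
  limUnder (𝓝[≠] z) (ladderQuot dPlus dMinus X)

lemma ladderQuot_eq {X : ℂ → Mat N} (hX : ∀ z, IsRankOneProj (X z)) (z : ℂ) :
    ladderQuot dPlus dMinus X z =
      (sff X z * (sff X z)ᴴ).trace⁻¹ • (sff X z * (sff X z)ᴴ) := by
  rw [ladderQuot, ladderNum_eq hX]

lemma inv_trace_smul_smul {c : ℂ} (hc : c ≠ 0) (B : Mat N) :
    ((c • B) * (c • B)ᴴ).trace⁻¹ • ((c • B) * (c • B)ᴴ) = (B * Bᴴ).trace⁻¹ • (B * Bᴴ) := by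
  have hc' : c * star c ≠ 0 := mul_ne_zero hc (star_ne_zero.2 hc)
  rw [Matrix.conjTranspose_smul, smul_mul_smul_comm, Matrix.trace_smul, smul_smul, smul_eq_mul,
    mul_inv, mul_right_comm, inv_mul_cancel₀ hc', one_mul]

/-- Near every point the extended quotient is `B B† / tr (B B†)`, where `B` is the second
fundamental form divided by the appropriate power of `z - p`. -/
lemma raiseExt_eventuallyEq {s : ℕ} (hs : 1 ≤ s) {X : ℂ → Mat N} (hX : HarmonicProj (s + 1) X)
    (hne : ∃ z, sff X z ≠ 0) (p : ℂ) :
    ∃ B : ℂ → Mat N, MSmoothAt s B p ∧ B p ≠ 0 ∧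
      (∀ᶠ z in 𝓝[≠] p, sff X z ≠ 0) ∧
      raiseExt X =ᶠ[𝓝 p] fun z => (B z * (B z)ᴴ).trace⁻¹ • (B z * (B z)ᴴ) := by
  obtain ⟨k, B, hB, hB0, hE⟩ := sff_eq_pow_smul hs hX hne p
  have hBne := hB.continuousAt.eventually_ne hB0
  refine ⟨B, hB, hB0, ?_, ?_⟩
  · filter_upwards [nhdsWithin_le_nhds hE, nhdsWithin_le_nhds hBne, self_mem_nhdsWithin]
      with z h1 h2 h3
    rw [h1]
    exact smul_ne_zero (pow_ne_zero k (sub_ne_zero.2 h3)) h2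
  have hq : ∀ᶠ z in 𝓝[≠] p, ladderQuot dPlus dMinus X z =
      (B z * (B z)ᴴ).trace⁻¹ • (B z * (B z)ᴴ) := by
    filter_upwards [nhdsWithin_le_nhds hE, self_mem_nhdsWithin] with z hz hzp
    rw [ladderQuot_eq hX.rankOne, hz, inv_trace_smul_smul (pow_ne_zero k (sub_ne_zero.2 hzp))]
  refine limUnder_punctured_eventuallyEq hq ?_
  filter_upwards [hBne, hB.eventually] with y hBy hBs
  have hBB : MSmoothAt s (fun z => B z * (B z)ᴴ) y := hBs.mul hBs.conjTranspose
  exact (hBB.trace.continuousAt.inv₀ (trace_mul_conjTranspose_ne_zero hBy)).smul hBB.continuousAt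

/-- `Y` is the projector that follows `X` in the sequence `X, Π₊X, Π₊²X, …`: its image is the image
of the second fundamental form `A` of `X`, and in the opposite direction the second fundamental form
of `Y` is `-A†`. -/
structure Next (X Y : ℂ → Mat N) : Prop where
  dense : Dense {z | sff X z ≠ 0}
  num : ∀ z, sff X z * (sff X z)ᴴ = (sff X z * (sff X z)ᴴ).trace • Y z
  back : ∀ z, dMinus Y z * Y z = -(sff X z)ᴴ

open scoped ComplexOrder in
lemma mul_eq_self_of_num {A Y : Mat N} (hY : Y * Y = Y) (h : A * Aᴴ = (A * Aᴴ).trace • Y) :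
    Y * A = A := by
  have h1 : (1 - Y) * A = 0 := by
    apply Matrix.self_mul_conjTranspose_eq_zero.1
    rw [Matrix.conjTranspose_mul, mul_assoc, ← mul_assoc A, h, ← mul_assoc, mul_smul_comm, sub_mul,
      one_mul, hY, sub_self, smul_zero, zero_mul]
  rw [sub_mul, one_mul, sub_eq_zero] at h1
  exact h1.symm

lemma Next.mul_sff {X Y : ℂ → Mat N} (h : Next X Y) {z : ℂ} (hY : IsRankOneProj (Y z)) :
    Y z * sff X z = sff X z := mul_eq_self_of_num hY.idem (h.num z)

lemma Next.sff_conjTranspose_mul {X Y : ℂ → Mat N} (h : Next X Y) {z : ℂ}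
    (hY : IsRankOneProj (Y z)) : (sff X z)ᴴ * Y z = (sff X z)ᴴ := by
  have := congrArg Matrix.conjTranspose (h.mul_sff hY)
  rwa [Matrix.conjTranspose_mul, hY.herm] at this

/-- The normalization of `A A†` is a rank-one projector, as `A† A` is a multiple of the projector
`P` on the initial space. -/
lemma isRankOneProj_inv_trace_smul {A P : Mat N} (hP : IsRankOneProj P) (hA : A * P = A)
    (h0 : A ≠ 0) : IsRankOneProj ((A * Aᴴ).trace⁻¹ • (A * Aᴴ)) := by
  have ht := trace_mul_conjTranspose_ne_zero h0
  have hAP : P * Aᴴ = Aᴴ := by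
    have := congrArg Matrix.conjTranspose hA
    rwa [Matrix.conjTranspose_mul, hP.herm] at this
  have h1 : Aᴴ * A = (A * Aᴴ).trace • P := by
    have := hP.mul_mul (Aᴴ * A)
    rwa [← mul_assoc, hAP, mul_assoc, hA, Matrix.trace_mul_comm Aᴴ A] at this
  have hreal : star (A * Aᴴ).trace = (A * Aᴴ).trace := by
    rw [← Matrix.trace_conjTranspose, Matrix.conjTranspose_mul, Matrix.conjTranspose_conjTranspose]
  refine ⟨?_, ?_, ?_⟩
  · rw [smul_mul_smul_comm, mul_assoc A, ← mul_assoc Aᴴ, h1, smul_mul_assoc, hAP, mul_smul_comm,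
      smul_smul, mul_assoc, inv_mul_cancel₀ ht, mul_one]
  · rw [Matrix.conjTranspose_smul, star_inv₀, hreal, Matrix.conjTranspose_mul,
      Matrix.conjTranspose_conjTranspose]
  · rw [Matrix.trace_smul, smul_eq_mul, inv_mul_cancel₀ ht]

section RaiseExt

variable {s : ℕ} {X : ℂ → Mat N}

lemma dense_sff_ne_zero (hs : 1 ≤ s) (hX : HarmonicProj (s + 1) X) (hne : ∃ z, sff X z ≠ 0) :
    Dense {z | sff X z ≠ 0} := fun p => by
  obtain ⟨B, -, -, h, -⟩ := raiseExt_eventuallyEq hs hX hne p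
  exact mem_closure_iff_frequently.2 (h.frequently.filter_mono nhdsWithin_le_nhds)

lemma mSmoothAt_raiseExt (hs : 1 ≤ s) (hX : HarmonicProj (s + 1) X) (hne : ∃ z, sff X z ≠ 0)
    (p : ℂ) : MSmoothAt s (raiseExt X) p := by
  obtain ⟨B, hB, hB0, -, he⟩ := raiseExt_eventuallyEq hs hX hne p
  have hBB : MSmoothAt s (fun z => B z * (B z)ᴴ) p := hB.mul hB.conjTranspose
  exact (MSmoothAt.smul (hBB.trace.inv (trace_mul_conjTranspose_ne_zero hB0)) hBB).congr he

lemma mSmoothAt_sff (hX : HarmonicProj (s + 1) X) (z : ℂ) : MSmoothAt s (sff X) z := by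
  have h1 : MSmoothAt s (dPlus X) z := by
    rw [dPlus_eq]; exact (hX.smoothAt z).dd (by norm_cast)
  exact h1.mul ((hX.smoothAt z).of_le (by exact_mod_cast Nat.le_succ s))

lemma raiseExt_eq_ladderQuot (hX : HarmonicProj (s + 1) X) {z : ℂ} (hz : sff X z ≠ 0) :
    raiseExt X z = ladderQuot dPlus dMinus X z := by
  have hA := mSmoothAt_sff hX z
  have hAA := hA.mul hA.conjTranspose
  have hc : ContinuousAt (ladderQuot dPlus dMinus X) z := by
    rw [show ladderQuot dPlus dMinus X = _ from funext (ladderQuot_eq hX.rankOne)]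
    exact (hAA.trace.continuousAt.inv₀ (trace_mul_conjTranspose_ne_zero hz)).smul hAA.continuousAt
  exact Tendsto.limUnder_eq (hc.tendsto.mono_left nhdsWithin_le_nhds)

lemma num_raiseExt (hX : HarmonicProj (s + 1) X) (z : ℂ) :
    sff X z * (sff X z)ᴴ = (sff X z * (sff X z)ᴴ).trace • raiseExt X z := by
  by_cases hz : sff X z = 0
  · simp [hz]
  · rw [raiseExt_eq_ladderQuot hX hz, ladderQuot_eq hX.rankOne, smul_smul,
      mul_inv_cancel₀ (trace_mul_conjTranspose_ne_zero hz), one_smul]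

lemma continuous_of_mSmoothAt {r : WithTop ℕ∞} {Y : ℂ → Mat N} (h : ∀ z, MSmoothAt r Y z) :
    Continuous Y := continuous_iff_continuousAt.2 fun z => (h z).continuousAt

lemma isRankOneProj_raiseExt (hs : 1 ≤ s) (hX : HarmonicProj (s + 1) X)
    (hne : ∃ z, sff X z ≠ 0) (z : ℂ) : IsRankOneProj (raiseExt X z) := by
  obtain ⟨B, hB, hB0, hn, he⟩ := raiseExt_eventuallyEq hs hX hne z
  have hc := continuous_of_mSmoothAt (mSmoothAt_raiseExt hs hX hne)
  have hd := dense_sff_ne_zero hs hX hne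
  have hp : ∀ z ∈ {z | sff X z ≠ 0}, IsRankOneProj (raiseExt X z) := fun z hz => by
    rw [raiseExt_eq_ladderQuot hX hz, ladderQuot_eq hX.rankOne]
    exact isRankOneProj_inv_trace_smul (hX.rankOne z) (sff_mul_self hX.rankOne z) hz
  refine ⟨?_, ?_, ?_⟩
  · exact congrFun (Continuous.ext_on hd (hc.mul hc) hc fun z hz => (hp z hz).idem) z
  · exact congrFun (Continuous.ext_on hd hc.matrix_conjTranspose hc fun z hz => (hp z hz).herm) z
  · exact congrFun (Continuous.ext_on hd hc.matrix_trace continuous_const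
      fun z hz => (hp z hz).trace_eq) z

lemma raiseExt_mul (hs : 1 ≤ s) (hX : HarmonicProj (s + 1) X) (hne : ∃ z, sff X z ≠ 0) (z : ℂ) :
    raiseExt X z * X z = 0 := by
  have hcX := continuous_of_mSmoothAt hX.smoothAt
  have hc := continuous_of_mSmoothAt (mSmoothAt_raiseExt hs hX hne)
  refine congrFun (Continuous.ext_on (dense_sff_ne_zero hs hX hne) (hc.mul hcX) continuous_const
    fun z hz => ?_) z
  have hd : MDiffAt X z := (hX.smoothAt z).mdiffAt (by simp)
  change raiseExt X z * X z = 0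
  rw [raiseExt_eq_ladderQuot hX hz, ladderQuot_eq hX.rankOne, smul_mul_assoc, mul_assoc,
    CPSigma.sff_conjTranspose_mul hX.rankOne hd, mul_zero, smul_zero]

/-- Differentiating `Y A = A` and inserting `∂₋A = [A, A†]` gives `∂₋Y A = -A† A`. -/
lemma next_raiseExt (hs : 1 ≤ s) (hX : HarmonicProj (s + 1) X) (hne : ∃ z, sff X z ≠ 0) :
    Next X (raiseExt X) := by
  have hsm := mSmoothAt_raiseExt hs hX hne
  have hY := isRankOneProj_raiseExt hs hX hne
  have hYA : ∀ z, raiseExt X z * sff X z = sff X z := fun z =>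
    mul_eq_self_of_num (hY z).idem (num_raiseExt hX z)
  have hd := dense_sff_ne_zero hs hX hne
  have hs1 : (1 : WithTop ℕ∞) ≤ (s : WithTop ℕ∞) := by exact_mod_cast hs
  have hA := mSmoothAt_sff hX
  have hc := continuous_of_mSmoothAt hsm
  have hdm : ∀ z, MSmoothAt 0 (dMinus (raiseExt X)) z := fun z => (hsm z).dd (by simpa using hs1)
  refine ⟨hd, num_raiseExt hX, fun z => ?_⟩
  refine congrFun (Continuous.ext_on hd ((continuous_of_mSmoothAt hdm).mul hc)
    (continuous_of_mSmoothAt fun z => (hA z)).matrix_conjTranspose.neg fun z hz => ?_) z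
  have hs0 : (s : WithTop ℕ∞) ≠ 0 := fun h => by simp [h] at hs1
  have hmul := dd_mul (c := Complex.I) ((hsm z).mdiffAt hs0) ((hA z).mdiffAt hs0)
  simp only [hYA] at hmul
  have hdA := hX.dMinus_sff (by omega) z
  have hYAs : raiseExt X z * (sff X z)ᴴ = 0 := by
    rw [← mul_sff_conjTranspose hX.rankOne, ← mul_assoc, raiseExt_mul hs hX hne, zero_mul]
  have h1 : dMinus (raiseExt X) z * sff X z = -((sff X z)ᴴ * sff X z) := by
    have h2 : dMinus (sff X) z = dMinus (raiseExt X) z * sff X z +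
      raiseExt X z * dMinus (sff X) z := hmul
    rw [hdA, mul_sub, ← mul_assoc, ← mul_assoc, hYA, hYAs, zero_mul, sub_zero] at h2
    rw [← sub_eq_iff_eq_add] at h2
    rw [← h2]
    abel
  have ht := trace_mul_conjTranspose_ne_zero hz
  have hAY : (sff X z)ᴴ * raiseExt X z = (sff X z)ᴴ := by
    have := congrArg Matrix.conjTranspose (hYA z)
    rwa [Matrix.conjTranspose_mul, (hY z).herm] at this
  have h3 : (sff X z * (sff X z)ᴴ).trace • (dMinus (raiseExt X) z * raiseExt X z) =
      (sff X z * (sff X z)ᴴ).trace • -(sff X z)ᴴ := by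
    rw [← mul_smul_comm, ← num_raiseExt hX, ← mul_assoc, h1, neg_mul, mul_assoc, num_raiseExt hX,
      mul_smul_comm, hAY, smul_neg, Matrix.trace_smul, (hY z).trace_eq, smul_eq_mul, mul_one]
  exact smul_right_injective _ ht h3

/-- Raising preserves the Euler–Lagrange equation and costs one derivative. -/
lemma harmonicProj_raiseExt (hs : 2 ≤ s) (hX : HarmonicProj (s + 1) X)
    (hne : ∃ z, sff X z ≠ 0) : HarmonicProj s (raiseExt X) := by
  have hs1 : 1 ≤ s := by omega
  have hsm := mSmoothAt_raiseExt hs1 hX hne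
  have hY := isRankOneProj_raiseExt hs1 hX hne
  have hnext := next_raiseExt hs1 hX hne
  have hA := mSmoothAt_sff hX
  have hs2 : (2 : WithTop ℕ∞) ≤ (s : WithTop ℕ∞) := by exact_mod_cast hs
  refine ⟨hY, hsm, fun z => eulerLagrange_of_dPlus hY (fun z => (hsm z).of_le hs2) ?_⟩
  have h1 : (fun ζ => dMinus (raiseExt X) ζ * raiseExt X ζ) = fun ζ => (-sff X ζ)ᴴ :=
    funext fun ζ => by
    rw [hnext.back, Matrix.conjTranspose_neg]
  have h2 : dPlus (fun ζ => (-sff X ζ)ᴴ) z = (-dMinus (sff X) z)ᴴ := by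
    rw [dPlus_eq, dd_conjTranspose, map_neg, Complex.conj_I, neg_neg]
    congr 1
    ext i j
    exact sd_neg
  rw [h1, h2, hX.dMinus_sff (by omega), neg_sub]
  simp only [Matrix.conjTranspose_sub, Matrix.conjTranspose_mul, Matrix.conjTranspose_conjTranspose]
  have hX0 : (sff X z)ᴴ * sff X z * raiseExt X z = 0 := by
    have h3 : X z * raiseExt X z = 0 := by
      have := congrArg Matrix.conjTranspose (raiseExt_mul hs1 hX hne z)
      rwa [Matrix.conjTranspose_mul, (hY z).herm, (hX.rankOne z).herm,
        Matrix.conjTranspose_zero] at this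
    rw [mul_assoc, ← sff_mul_self hX.rankOne, mul_assoc, h3, mul_zero, mul_zero]
  have h4 : ((sff X z)ᴴ * sff X z - sff X z * (sff X z)ᴴ) * raiseExt X z =
      -((sff X z * (sff X z)ᴴ).trace • raiseExt X z) := by
    rw [sub_mul, hX0, zero_sub, num_raiseExt hX, smul_mul_assoc, (hY z).idem, Matrix.trace_smul,
      (hY z).trace_eq, smul_eq_mul, mul_one]
  rw [mul_assoc, h4, mul_neg, mul_smul_comm, sub_mul, one_mul, (hY z).idem, sub_self, smul_zero,
    neg_zero]

end RaiseExt

end Step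

/-! ### The coordinate change `w = 1 / z` -/

section Inversion

variable {N : ℕ}

lemma sd_comp_inv {c : ℂ} {f : ℂ → ℂ} {w : ℂ} (hw : w ≠ 0)
    (hf : DifferentiableAt ℝ f w⁻¹) {b : ℂ}
    (hb : ∀ L : ℂ →L[ℝ] ℂ, L (-(w ^ 2)⁻¹) + c * L (-(w ^ 2)⁻¹ * Complex.I) =
      b * (L 1 + c * L Complex.I)) :
    sd c (fun y => f y⁻¹) w = b * sd c f w⁻¹ := by
  have h1 : HasFDerivAt (fun y : ℂ => y⁻¹)
      ((ContinuousLinearMap.toSpanSingleton ℂ (-(w ^ 2)⁻¹)).restrictScalars ℝ) w :=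
    (hasDerivAt_inv hw).hasFDerivAt.restrictScalars ℝ
  have h2 : HasFDerivAt (fun y => f y⁻¹) _ w := hf.hasFDerivAt.comp w h1
  rw [sd, h2.fderiv, sd, mul_left_comm, ← hb]
  simp [mul_comm]

lemma clm_apply_eq (L : ℂ →L[ℝ] ℂ) (w : ℂ) : L w = w.re * L 1 + w.im * L Complex.I := by
  conv_lhs => rw [show w = w.re • (1 : ℂ) + w.im • Complex.I by simp [Complex.re_add_im]]
  rw [map_add, map_smul, map_smul, Complex.real_smul, Complex.real_smul]

lemma sd_neg_I_comp_inv {f : ℂ → ℂ} {w : ℂ} (hw : w ≠ 0) (hf : DifferentiableAt ℝ f w⁻¹) :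
    sd (-Complex.I) (fun y => f y⁻¹) w = -(w ^ 2)⁻¹ * sd (-Complex.I) f w⁻¹ := by
  refine sd_comp_inv hw hf fun L => ?_
  generalize -(w ^ 2)⁻¹ = a
  rw [clm_apply_eq L a, clm_apply_eq L (a * Complex.I)]
  conv_rhs => rw [← Complex.re_add_im a]
  simp only [Complex.mul_re, Complex.mul_im, Complex.I_re, Complex.I_im]
  push_cast
  linear_combination (a.im * L Complex.I) * Complex.I_sq

lemma sd_I_comp_inv {f : ℂ → ℂ} {w : ℂ} (hw : w ≠ 0) (hf : DifferentiableAt ℝ f w⁻¹) :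
    sd Complex.I (fun y => f y⁻¹) w = -conj (w ^ 2)⁻¹ * sd Complex.I f w⁻¹ := by
  refine sd_comp_inv hw hf fun L => ?_
  rw [← map_neg]
  generalize -(w ^ 2)⁻¹ = a
  rw [clm_apply_eq L a, clm_apply_eq L (a * Complex.I),
    show conj a = a.re - a.im * Complex.I from Complex.ext (by simp) (by simp)]
  simp only [Complex.mul_re, Complex.mul_im, Complex.I_re, Complex.I_im]
  push_cast
  linear_combination (a.im * L Complex.I) * Complex.I_sq

lemma dPlus_comp_inv {X : ℂ → Mat N} {w : ℂ} (hw : w ≠ 0) (hX : MDiffAt X w⁻¹) :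
    dPlus (fun y => X y⁻¹) w = -(w ^ 2)⁻¹ • dPlus X w⁻¹ := by
  ext i j
  rw [dPlus_eq]
  exact sd_neg_I_comp_inv hw (hX i j)

lemma dMinus_comp_inv {X : ℂ → Mat N} {w : ℂ} (hw : w ≠ 0) (hX : MDiffAt X w⁻¹) :
    dMinus (fun y => X y⁻¹) w = -conj (w ^ 2)⁻¹ • dMinus X w⁻¹ := by
  ext i j
  exact sd_I_comp_inv hw (hX i j)

lemma inv_eventuallyEq {X : OnePoint ℂ → Mat N} {w : ℂ} (hw : w ≠ 0) :
    inv X =ᶠ[𝓝 w] fun y => aff X y⁻¹ := by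
  filter_upwards [eventually_ne_nhds hw] with y hy
  rw [inv, if_neg hy]; rfl

lemma sff_inv {X : OnePoint ℂ → Mat N} {w : ℂ} (hw : w ≠ 0) (hX : MDiffAt (aff X) w⁻¹) :
    sff (inv X) w = -(w ^ 2)⁻¹ • sff (aff X) w⁻¹ := by
  have h := inv_eventuallyEq (X := X) hw
  have h1 : dPlus (inv X) w = -(w ^ 2)⁻¹ • dPlus (aff X) w⁻¹ := by
    rw [← dPlus_comp_inv hw hX, dPlus_eq]
    exact dd_congr h
  rw [sff, sff, h1, h.self_of_nhds, smul_mul_assoc]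

lemma differentiableAt_inv_sq {w : ℂ} (hw : w ≠ 0) :
    DifferentiableAt ℂ (fun y : ℂ => -(y ^ 2)⁻¹) w :=
  ((differentiableAt_id.pow 2).inv (pow_ne_zero 2 hw)).neg

lemma sd_I_eq_zero {f : ℂ → ℂ} {z : ℂ} (hf : DifferentiableAt ℂ f z) : sd Complex.I f z = 0 := by
  have h := hf.hasFDerivAt.restrictScalars ℝ
  rw [sd, h.fderiv]
  have : fderiv ℂ f z Complex.I = Complex.I * fderiv ℂ f z 1 := by
    rw [← smul_eq_mul, ← map_smul, smul_eq_mul, mul_one]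
  simp only [ContinuousLinearMap.coe_restrictScalars', this]
  linear_combination (1 / 2 * fderiv ℂ f z 1) * Complex.I_sq

/-- The Euler–Lagrange operator is conformally covariant. -/
lemma dPlus_dMinus_inv {X : OnePoint ℂ → Mat N} {w : ℂ} (hw : w ≠ 0)
    (hX : ∀ z, MSmoothAt 2 (aff X) z) :
    dPlus (dMinus (inv X)) w =
      (-conj (w ^ 2)⁻¹ * -(w ^ 2)⁻¹) • dPlus (dMinus (aff X)) w⁻¹ := by
  have hd : ∀ z, MDiffAt (aff X) z := fun z => (hX z).mdiffAt (by norm_num)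
  have hdd : ∀ z, MDiffAt (dMinus (aff X)) z := fun z =>
    ((hX z).dd (s := 1) (by norm_num)).mdiffAt (by norm_num)
  have h1 : dMinus (inv X) =ᶠ[𝓝 w] fun y => -conj (y ^ 2)⁻¹ • dMinus (aff X) y⁻¹ := by
    filter_upwards [(inv_eventuallyEq (X := X) hw).eventuallyEq_nhds, eventually_ne_nhds hw]
      with y hy hy0
    rw [← dMinus_comp_inv hy0 (hd _)]
    exact dd_congr hy
  have hsc : DifferentiableAt ℝ (fun y : ℂ => -conj (y ^ 2)⁻¹) w := by
    have := (Complex.conjCLE : ℂ →L[ℝ] ℂ).differentiableAt.comp w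
      ((differentiableAt_inv_sq hw).restrictScalars ℝ)
    refine this.congr_of_eventuallyEq (Eventually.of_forall fun y => ?_)
    simp
  have hsc0 : sd (-Complex.I) (fun y : ℂ => -conj (y ^ 2)⁻¹) w = 0 := by
    have h2 : (fun y : ℂ => -conj (y ^ 2)⁻¹) = fun y : ℂ => conj (-(y ^ 2)⁻¹) := by
      funext y; rw [map_neg]
    rw [h2, sd_conj, map_neg, Complex.conj_I, neg_neg, sd_I_eq_zero (differentiableAt_inv_sq hw),
      map_zero]
  have hinv : DifferentiableAt ℝ (fun y : ℂ => y⁻¹) w :=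
    ((differentiableAt_id (𝕜 := ℂ)).inv hw).restrictScalars ℝ
  have h3 : dPlus (dMinus (inv X)) w =
      dPlus (fun y => -conj (y ^ 2)⁻¹ • dMinus (aff X) y⁻¹) w := by
    rw [dPlus_eq]; exact dd_congr h1
  rw [h3, mul_smul, ← dPlus_comp_inv hw (hdd _), dPlus_eq]
  ext i j
  have hg : DifferentiableAt ℝ (fun y => dMinus (aff X) y⁻¹ i j) w :=
    DifferentiableAt.comp w (hdd _ i j) hinv
  refine (sd_mul hsc hg).trans ?_
  rw [hsc0, zero_mul, zero_add]
  rfl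

end Inversion

/-! ### Harmonic projectors on the sphere -/

section Sphere

variable {N : ℕ}

/-- A harmonic projector function of class `C^r` on the sphere: it is one in both charts. -/
structure SphereHarmonic (r : ℕ) (X : OnePoint ℂ → Mat N) : Prop where
  aff : HarmonicProj r (aff X)
  inv : HarmonicProj r (inv X)

lemma SphereHarmonic.rankOne {r : ℕ} {X : OnePoint ℂ → Mat N} (h : SphereHarmonic r X)
    (p : OnePoint ℂ) : IsRankOneProj (X p) := by
  induction p with
  | infty => simpa [CPSigma.inv] using h.inv.rankOne 0
  | coe z => exact h.aff.rankOne z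

lemma eq_of_frequently_eq {E : Type*} [TopologicalSpace E] [T2Space E] {f g : ℂ → E} {z : ℂ}
    (hf : ContinuousAt f z) (hg : ContinuousAt g z) (h : ∃ᶠ y in 𝓝 z, f y = g y) : f z = g z :=
  isClosed_diagonal.mem_of_frequently_of_tendsto h (hf.tendsto.prodMk_nhds hg.tendsto)

lemma IsFiniteActionSolution.sphereHarmonic {r : ℕ} (hr : 2 ≤ r) {X : OnePoint ℂ → Mat N}
    (h : IsFiniteActionSolution r X) : SphereHarmonic r X := by
  have hs : ∀ z, MSmoothAt r (CPSigma.aff X) z := fun z i j => (h.smooth.1 i j).contDiffAt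
  have hsi : ∀ z, MSmoothAt r (CPSigma.inv X) z := fun z i j => (h.smooth.2 i j).contDiffAt
  have h2 : (2 : WithTop ℕ∞) ≤ (r : WithTop ℕ∞) := by exact_mod_cast hr
  refine ⟨⟨fun z => h.rankOne z, hs, h.eulerLagrange⟩, fun z => ?_, hsi, ?_⟩
  · rw [CPSigma.inv]; split_ifs <;> exact h.rankOne _
  · have hcX := continuous_of_mSmoothAt hsi
    have hcS : Continuous (dPlus (dMinus (CPSigma.inv X))) := by
      rw [dPlus_eq]
      exact continuous_of_mSmoothAt fun z =>
        (((hsi z).of_le h2).dd (c := Complex.I) (s := 1) (by norm_num)).dd (s := 0) (by norm_num)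
    refine congrFun (Continuous.ext_on (dense_compl_singleton (0 : ℂ))
      ((hcS.mul hcX).sub (hcX.mul hcS)) continuous_const fun w hw => ?_)
    have hw0 : w ≠ 0 := hw
    have hE := h.eulerLagrange w⁻¹
    change dPlus (dMinus (CPSigma.inv X)) w * CPSigma.inv X w -
      CPSigma.inv X w * dPlus (dMinus (CPSigma.inv X)) w = 0
    rw [dPlus_dMinus_inv hw0 (fun z => (hs z).of_le h2), (inv_eventuallyEq hw0).self_of_nhds,
      smul_mul_assoc, mul_smul_comm, ← smul_sub, hE, smul_zero]

/-- The extension of the quotient in `Π₊X` to the sphere, assembled from the two charts. -/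
def raiseS (X : OnePoint ℂ → Mat N) (p : OnePoint ℂ) : Mat N :=
  p.elim (raiseExt (CPSigma.inv X) 0) (raiseExt (CPSigma.aff X))

lemma SphereHarmonic.sff_inv {r : ℕ} (hr : 1 ≤ r) {X : OnePoint ℂ → Mat N}
    (h : SphereHarmonic r X) {w : ℂ} (hw : w ≠ 0) :
    sff (CPSigma.inv X) w = -(w ^ 2)⁻¹ • sff (CPSigma.aff X) w⁻¹ := by
  refine CPSigma.sff_inv hw ((h.aff.smoothAt _).mdiffAt ?_)
  have : r ≠ 0 := by omega
  exact_mod_cast this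

lemma SphereHarmonic.exists_sff_inv_ne_zero {s : ℕ} {X : OnePoint ℂ → Mat N}
    (hX : SphereHarmonic (s + 1) X) (hne : ∃ z, sff (CPSigma.aff X) z ≠ 0) :
    ∃ z, sff (CPSigma.inv X) z ≠ 0 := by
  obtain ⟨z, hz⟩ := hne
  have hc := (mSmoothAt_sff hX.aff z).continuousAt
  have : (𝓝[{0}ᶜ] z).NeBot := mem_closure_iff_nhdsWithin_neBot.1 (dense_compl_singleton 0 z)
  obtain ⟨y, hy, hy0⟩ := (((hc.eventually_ne hz).filter_mono nhdsWithin_le_nhds).and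
    (self_mem_nhdsWithin (s := {0}ᶜ))).exists
  have hy0' : y ≠ 0 := hy0
  refine ⟨y⁻¹, ?_⟩
  rw [hX.sff_inv (by omega) (inv_ne_zero hy0'), inv_inv]
  exact smul_ne_zero (neg_ne_zero.2 (inv_ne_zero (pow_ne_zero 2 (inv_ne_zero hy0')))) hy

lemma inv_raiseS {s : ℕ} (hs : 1 ≤ s) {X : OnePoint ℂ → Mat N} (hX : SphereHarmonic (s + 1) X)
    (hne : ∃ z, sff (CPSigma.aff X) z ≠ 0) :
    CPSigma.inv (raiseS X) = raiseExt (CPSigma.inv X) := by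
  funext w
  by_cases hw : w = 0
  · rw [CPSigma.inv, if_pos hw, hw]; rfl
  rw [CPSigma.inv, if_neg hw]
  change raiseExt (CPSigma.aff X) w⁻¹ = _
  have hne' := hX.exists_sff_inv_ne_zero hne
  have h1 : ContinuousAt (fun y => raiseExt (CPSigma.aff X) y⁻¹) w :=
    ContinuousAt.comp (f := fun y : ℂ => y⁻¹)
      (continuous_of_mSmoothAt (mSmoothAt_raiseExt hs hX.aff hne)).continuousAt
      (continuousAt_inv₀ hw)
  have h2 : ContinuousAt (raiseExt (CPSigma.inv X)) w :=
    (mSmoothAt_raiseExt hs hX.inv hne' w).continuousAt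
  refine eq_of_frequently_eq h1 h2 ?_
  have hf : ∃ᶠ y in 𝓝 w, sff (CPSigma.inv X) y ≠ 0 :=
    mem_closure_iff_frequently.1 (dense_sff_ne_zero hs hX.inv hne' w)
  refine (hf.and_eventually (eventually_ne_nhds hw)).mono fun y hy => ?_
  have hy2 := hX.sff_inv (by omega) hy.2
  have hc : -(y ^ 2)⁻¹ ≠ 0 := neg_ne_zero.2 (inv_ne_zero (pow_ne_zero 2 hy.2))
  have hy3 : sff (CPSigma.aff X) y⁻¹ ≠ 0 := fun h0 => hy.1 (by rw [hy2, h0, smul_zero])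
  rw [raiseExt_eq_ladderQuot hX.aff hy3, raiseExt_eq_ladderQuot hX.inv hy.1,
    ladderQuot_eq hX.aff.rankOne, ladderQuot_eq hX.inv.rankOne, hy2, inv_trace_smul_smul hc]

variable {d d' : (ℂ → Mat N) → ℂ → Mat N}

lemma ladder_eq_of_tendsto {X : OnePoint ℂ → Mat N} {p : OnePoint ℂ} {A : Mat N}
    (hne : (ladderFilter d d' (CPSigma.aff X) p).NeBot)
    (h : Tendsto (ladderQuot d d' (CPSigma.aff X)) (ladderFilter d d' (CPSigma.aff X) p) (𝓝 A)) :
    ladder d d' X p = A := by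
  have hex : ∃ A, Tendsto (ladderQuot d d' (CPSigma.aff X))
      (ladderFilter d d' (CPSigma.aff X) p) (𝓝 A) := ⟨A, h⟩
  rw [ladder, dif_pos ⟨hne, hex⟩]
  exact tendsto_nhds_unique hex.choose_spec h

/-- A continuous function on the sphere that agrees with the quotient on a dense set is the
extended quotient. -/
lemma ladder_eq {X Y : OnePoint ℂ → Mat N}
    (hq : ∀ z, ladderNum d d' (CPSigma.aff X) z ≠ 0 →
      ladderQuot d d' (CPSigma.aff X) z = CPSigma.aff Y z)
    (hd : Dense {z | ladderNum d d' (CPSigma.aff X) z ≠ 0})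
    (hc : Continuous (CPSigma.aff Y)) (hc' : Continuous (CPSigma.inv Y)) : ladder d d' X = Y := by
  funext p
  have heq : CPSigma.aff Y =ᶠ[ladderFilter d d' (CPSigma.aff X) p]
      ladderQuot d d' (CPSigma.aff X) := by
    filter_upwards [mem_inf_of_right (mem_principal_self _)] with z hz using (hq z hz).symm
  refine ladder_eq_of_tendsto ?_ (Tendsto.congr' heq ?_)
  · induction p with
    | infty =>
      rw [ladderFilter, OnePoint.comap_coe_nhds_infty, coclosedCompact_eq_cocompact,
        ← Metric.cobounded_eq_cocompact, inf_principal_neBot_iff]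
      intro U hU
      have : (interior U).Nonempty := by
        obtain ⟨r, -, hr⟩ := (Metric.hasBasis_cobounded_compl_closedBall (0 : ℂ)).mem_iff.1 hU
        have hsub := interior_maximal hr Metric.isClosed_closedBall.isOpen_compl
        refine Set.Nonempty.mono hsub ⟨((|r| + 1 : ℝ) : ℂ), fun hmem => ?_⟩
        rw [Metric.mem_closedBall, dist_zero_right, Complex.norm_real,
          Real.norm_of_nonneg (by positivity)] at hmem
        linarith [le_abs_self r]
      obtain ⟨z, hz1, hz2⟩ := hd.inter_open_nonempty _ isOpen_interior this
      exact ⟨z, interior_subset hz1, hz2⟩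
    | coe z =>
      rw [ladderFilter, OnePoint.comap_coe_nhds]
      exact mem_closure_iff_nhdsWithin_neBot.1 (hd z)
  · refine Tendsto.mono_left ?_ inf_le_left
    induction p with
    | infty =>
      rw [OnePoint.comap_coe_nhds_infty, coclosedCompact_eq_cocompact,
        ← Metric.cobounded_eq_cocompact]
      have h0 : CPSigma.inv Y 0 = Y OnePoint.infty := by simp [CPSigma.inv]
      rw [← h0]
      refine (hc'.continuousAt.tendsto.comp tendsto_inv₀_cobounded).congr' ?_
      filter_upwards [tendsto_norm_cobounded_atTop.eventually_gt_atTop (0 : ℝ)] with z hz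
      simp [CPSigma.inv, CPSigma.aff, norm_pos_iff.1 hz]
    | coe z =>
      rw [OnePoint.comap_coe_nhds]
      exact hc.continuousAt.tendsto

/-- If the numerator vanishes identically, the result is `0`. -/
lemma ladder_eq_zero {X : OnePoint ℂ → Mat N}
    (h : ∀ z, ladderNum d d' (CPSigma.aff X) z = 0) : ladder d d' X = 0 := by
  funext p
  rw [ladder, dif_neg]
  · induction p with
    | infty => rfl
    | coe z => simp [ladderQuot, h]
  · rintro ⟨hne, -⟩
    have : {z | ladderNum d d' (CPSigma.aff X) z ≠ 0} = ∅ := by simp [h]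
    simp only [ladderFilter, this, principal_empty, inf_bot_eq] at hne
    exact hne.ne rfl

/-- `Y` follows `X` in both charts. -/
structure NextS (X Y : OnePoint ℂ → Mat N) : Prop where
  aff : Next (aff X) (aff Y)
  inv : Next (inv X) (inv Y)

lemma SphereHarmonic.raise_eq {s : ℕ} (hs : 1 ≤ s) {X : OnePoint ℂ → Mat N}
    (hX : SphereHarmonic (s + 1) X) (hne : ∃ z, sff (CPSigma.aff X) z ≠ 0) :
    raise X = raiseS X := by
  refine ladder_eq (fun z hz => ?_) ?_ ?_ ?_
  · exact (raiseExt_eq_ladderQuot hX.aff ((ladderNum_ne_zero_iff hX.aff.rankOne z).1 hz)).symm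
  · simp only [ladderNum_ne_zero_iff hX.aff.rankOne]
    exact dense_sff_ne_zero hs hX.aff hne
  · exact continuous_of_mSmoothAt (mSmoothAt_raiseExt hs hX.aff hne)
  · rw [inv_raiseS hs hX hne]
    exact continuous_of_mSmoothAt (mSmoothAt_raiseExt hs hX.inv (hX.exists_sff_inv_ne_zero hne))

lemma SphereHarmonic.nextS_raise {s : ℕ} (hs : 1 ≤ s) {X : OnePoint ℂ → Mat N}
    (hX : SphereHarmonic (s + 1) X) (hne : ∃ z, sff (CPSigma.aff X) z ≠ 0) :
    NextS X (raise X) := by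
  rw [hX.raise_eq hs hne]
  refine ⟨next_raiseExt hs hX.aff hne, ?_⟩
  rw [inv_raiseS hs hX hne]
  exact next_raiseExt hs hX.inv (hX.exists_sff_inv_ne_zero hne)

lemma SphereHarmonic.sphereHarmonic_raise {s : ℕ} (hs : 2 ≤ s) {X : OnePoint ℂ → Mat N}
    (hX : SphereHarmonic (s + 1) X) (hne : ∃ z, sff (CPSigma.aff X) z ≠ 0) :
    SphereHarmonic s (raise X) := by
  rw [hX.raise_eq (by omega) hne]
  refine ⟨harmonicProj_raiseExt hs hX.aff hne, ?_⟩
  rw [inv_raiseS (by omega) hX hne]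
  exact harmonicProj_raiseExt hs hX.inv (hX.exists_sff_inv_ne_zero hne)

lemma SphereHarmonic.raise_eq_zero {r : ℕ} {X : OnePoint ℂ → Mat N} (hX : SphereHarmonic r X)
    (h : ∀ z, sff (CPSigma.aff X) z = 0) : raise X = 0 :=
  ladder_eq_zero fun z => by rw [ladderNum_eq hX.aff.rankOne, h, zero_mul]

lemma raise_zero : raise (0 : OnePoint ℂ → Mat N) = 0 :=
  ladder_eq_zero fun z => by
    have : CPSigma.aff (0 : OnePoint ℂ → Mat N) z = 0 := rfl
    rw [ladderNum, this, mul_zero, zero_mul]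

lemma lower_zero : lower (0 : OnePoint ℂ → Mat N) = 0 :=
  ladder_eq_zero fun z => by
    have : CPSigma.aff (0 : OnePoint ℂ → Mat N) z = 0 := rfl
    rw [ladderNum, this, mul_zero, zero_mul]

/-- Lowering undoes raising. -/
lemma NextS.lower_eq {r r' : ℕ} {X Y : OnePoint ℂ → Mat N} (h : NextS X Y)
    (hX : SphereHarmonic r X) (hY : SphereHarmonic r' Y) : lower Y = X := by
  have hnum : ∀ z, ladderNum dMinus dPlus (CPSigma.aff Y) z =
      (sff (CPSigma.aff X) z)ᴴ * sff (CPSigma.aff X) z := fun z => by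
    have h1 : CPSigma.aff Y z * dPlus (CPSigma.aff Y) z = -sff (CPSigma.aff X) z := by
      have := congrArg Matrix.conjTranspose (h.aff.back z)
      rwa [dMinus_eq_conjTranspose hY.aff.rankOne, Matrix.conjTranspose_mul,
        Matrix.conjTranspose_conjTranspose, (hY.aff.rankOne z).herm, Matrix.conjTranspose_neg,
        Matrix.conjTranspose_conjTranspose] at this
    rw [ladderNum, ← (hY.aff.rankOne z).idem, ← mul_assoc, h.aff.back, mul_assoc, h1, neg_mul_neg]
  have hXA : ∀ z, (sff (CPSigma.aff X) z)ᴴ * sff (CPSigma.aff X) z =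
      (sff (CPSigma.aff X) z * (sff (CPSigma.aff X) z)ᴴ).trace • CPSigma.aff X z := fun z => by
    have := (hX.aff.rankOne z).mul_mul ((sff (CPSigma.aff X) z)ᴴ * sff (CPSigma.aff X) z)
    rwa [← mul_assoc, mul_sff_conjTranspose hX.aff.rankOne, mul_assoc,
      sff_mul_self hX.aff.rankOne, Matrix.trace_mul_comm] at this
  have hiff : ∀ z, ladderNum dMinus dPlus (CPSigma.aff Y) z ≠ 0 ↔ sff (CPSigma.aff X) z ≠ 0 := by
    intro z
    rw [hnum]
    refine ⟨fun h0 h1 => h0 (by rw [h1, mul_zero]), fun h0 h1 => ?_⟩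
    apply trace_mul_conjTranspose_ne_zero h0
    rw [Matrix.trace_mul_comm, h1, Matrix.trace_zero]
  refine ladder_eq (fun z hz => ?_) ?_ (continuous_of_mSmoothAt hX.aff.smoothAt)
    (continuous_of_mSmoothAt hX.inv.smoothAt)
  · have ht := trace_mul_conjTranspose_ne_zero ((hiff z).1 hz)
    rw [ladderQuot, hnum, Matrix.trace_mul_comm, hXA, smul_smul, inv_mul_cancel₀ ht, one_smul]
  · simp only [hiff]
    exact h.aff.dense

end Sphere

/-! ### Orthogonality along the sequence -/

section Orthogonality

variable {N : ℕ}

lemma mSmoothAt_sff_of_two {X : ℂ → Mat N} (hX : HarmonicProj 2 X) (z : ℂ) :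
    MSmoothAt 1 (sff X) z := by
  have := mSmoothAt_sff (s := 1) hX z
  exact_mod_cast this

lemma Next.mul_eq_zero {X Y : ℂ → Mat N} (h : Next X Y) (hX : HarmonicProj 2 X)
    (hY : HarmonicProj 2 Y) (z : ℂ) : Y z * X z = 0 := by
  have hcX := continuous_of_mSmoothAt hX.smoothAt
  have hcY := continuous_of_mSmoothAt hY.smoothAt
  refine congrFun (Continuous.ext_on h.dense (hcY.mul hcX) continuous_const fun z hz => ?_) z
  have hd : MDiffAt X z := (hX.smoothAt z).mdiffAt (by norm_num)
  have ht := trace_mul_conjTranspose_ne_zero hz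
  apply smul_right_injective _ ht
  change _ • (Y z * X z) = _ • (0 : Mat N)
  rw [← smul_mul_assoc, ← h.num, mul_assoc, CPSigma.sff_conjTranspose_mul hX.rankOne hd, mul_zero,
    smul_zero]

/-- The composition `A_{k-1} ⋯ A_0` of the second fundamental forms of a sequence, a map from the
image of `X 0` to the image of `X k`. -/
def sffComp (X : ℕ → ℂ → Mat N) : ℕ → ℂ → Mat N
  | 0 => X 0
  | k + 1 => fun z => sff (X k) z * sffComp X k z

lemma mul_eq_zero_comm {P Q : Mat N} (hP : IsRankOneProj P) (hQ : IsRankOneProj Q)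
    (h : P * Q = 0) : Q * P = 0 := by
  have := congrArg Matrix.conjTranspose h
  rwa [Matrix.conjTranspose_mul, hP.herm, hQ.herm, Matrix.conjTranspose_zero] at this

/-- A sequence of harmonic projectors in one chart, each of which follows its predecessor. -/
structure ChartChain (s : ℕ) (X : ℕ → ℂ → Mat N) : Prop where
  harmonic : ∀ i ≤ s, HarmonicProj 2 (X i)
  next : ∀ i < s, Next (X i) (X (i + 1))

namespace ChartChain

variable {s : ℕ} {X : ℕ → ℂ → Mat N}

lemma mSmoothAt_sffComp (h : ChartChain s X) {k : ℕ} (hk : k ≤ s) (z : ℂ) :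
    MSmoothAt 1 (sffComp X k) z := by
  induction k with
  | zero => exact ((h.harmonic 0 (Nat.zero_le _)).smoothAt z).of_le (by norm_num)
  | succ k ih => exact (mSmoothAt_sff_of_two (h.harmonic k (by omega)) z).mul (ih (by omega))

lemma mul_sffComp (h : ChartChain s X) {k : ℕ} (hk : k ≤ s) (z : ℂ) :
    X k z * sffComp X k z = sffComp X k z := by
  cases k with
  | zero => exact ((h.harmonic 0 (Nat.zero_le _)).rankOne z).idem
  | succ k =>
    simp only [sffComp]
    rw [← mul_assoc, (h.next k (by omega)).mul_sff ((h.harmonic (k + 1) hk).rankOne z)]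

lemma sffComp_mul (h : ChartChain s X) {k : ℕ} (hk : k ≤ s) (z : ℂ) :
    sffComp X k z * X 0 z = sffComp X k z := by
  induction k with
  | zero => exact ((h.harmonic 0 (Nat.zero_le _)).rankOne z).idem
  | succ k ih => simp only [sffComp]; rw [mul_assoc, ih (by omega)]

lemma sff_conjTranspose_mul_sff (h : HarmonicProj 2 (X s)) (z : ℂ) :
    (sff (X s) z)ᴴ * sff (X s) z =
      (sff (X s) z * (sff (X s) z)ᴴ).trace • X s z := by
  have := (h.rankOne z).mul_mul ((sff (X s) z)ᴴ * sff (X s) z)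
  rwa [← mul_assoc, mul_sff_conjTranspose h.rankOne, mul_assoc, sff_mul_self h.rankOne,
    Matrix.trace_mul_comm] at this

/-- The covariant `∂₋`-derivative of the composition lowers its length by one. -/
lemma dMinus_sffComp_mul (h : ChartChain s X) {k : ℕ} (hk : k + 1 ≤ s) (z : ℂ) :
    dMinus (sffComp X (k + 1)) z * X 0 z =
      -((sff (X k) z * (sff (X k) z)ᴴ).trace • sffComp X k z) := by
  induction k with
  | zero =>
    have h0 := h.harmonic 0 (Nat.zero_le _)
    have hd : MDiffAt (X 0) z := (h0.smoothAt z).mdiffAt (by norm_num)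
    have e : sffComp X 1 = sff (X 0) := funext fun ζ => sff_mul_self h0.rankOne ζ
    rw [e, h0.dMinus_sff le_rfl, sub_mul, mul_assoc, sff_conjTranspose_mul h0.rankOne hd, mul_zero,
      zero_sub, mul_assoc, sff_mul_self h0.rankOne, sff_conjTranspose_mul_sff h0]
    rfl
  | succ k ih =>
    have h1 := h.harmonic (k + 1) (by omega)
    have hd : MDiffAt (X (k + 1)) z := (h1.smoothAt z).mdiffAt (by norm_num)
    have hB := h.mul_sffComp (k := k + 1) (by omega) z
    have e : dMinus (sffComp X (k + 1 + 1)) z = _ :=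
      dd_mul ((mSmoothAt_sff_of_two h1 z).mdiffAt (by norm_num))
        ((h.mSmoothAt_sffComp (k := k + 1) (by omega) z).mdiffAt (by norm_num))
    have hdm : dd Complex.I (sff (X (k + 1))) z = _ := h1.dMinus_sff le_rfl z
    have ih' : dd Complex.I (sffComp X (k + 1)) z * X 0 z = _ := ih (by omega)
    rw [e, add_mul, mul_assoc, mul_assoc, h.sffComp_mul (by omega), ih', hdm, sub_mul]
    have e1 : sff (X (k + 1)) z * (sff (X (k + 1)) z)ᴴ * sffComp X (k + 1) z = 0 := by
      rw [← hB, mul_assoc, ← mul_assoc _ (X (k + 1) z), sff_conjTranspose_mul h1.rankOne hd,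
        zero_mul, mul_zero]
    have e2 : sff (X (k + 1)) z * sffComp X k z = 0 := by
      rw [← sff_mul_self h1.rankOne, ← h.mul_sffComp (k := k) (by omega), mul_assoc,
        ← mul_assoc (X (k + 1) z), (h.next k (by omega)).mul_eq_zero (h.harmonic k (by omega)) h1,
        zero_mul, mul_zero]
    rw [e1, sff_conjTranspose_mul_sff h1, smul_mul_assoc, hB, zero_sub, mul_neg, mul_smul_comm, e2,
      smul_zero, neg_zero, add_zero]

/-- The trace of the composition is holomorphic if the required orthogonality relations hold for
the shorter pieces of the sequence. -/
lemma differentiable_trace_sffComp (h : ChartChain (s + 2) X)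
    (h0 : ∀ z, X 0 z * X (s + 1) z = 0) (h1 : ∀ z, X 1 z * X (s + 2) z = 0) :
    Differentiable ℂ fun z => (sffComp X (s + 2) z).trace := by
  intro z
  have hB := h.mSmoothAt_sffComp le_rfl z
  have hX0 := h.harmonic 0 (Nat.zero_le _)
  refine differentiableAt_of_dbar_eq_zero (hB.trace.differentiableAt (by norm_num)) ?_
  change sd Complex.I (fun z => (sffComp X (s + 2) z).trace) z = 0
  rw [dd_trace (hB.mdiffAt (by norm_num))]
  have e : dd Complex.I (sffComp X (s + 2)) z = dMinus (sffComp X (s + 2)) z * X 0 z +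
      sffComp X (s + 2) z * dMinus (X 0) z := by
    have h2 : sffComp X (s + 2) = fun ζ => sffComp X (s + 2) ζ * X 0 ζ :=
      funext fun ζ => (h.sffComp_mul le_rfl ζ).symm
    conv_lhs => rw [h2]
    exact dd_mul (hB.mdiffAt (by norm_num)) ((hX0.smoothAt z).mdiffAt (by norm_num))
  have e1 : (sffComp X (s + 1) z).trace = 0 := by
    rw [← h.sffComp_mul (by omega), ← h.mul_sffComp (by omega), mul_assoc, Matrix.trace_mul_comm,
      mul_assoc, h0, mul_zero, Matrix.trace_zero]
  have e2 : (sffComp X (s + 2) z * dMinus (X 0) z).trace = 0 := by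
    have h3 : (sff (X 0) z)ᴴ * X (s + 2) z = 0 := by
      have h4 := (h.next 0 (by omega)).sff_conjTranspose_mul
        ((h.harmonic 1 (by omega)).rankOne z)
      rw [← h4, mul_assoc, h1, mul_zero]
    rw [← h.mul_sffComp le_rfl, ← h.sffComp_mul le_rfl, mul_assoc, mul_assoc,
      ← sff_conjTranspose hX0.rankOne, Matrix.trace_mul_comm, mul_assoc, h3, mul_zero,
      Matrix.trace_zero]
  rw [e, Matrix.trace_add, e2, h.dMinus_sffComp_mul le_rfl, Matrix.trace_neg, Matrix.trace_smul, e1,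
    smul_zero, neg_zero, add_zero]

lemma sffComp_mul_conjTranspose (h : ChartChain s X) {z : ℂ}
    (hz : ∀ i < s, sff (X i) z ≠ 0) {k : ℕ} (hk : k ≤ s) :
    ∃ c : ℂ, c ≠ 0 ∧ sffComp X k z * (sffComp X k z)ᴴ = c • X k z := by
  induction k with
  | zero =>
    have h0 := (h.harmonic 0 (Nat.zero_le _)).rankOne z
    exact ⟨1, one_ne_zero, by simp only [sffComp]; rw [h0.herm, h0.idem, one_smul]⟩
  | succ k ih =>
    obtain ⟨c, hc, hck⟩ := ih (by omega)
    refine ⟨c * (sff (X k) z * (sff (X k) z)ᴴ).trace,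
      mul_ne_zero hc (trace_mul_conjTranspose_ne_zero (hz k (by omega))), ?_⟩
    simp only [sffComp]
    rw [Matrix.conjTranspose_mul, mul_assoc, ← mul_assoc _ _ (sff (X k) z)ᴴ, hck, smul_mul_assoc,
      mul_sff_conjTranspose (h.harmonic k (by omega)).rankOne, mul_smul_comm,
      (h.next k (by omega)).num, smul_smul, Matrix.trace_smul,
      ((h.harmonic (k + 1) hk).rankOne z).trace_eq, smul_eq_mul, mul_one]

/-- If the trace of the composition vanishes, then the two ends of the sequence are orthogonal. -/
lemma mul_eq_zero_of_trace (h : ChartChain s X) (ht : ∀ z, (sffComp X s z).trace = 0) (z : ℂ) :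
    X 0 z * X s z = 0 := by
  have hc : ∀ i ≤ s, Continuous (X i) := fun i hi =>
    continuous_of_mSmoothAt (h.harmonic i hi).smoothAt
  have hd : Dense (⋂ i ∈ Set.Iio s, {z | sff (X i) z ≠ 0}) := by
    refine dense_biInter_of_isOpen (fun i hi => ?_) (Set.to_countable _) fun i hi =>
      (h.next i hi).dense
    exact isOpen_ne.preimage
      (continuous_of_mSmoothAt (mSmoothAt_sff_of_two (h.harmonic i (le_of_lt hi))))
  refine congrFun (Continuous.ext_on hd ((hc 0 (Nat.zero_le _)).mul (hc s le_rfl)) continuous_const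
    fun z hz => ?_) z
  have h0 := (h.harmonic 0 (Nat.zero_le _)).rankOne z
  have hz' : ∀ i < s, sff (X i) z ≠ 0 := fun i hi => Set.mem_iInter₂.1 hz i hi
  obtain ⟨c, hc0, hcs⟩ := h.sffComp_mul_conjTranspose hz' le_rfl
  have h1 : X 0 z * sffComp X s z = 0 := by
    rw [← h.sffComp_mul le_rfl, ← mul_assoc, h0.mul_mul, Matrix.trace_mul_comm,
      h.sffComp_mul le_rfl, ht, zero_smul]
  apply smul_right_injective _ hc0
  change c • (X 0 z * X s z) = c • (0 : Mat N)
  rw [← mul_smul_comm, ← hcs, ← mul_assoc, h1, zero_mul, smul_zero]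

end ChartChain

/-- A sequence of harmonic projectors on the sphere, each of which follows its predecessor. -/
structure Chain (s : ℕ) (R : ℕ → OnePoint ℂ → Mat N) : Prop where
  harmonic : ∀ i ≤ s, SphereHarmonic 2 (R i)
  next : ∀ i < s, NextS (R i) (R (i + 1))

namespace Chain

variable {s : ℕ} {R : ℕ → OnePoint ℂ → Mat N}

lemma chartAff (h : Chain s R) : ChartChain s fun i => aff (R i) :=
  ⟨fun i hi => (h.harmonic i hi).aff, fun i hi => (h.next i hi).aff⟩

lemma chartInv (h : Chain s R) : ChartChain s fun i => inv (R i) :=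
  ⟨fun i hi => (h.harmonic i hi).inv, fun i hi => (h.next i hi).inv⟩

lemma shift {t : ℕ} (h : Chain (t + s) R) : Chain s fun i => R (t + i) :=
  ⟨fun i hi => h.harmonic _ (by omega), fun i hi => h.next (t + i) (by omega)⟩

lemma mono {t : ℕ} (h : Chain s R) (ht : t ≤ s) : Chain t R :=
  ⟨fun i hi => h.harmonic i (hi.trans ht), fun i hi => h.next i (hi.trans_le ht)⟩

/-- The composition of `k` second fundamental forms transforms like a differential of degree `k`
under the change of coordinates. -/
lemma sffComp_aff (h : Chain s R) {k : ℕ} (hk : k ≤ s) {z : ℂ} (hz : z ≠ 0) :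
    sffComp (fun i => aff (R i)) k z =
      (-(z ^ 2)⁻¹) ^ k • sffComp (fun i => inv (R i)) k z⁻¹ := by
  have hz' : z⁻¹ ≠ 0 := inv_ne_zero hz
  induction k with
  | zero =>
    simp only [sffComp, pow_zero, one_smul]
    rw [(inv_eventuallyEq hz').self_of_nhds]
    simp only [inv_inv]
  | succ k ih =>
    have h1 : sff (aff (R k)) z = -(z ^ 2)⁻¹ • sff (inv (R k)) z⁻¹ := by
      rw [(h.harmonic k (by omega)).sff_inv (by omega) hz', inv_inv, smul_smul, inv_pow, inv_inv,
        neg_mul_neg, inv_mul_cancel₀ (pow_ne_zero 2 hz), one_smul]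
    simp only [sffComp]
    rw [ih (by omega), h1, smul_mul_smul_comm, ← pow_succ']

/-- Liouville's theorem: the trace of the composition of second fundamental forms vanishes if it is
holomorphic, since it tends to `0` at `∞`. -/
lemma trace_sffComp_eq_zero (h : Chain s R) (hs : 1 ≤ s)
    (hd : Differentiable ℂ fun z => (sffComp (fun i => aff (R i)) s z).trace) (z : ℂ) :
    (sffComp (fun i => aff (R i)) s z).trace = 0 := by
  refine hd.apply_eq_of_tendsto_cocompact z ?_
  rw [← Metric.cobounded_eq_cocompact]
  have hc : ContinuousAt (fun w => (sffComp (fun i => inv (R i)) s w).trace) 0 :=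
    (h.chartInv.mSmoothAt_sffComp le_rfl 0).trace.continuousAt
  have hp : ContinuousAt (fun w : ℂ => (-(w ^ 2)) ^ s) 0 := by fun_prop
  have h1 := (hp.mul hc).tendsto.comp (tendsto_inv₀_cobounded (α := ℂ))
  have h0 : (-((0 : ℂ) ^ 2)) ^ s = 0 := by
    rw [zero_pow two_ne_zero, neg_zero, zero_pow (by omega)]
  simp only [Pi.mul_apply, h0, zero_mul] at h1
  refine h1.congr' ?_
  filter_upwards [tendsto_norm_cobounded_atTop.eventually_gt_atTop (0 : ℝ)] with z hz
  rw [h.sffComp_aff le_rfl (norm_pos_iff.1 hz), Matrix.trace_smul, smul_eq_mul, ← inv_pow]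
  rfl

lemma aff_mul_aff_eq_zero (hs : 1 ≤ s) : ∀ {R : ℕ → OnePoint ℂ → Mat N}, Chain s R → ∀ z,
    aff (R 0) z * aff (R s) z = 0 := by
  induction s using Nat.strong_induction_on with
  | _ s ih =>
    intro R h z
    obtain rfl | ⟨t, rfl⟩ : s = 1 ∨ ∃ t, s = t + 2 := by
      rcases s with _ | _ | t
      · omega
      · exact Or.inl rfl
      · exact Or.inr ⟨t, rfl⟩
    · exact mul_eq_zero_comm ((h.harmonic 1 le_rfl).aff.rankOne z)
        ((h.harmonic 0 zero_le_one).aff.rankOne z)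
        ((h.next 0 one_pos).aff.mul_eq_zero (h.harmonic 0 zero_le_one).aff
          (h.harmonic 1 le_rfl).aff z)
    · refine h.chartAff.mul_eq_zero_of_trace (h.trace_sffComp_eq_zero hs ?_) z
      refine h.chartAff.differentiable_trace_sffComp ?_ ?_
      · exact ih (t + 1) (by omega) (by omega) (h.mono (by omega))
      · intro z
        have h1 : Chain (1 + (t + 1)) R := by rwa [show 1 + (t + 1) = t + 2 by ring]
        have := ih (t + 1) (by omega) (by omega) h1.shift z
        simpa only [show 1 + (t + 1) = t + 2 by ring, add_zero] using this

/-- The members of the sequence are mutually orthogonal. -/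
theorem mul_eq_zero (h : Chain s R) {i j : ℕ} (hi : i ≤ s) (hj : j ≤ s) (hij : i ≠ j)
    (p : OnePoint ℂ) : R i p * R j p = 0 := by
  wlog hlt : i < j generalizing i j
  · exact mul_eq_zero_comm ((h.harmonic j hj).rankOne p) ((h.harmonic i hi).rankOne p)
      (this hj hi hij.symm (by omega))
  have h1 : Chain (i + (j - i)) R := h.mono (by omega)
  have haff : ∀ z, aff (R i) z * aff (R j) z = 0 := fun z => by
    have := aff_mul_aff_eq_zero (by omega) h1.shift z
    simpa only [add_zero, show i + (j - i) = j by omega] using this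
  induction p with
  | coe z => exact haff z
  | infty =>
    have hci := continuous_of_mSmoothAt (h.harmonic i hi).inv.smoothAt
    have hcj := continuous_of_mSmoothAt (h.harmonic j hj).inv.smoothAt
    have := congrFun (Continuous.ext_on (dense_compl_singleton (0 : ℂ)) (hci.mul hcj)
      continuous_const (g := fun _ => 0) fun w hw => by
        have hw0 : w ≠ 0 := hw
        change inv (R i) w * inv (R j) w = 0
        rw [(inv_eventuallyEq hw0).self_of_nhds, (inv_eventuallyEq hw0).self_of_nhds, haff]) 0
    simpa [inv] using this

end Chain

/-- Mutually orthogonal rank-one projectors have linearly independent image vectors. -/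
lemma linearIndependent_of_orthogonal {ι : Type*} {P : ι → Mat N}
    {v : ι → Fin N → ℂ} (hv : ∀ i, v i ≠ 0) (hPv : ∀ i, P i *ᵥ v i = v i)
    (hP : ∀ i j, i ≠ j → P i * P j = 0) : LinearIndependent ℂ v := by
  rw [linearIndependent_iff']
  intro t c hc i hi
  have h1 := congrArg (fun x => P i *ᵥ x) hc
  simp only [Matrix.mulVec_sum, Matrix.mulVec_smul, Matrix.mulVec_zero] at h1
  rw [Finset.sum_eq_single i] at h1
  · rw [hPv] at h1
    exact (smul_eq_zero.1 h1).resolve_right (hv i)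
  · intro j _ hj
    rw [← hPv j, Matrix.mulVec_mulVec, hP i j hj.symm, Matrix.zero_mulVec, smul_zero]
  · exact fun h => absurd hi h

/-- There are at most `N` mutually orthogonal rank-one projectors. -/
lemma Chain.lt {s : ℕ} {R : ℕ → OnePoint ℂ → Mat N} (h : Chain s R) : s < N := by
  have h0 : ∀ i : Fin (s + 1), ∃ v : Fin N → ℂ, v ≠ 0 ∧ R i (0 : ℂ) *ᵥ v = v := fun i => by
    obtain ⟨v, hv, hv', -⟩ := ((h.harmonic i (by omega)).rankOne (0 : ℂ)).exists_span
    exact ⟨v, hv, hv'⟩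
  choose v hv hPv using h0
  have hli := linearIndependent_of_orthogonal hv hPv fun i j hij =>
    h.mul_eq_zero (by omega) (by omega) (fun h => hij (Fin.ext h)) _
  have := hli.fintype_card_le_finrank
  simp only [Fintype.card_fin, Module.finrank_fin_fun] at this
  omega

end Orthogonality

/-! ### Complex conjugation exchanges raising and lowering -/

section Conjugation

variable {N : ℕ}

/-- Entrywise complex conjugation of a matrix. -/
def cj (A : Mat N) : Mat N := A.map (starRingEnd ℂ)

lemma cj_mul (A B : Mat N) : cj (A * B) = cj A * cj B := Matrix.map_mul

lemma cj_cj (A : Mat N) : cj (cj A) = A := by ext i j; simp [cj]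

lemma cj_zero : cj (0 : Mat N) = 0 := by ext i j; simp [cj]

lemma cj_sub (A B : Mat N) : cj (A - B) = cj A - cj B := by ext i j; simp [cj]

lemma cj_smul (c : ℂ) (A : Mat N) : cj (c • A) = conj c • cj A := by ext i j; simp [cj]

lemma trace_cj (A : Mat N) : (cj A).trace = conj A.trace := by simp [cj, Matrix.trace]

lemma cj_eq_zero {A : Mat N} : cj A = 0 ↔ A = 0 :=
  ⟨fun h => by rw [← cj_cj A, h, cj_zero], fun h => by rw [h, cj_zero]⟩

lemma cj_mulVec (A : Mat N) (v : Fin N → ℂ) : cj A *ᵥ star v = star (A *ᵥ v) := by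
  ext i; simp [cj, Matrix.mulVec, dotProduct]

lemma continuous_cj : Continuous (cj (N := N)) :=
  Continuous.matrix_map continuous_id Complex.continuous_conj

lemma IsRankOneProj.cj {P : Mat N} (h : IsRankOneProj P) : IsRankOneProj (cj P) := by
  refine ⟨by rw [← cj_mul, h.idem], ?_, by rw [trace_cj, h.trace_eq, map_one]⟩
  conv_rhs => rw [← h.herm]
  ext i j; simp [CPSigma.cj]

lemma dd_cj {c : ℂ} {X : ℂ → Mat N} {z : ℂ} :
    dd c (fun ζ => cj (X ζ)) z = cj (dd (conj c) X z) := by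
  ext i j; exact sd_conj

lemma dPlus_cj {X : ℂ → Mat N} {z : ℂ} : dPlus (fun ζ => cj (X ζ)) z = cj (dMinus X z) := by
  rw [dPlus_eq, dMinus_eq, dd_cj, map_neg, Complex.conj_I, neg_neg]

lemma dMinus_cj {X : ℂ → Mat N} {z : ℂ} : dMinus (fun ζ => cj (X ζ)) z = cj (dPlus X z) := by
  rw [dPlus_eq, dMinus_eq, dd_cj, Complex.conj_I]

lemma MSmoothAt.cj {r : WithTop ℕ∞} {X : ℂ → Mat N} {z : ℂ} (h : MSmoothAt r X z) :
    MSmoothAt r (fun ζ => cj (X ζ)) z := fun i j => contDiffAt_conj (h i j)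

lemma HarmonicProj.cj {r : ℕ} (hr : 2 ≤ r) {X : ℂ → Mat N} (h : HarmonicProj r X) :
    HarmonicProj r fun z => cj (X z) := by
  refine ⟨fun z => (h.rankOne z).cj, fun z => (h.smoothAt z).cj, fun z => ?_⟩
  have h1 : dMinus (fun ζ => CPSigma.cj (X ζ)) = fun ζ => CPSigma.cj (dPlus X ζ) :=
    funext fun ζ => dMinus_cj
  have h2 : dMinus (dPlus X) z = dPlus (dMinus X) z := by
    rw [dPlus_eq, dMinus_eq]
    exact dd_comm ((h.smoothAt z).of_le (by exact_mod_cast hr))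
  rw [h1, dPlus_cj, h2, ← cj_mul, ← cj_mul, ← cj_sub, h.eulerLagrange, cj_zero]

/-- Entrywise complex conjugation of a function on the sphere. -/
def cjS (X : OnePoint ℂ → Mat N) (p : OnePoint ℂ) : Mat N := cj (X p)

lemma cjS_cjS (X : OnePoint ℂ → Mat N) : cjS (cjS X) = X := funext fun p => cj_cj (X p)

lemma cjS_zero : cjS (0 : OnePoint ℂ → Mat N) = 0 := funext fun _ => cj_zero

lemma inv_cjS (X : OnePoint ℂ → Mat N) : inv (cjS X) = fun z => cj (inv X z) := by
  funext z; simp only [inv]; split_ifs <;> rfl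

lemma SphereHarmonic.cjS {r : ℕ} (hr : 2 ≤ r) {X : OnePoint ℂ → Mat N}
    (h : SphereHarmonic r X) : SphereHarmonic r (cjS X) := by
  refine ⟨h.aff.cj hr, ?_⟩
  rw [inv_cjS]
  exact h.inv.cj hr

lemma ladder_cjS {d d' e e' : (ℂ → Mat N) → ℂ → Mat N} {X : OnePoint ℂ → Mat N}
    (h : ∀ z, d (aff (cjS X)) z = cj (e (aff X) z))
    (h' : ∀ z, d' (aff (cjS X)) z = cj (e' (aff X) z)) :
    ladder d d' (cjS X) = cjS (ladder e e' X) := by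
  have hnum : ∀ z, ladderNum d d' (aff (cjS X)) z = cj (ladderNum e e' (aff X) z) := fun z => by
    rw [ladderNum, ladderNum, cj_mul, cj_mul, h, h']; rfl
  have hq : ladderQuot d d' (aff (cjS X)) = fun z => cj (ladderQuot e e' (aff X) z) := by
    funext z
    rw [ladderQuot, ladderQuot, hnum, cj_smul, trace_cj, map_inv₀]
  have hF : ∀ p, ladderFilter d d' (aff (cjS X)) p = ladderFilter e e' (aff X) p := fun p => by
    simp only [ladderFilter, hnum, ne_eq, cj_eq_zero]
  funext p
  by_cases hc : (ladderFilter e e' (aff X) p).NeBot ∧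
      ∃ A, Tendsto (ladderQuot e e' (aff X)) (ladderFilter e e' (aff X) p) (𝓝 A)
  · obtain ⟨hne, A, hA⟩ := hc
    rw [cjS, ladder_eq_of_tendsto hne hA]
    refine ladder_eq_of_tendsto (by rwa [hF]) ?_
    rw [hF, hq]
    exact (continuous_cj.tendsto A).comp hA
  · have hc' : ¬((ladderFilter d d' (aff (cjS X)) p).NeBot ∧ ∃ A, Tendsto
        (ladderQuot d d' (aff (cjS X))) (ladderFilter d d' (aff (cjS X)) p) (𝓝 A)) := by
      rintro ⟨hne, A, hA⟩
      rw [hF] at hne hA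
      refine hc ⟨hne, cj A, ?_⟩
      have := (continuous_cj.tendsto A).comp hA
      rw [hq] at this
      exact this.congr fun z => cj_cj _
    rw [ladder, dif_neg hc', cjS, ladder, dif_neg hc, hq]
    induction p with
    | infty => exact cj_zero.symm
    | coe z => rfl

lemma lower_cjS (X : OnePoint ℂ → Mat N) : lower (cjS X) = cjS (raise X) :=
  ladder_cjS (fun _ => dMinus_cj) fun _ => dPlus_cj

end Conjugation

/-! ### Holomorphic projectors -/

section Holomorphic

variable {N : ℕ}

/-- A continuously differentiable rank-one projector function in one chart whose image is a
holomorphic line bundle: the image is preserved by `∂₋`. -/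
structure HoloProj (X : ℂ → Mat N) : Prop where
  rankOne : ∀ z, IsRankOneProj (X z)
  smoothAt : ∀ z, MSmoothAt 1 X z
  dMinus_mul : ∀ z, dMinus X z * X z = 0

lemma IsRankOneProj.apply_mul_apply {P : Mat N} (h : IsRankOneProj P) (i j k l : Fin N) :
    P i j * P k l = P i l * P k j := by
  obtain ⟨v, -, -, hspan⟩ := h.exists_span
  have hcol : ∀ j, ∃ c : ℂ, ∀ i, P i j = c * v i := fun j => by
    obtain ⟨c, hc⟩ := hspan (Pi.single j 1)
    refine ⟨c, fun i => ?_⟩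
    have := congrFun hc i
    simpa using this
  obtain ⟨c, hc⟩ := hcol j
  obtain ⟨d, hd⟩ := hcol l
  rw [hc, hd, hd, hc]
  ring

lemma IsRankOneProj.star_apply {P : Mat N} (h : IsRankOneProj P) (i j : Fin N) :
    conj (P i j) = P j i := congrFun (congrFun h.herm j) i

/-- The column `X e_j` of a rank-one projector function, normalized to have `j`-th entry `1`. -/
def normCol (X : ℂ → Mat N) (j : Fin N) (z : ℂ) (k : Fin N) : ℂ :=
  X z k j * (X z j j)⁻¹

/-- Since `∂₋X = X ∂₋X` and `X` has rank one, `∂₋` multiplies each column of `X` by a factor, which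
the normalization removes. -/
lemma HoloProj.eventually_differentiableAt_normCol {X : ℂ → Mat N} (h : HoloProj X) {j : Fin N}
    {p : ℂ} (hp : X p j j ≠ 0) (k : Fin N) :
    ∀ᶠ z in 𝓝 p, DifferentiableAt ℂ (fun z => normCol X j z k) z := by
  filter_upwards [((h.smoothAt p) j j).continuousAt.eventually_ne hp] with z hz
  have hd : MDiffAt X z := (h.smoothAt z).mdiffAt one_ne_zero
  have hv : DifferentiableAt ℝ (fun z => normCol X j z k) z := by
    unfold normCol
    exact (hd k j).mul ((((h.smoothAt z) j j).inv hz).differentiableAt one_ne_zero)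
  refine differentiableAt_of_dbar_eq_zero hv ?_
  change sd Complex.I (fun z => normCol X j z k) z = 0
  have hD : dMinus X z = X z * dMinus X z := by
    have := dd_eq_add h.rankOne hd Complex.I
    rw [← dMinus_eq, h.dMinus_mul, zero_add] at this
    exact this
  have hmin : dMinus X z k j * X z j j = X z k j * dMinus X z j j := by
    rw [hD, Matrix.mul_apply, Matrix.mul_apply, Finset.sum_mul, Finset.mul_sum]
    refine Finset.sum_congr rfl fun l _ => ?_
    rw [mul_right_comm, (h.rankOne z).apply_mul_apply k l j j]
    ring
  have hprod : (fun y => normCol X j y k * X y j j) =ᶠ[𝓝 z] fun y => X y k j := by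
    filter_upwards [((h.smoothAt z) j j).continuousAt.eventually_ne hz] with y hy
    exact inv_mul_cancel_right₀ hy _
  have h1 := sd_congr (c := Complex.I) hprod
  rw [sd_mul hv (hd j j)] at h1
  have h2 : sd Complex.I (fun z => normCol X j z k) z * X z j j +
      normCol X j z k * dMinus X z j j = dMinus X z k j := h1
  have h3 : normCol X j z k * X z j j = X z k j := hprod.self_of_nhds
  have h4 : sd Complex.I (fun z => normCol X j z k) z * X z j j * X z j j = 0 := by
    rw [← h2] at hmin
    linear_combination hmin - (dMinus X z j j) * h3
  simpa [hz] using h4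

lemma HoloProj.analyticAt_normCol {X : ℂ → Mat N} (h : HoloProj X) {j : Fin N}
    {p : ℂ} (hp : X p j j ≠ 0) : AnalyticAt ℂ (normCol X j) p := by
  rw [analyticAt_pi_iff]
  intro k
  obtain ⟨U, hU, hUo, hpU⟩ := eventually_nhds_iff.1 (h.eventually_differentiableAt_normCol hp k)
  exact DifferentiableOn.analyticAt (s := U) (fun z hz => (hU z hz).differentiableWithinAt)
    (hUo.mem_nhds hpU)

lemma IsRankOneProj.exists_apply_ne_zero {P : Mat N} (h : IsRankOneProj P) : ∃ j, P j j ≠ 0 := by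
  by_contra! h0
  have := h.trace_eq
  simp [Matrix.trace, h0] at this

lemma IsRankOneProj.mulVec_normCol {X : ℂ → Mat N} {z : ℂ} (h : IsRankOneProj (X z))
    (j : Fin N) : X z *ᵥ normCol X j z = normCol X j z := by
  have h1 : normCol X j z = (X z j j)⁻¹ • (X z *ᵥ Pi.single j 1) := by
    funext k
    simp [normCol, mul_comm]
  rw [h1, Matrix.mulVec_smul, Matrix.mulVec_mulVec, h.idem]

/-- In terms of the normalized column `v` one has `X = v v† / |v|²`. -/
lemma IsRankOneProj.apply_eq {X : ℂ → Mat N} {z : ℂ} (h : IsRankOneProj (X z)) {j : Fin N}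
    (hj : X z j j ≠ 0) (k l : Fin N) :
    X z k l = normCol X j z k * conj (normCol X j z l) /
      ∑ i, normCol X j z i * conj (normCol X j z i) := by
  have h1 : ∀ k l, normCol X j z k * conj (normCol X j z l) = X z k l / X z j j := fun k l => by
    rw [normCol, normCol, ← div_eq_mul_inv, ← div_eq_mul_inv, map_div₀, h.star_apply, h.star_apply,
      div_mul_div_comm,
      h.apply_mul_apply k j j l, mul_div_mul_right _ _ hj]
  simp only [h1, ← Finset.sum_div]
  have h2 : ∑ i, X z i i = 1 := h.trace_eq
  rw [h2]
  field_simp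

/-- A holomorphic projector is smooth. -/
lemma HoloProj.mSmoothAt {X : ℂ → Mat N} (h : HoloProj X) (r : ℕ) (p : ℂ) :
    MSmoothAt r X p := by
  obtain ⟨j, hj⟩ := (h.rankOne p).exists_apply_ne_zero
  have hv : ∀ k, ContDiffAt ℝ r (fun z => normCol X j z k) p := fun k =>
    ((analyticAt_pi_iff.1 (h.analyticAt_normCol hj) k).contDiffAt (n := r)).restrict_scalars ℝ
  intro k l
  have hden : ∑ i, normCol X j p i * conj (normCol X j p i) ≠ 0 := by
    intro h0
    have := (h.rankOne p).apply_eq hj j j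
    rw [h0, div_zero] at this
    exact hj this
  have hsum : ContDiffAt ℝ r (fun z => ∑ i, normCol X j z i * conj (normCol X j z i)) p :=
    ContDiffAt.sum fun i _ => (hv i).mul (contDiffAt_conj (hv i))
  refine ContDiffAt.congr_of_eventuallyEq (((hv k).mul (contDiffAt_conj (hv l))).mul
    (hsum.inv hden)) ?_
  filter_upwards [((h.smoothAt p) j j).continuousAt.eventually_ne hj] with z hz
  exact ((h.rankOne z).apply_eq hz k l).trans (div_eq_mul_inv _ _)

lemma IsRankOneProj.normCol_eq_smul {X : ℂ → Mat N} {z : ℂ} (h : IsRankOneProj (X z))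
    {i j : Fin N} (hi : X z i i ≠ 0) : normCol X j z = normCol X j z i • normCol X i z := by
  funext k
  simp only [normCol, Pi.smul_apply, smul_eq_mul]
  have := h.apply_mul_apply i j k i
  field_simp
  linear_combination (-(X z j j)⁻¹) * this

lemma IsRankOneProj.normCol_apply_eq_zero_iff {X : ℂ → Mat N} {z : ℂ} (h : IsRankOneProj (X z))
    {i j : Fin N} (hj : X z j j ≠ 0) : normCol X j z i = 0 ↔ X z i i = 0 := by
  constructor
  · intro h0
    rw [h.apply_eq hj, h0, zero_mul, zero_div]
  · intro h0
    have h1 := h.apply_mul_apply i j j i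
    rw [h0, zero_mul, ← h.star_apply i j, mul_eq_zero, map_eq_zero, or_self] at h1
    rw [normCol, h1, zero_mul]

lemma normCol_self {X : ℂ → Mat N} {z : ℂ} {j : Fin N} (hj : X z j j ≠ 0) :
    normCol X j z j = 1 := mul_inv_cancel₀ hj

lemma normCol_ne_zero {X : ℂ → Mat N} {z : ℂ} {j : Fin N} (hj : X z j j ≠ 0) :
    normCol X j z ≠ 0 := fun h0 => by
  have := normCol_self hj
  rw [h0] at this
  exact zero_ne_one this

/-- The normalized column `X e_i / X_ii` is meromorphic: near `p` it becomes a nowhere vanishing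
holomorphic section after multiplication by a power of `z - p`. -/
lemma HoloProj.exists_local_frame {X : ℂ → Mat N} (h : HoloProj X) (i : Fin N) (p : ℂ) :
    (∀ᶠ z in 𝓝 p, X z i i = 0) ∨ (∀ᶠ z in 𝓝[≠] p, X z i i ≠ 0) ∧
      ∃ (k : ℕ) (v : ℂ → Fin N → ℂ), (X p i i ≠ 0 → k = 0) ∧ AnalyticAt ℂ v p ∧ v p ≠ 0 ∧
        (∀ᶠ z in 𝓝 p, X z *ᵥ v z = v z) ∧
        ∀ᶠ z in 𝓝[≠] p, (z - p) ^ k • normCol X i z = v z := by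
  obtain ⟨j, hj⟩ := (h.rankOne p).exists_apply_ne_zero
  have hjev : ∀ᶠ z in 𝓝 p, X z j j ≠ 0 := ((h.smoothAt p) j j).continuousAt.eventually_ne hj
  have han := h.analyticAt_normCol hj
  have hani := analyticAt_pi_iff.1 han i
  by_cases h0 : ∀ᶠ z in 𝓝 p, normCol X j z i = 0
  · left
    filter_upwards [h0, hjev] with z hz hzj
    exact ((h.rankOne z).normCol_apply_eq_zero_iff hzj).1 hz
  right
  obtain ⟨k, g, hg, hg0, hgE⟩ := hani.exists_eventuallyEq_pow_smul_nonzero_iff.2 h0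
  have hgne := hg.continuousAt.eventually_ne hg0
  have hne : ∀ᶠ z in 𝓝[≠] p, X z i i ≠ 0 := by
    filter_upwards [nhdsWithin_le_nhds hgE, nhdsWithin_le_nhds hgne, nhdsWithin_le_nhds hjev,
      self_mem_nhdsWithin] with z h1 h2 h3 h4
    rw [ne_eq, ← (h.rankOne z).normCol_apply_eq_zero_iff h3, h1]
    exact smul_ne_zero (pow_ne_zero k (sub_ne_zero.2 h4)) h2
  refine ⟨hne, k, fun z => (g z)⁻¹ • normCol X j z, ?_, (hg.inv hg0).smul han,
    smul_ne_zero (inv_ne_zero hg0) (normCol_ne_zero hj), ?_, ?_⟩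
  · intro hi
    by_contra hk
    have h1 := hgE.self_of_nhds
    rw [sub_self, zero_pow hk, zero_smul, (h.rankOne p).normCol_apply_eq_zero_iff hj] at h1
    exact hi h1
  · filter_upwards with z
    rw [Matrix.mulVec_smul, (h.rankOne z).mulVec_normCol]
  · filter_upwards [nhdsWithin_le_nhds hgE, nhdsWithin_le_nhds hgne, hne] with z h1 h2 h3
    rw [(h.rankOne z).normCol_eq_smul h3 (j := j), h1, smul_smul, smul_eq_mul, mul_left_comm,
      inv_mul_cancel₀ h2, mul_one]

lemma IsRankOneProj.range_eq_span {P : Mat N} (h : IsRankOneProj P) {v : Fin N → ℂ} (hv : v ≠ 0)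
    (hPv : P *ᵥ v = v) : LinearMap.range P.mulVecLin = Submodule.span ℂ {v} := by
  obtain ⟨u, -, -, hspan⟩ := h.exists_span
  obtain ⟨c, hc⟩ := hspan v
  rw [hPv] at hc
  have hc0 : c ≠ 0 := by rintro rfl; exact hv (by rw [hc, zero_smul])
  apply le_antisymm
  · rintro _ ⟨x, rfl⟩
    obtain ⟨a, ha⟩ := hspan x
    rw [Matrix.mulVecLin_apply, ha, Submodule.mem_span_singleton]
    exact ⟨a * c⁻¹, by rw [hc, smul_smul, inv_mul_cancel_right₀ hc0]⟩
  · rw [Submodule.span_singleton_le_iff_mem]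
    exact ⟨v, hPv⟩

/-- A holomorphic line subbundle over the sphere has a nowhere vanishing holomorphic section over
the affine chart: take a normalized column that is regular at `∞` and clear its finitely many poles
by a polynomial. -/
theorem hasRep_of_holoProj {X : OnePoint ℂ → Mat N} (h : HoloProj (aff X))
    (h' : HoloProj (CPSigma.inv X)) : HasRep sdMinus (aff X) := by
  obtain ⟨i, hi⟩ := (h'.rankOne 0).exists_apply_ne_zero
  -- the poles of the normalized column are the zeros of `X_ii`, which form a discrete bounded set
  have hinf : ∀ᶠ z in Bornology.cobounded ℂ, aff X z i i ≠ 0 := by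
    have h1 := tendsto_inv₀_cobounded (α := ℂ) |>.eventually
      (((h'.smoothAt 0) i i).continuousAt.eventually_ne hi)
    filter_upwards [h1, tendsto_norm_cobounded_atTop.eventually_gt_atTop (0 : ℝ)] with z hz hz0
    rw [(inv_eventuallyEq (X := X) (inv_ne_zero (norm_pos_iff.1 hz0))).self_of_nhds] at hz
    simpa only [inv_inv] using hz
  have hne : ∀ p, ∀ᶠ z in 𝓝[≠] p, aff X z i i ≠ 0 :=
    eventually_ne_zero_of_dichotomy (fun p => (h.exists_local_frame i p).imp id And.left)
      hinf.exists
  have hfin : {z | aff X z i i = 0}.Finite := by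
    obtain ⟨r, -, hr⟩ := (Metric.hasBasis_cobounded_compl_closedBall (0 : ℂ)).mem_iff.1 hinf
    by_contra hinfinite
    obtain ⟨p, -, hp⟩ := Set.Infinite.exists_accPt_of_subset_isCompact hinfinite
      (isCompact_closedBall (0 : ℂ) r) fun z hz => by
        by_contra hz'
        exact hr hz' hz
    obtain ⟨z, hz1, hz2⟩ := (accPt_iff_frequently_nhdsNE.1 hp).and_eventually (hne p) |>.exists
    exact hz2 hz1
  have hloc := fun p => ((h.exists_local_frame i p).resolve_left fun h0 => by
    obtain ⟨z, hz1, hz2⟩ := ((hne p).and (nhdsWithin_le_nhds h0)).exists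
    exact hz1 hz2).2
  choose k v hk hv hv0 hXv hvE using hloc
  let Z : Finset ℂ := hfin.toFinset
  -- the polynomial that clears the poles, and its part without the factor that belongs to `p`
  let q : ℂ → ℂ := fun z => ∏ a ∈ Z, (z - a) ^ k a
  let F : ℂ → Fin N → ℂ := fun z => limUnder (𝓝[≠] z) fun y => q y • normCol (aff X) i y
  let e : ℂ → ℂ → ℂ := fun p z => ∏ a ∈ Z.erase p, (z - a) ^ k a
  have hqe : ∀ p z, q z = e p z * (z - p) ^ k p := by
    intro p z
    by_cases hp : p ∈ Z
    · exact (Finset.prod_erase_mul Z _ hp).symm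
    · have hp' : aff X p i i ≠ 0 := fun h0 => hp (hfin.mem_toFinset.2 h0)
      rw [hk p hp', pow_zero, mul_one]
      simp only [e, q, Finset.erase_eq_of_notMem hp]
  have hean : ∀ p z, AnalyticAt ℂ (e p) z := fun p z => by
    have : Differentiable ℂ (e p) := by fun_prop
    exact this.analyticAt z
  have he0 : ∀ p, e p p ≠ 0 := fun p => Finset.prod_ne_zero_iff.2 fun a ha =>
    pow_ne_zero _ (sub_ne_zero.2 (Finset.ne_of_mem_erase ha).symm)
  have hF : ∀ p, F =ᶠ[𝓝 p] fun z => e p z • v p z := by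
    intro p
    refine limUnder_punctured_eventuallyEq ?_ ?_
    · filter_upwards [hvE p] with z hz
      rw [hqe p z, mul_smul, hz]
    · filter_upwards [(hv p).eventually_analyticAt] with z hz
      exact ((hean p z).smul hz).continuousAt
  have hFan : ∀ p, AnalyticAt ℂ F p := fun p =>
    ((hean p p).smul (hv p)).congr (hF p).symm
  have hF0 : ∀ p, F p ≠ 0 := fun p => by
    rw [(hF p).self_of_nhds]
    exact smul_ne_zero (he0 p) (hv0 p)
  have hFc : ∀ k z, DifferentiableAt ℂ (fun z => F z k) z := fun k z =>
    (analyticAt_pi_iff.1 (hFan z) k).differentiableAt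
  refine ⟨F, hF0, fun k z => (hFc k z).restrictScalars ℝ, fun k z => sd_I_eq_zero (hFc k z),
    fun z => (h.rankOne z).range_eq_span (hF0 z) ?_⟩
  rw [(hF z).self_of_nhds, Matrix.mulVec_smul, (hXv z).self_of_nhds]

/-- The function `X` on the sphere with the two charts interchanged, `z ↦ X (1 / z)`. -/
def flip (X : OnePoint ℂ → Mat N) (p : OnePoint ℂ) : Mat N :=
  p.elim (X (0 : ℂ)) (CPSigma.inv X)

lemma inv_flip (X : OnePoint ℂ → Mat N) : CPSigma.inv (flip X) = aff X := by
  funext w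
  by_cases hw : w = 0
  · rw [CPSigma.inv, if_pos hw, hw]; rfl
  · rw [CPSigma.inv, if_neg hw]
    change CPSigma.inv X w⁻¹ = _
    rw [CPSigma.inv, if_neg (inv_ne_zero hw), inv_inv]
    rfl

theorem isHolomorphicProj_of_holoProj {X : OnePoint ℂ → Mat N} (hX : ∀ p, IsRankOneProj (X p))
    (h : HoloProj (aff X)) (h' : HoloProj (CPSigma.inv X)) : IsHolomorphicProj X :=
  ⟨hX, hasRep_of_holoProj h h', hasRep_of_holoProj (X := flip X) h' (by rwa [inv_flip])⟩

lemma HasRep.cj {X : ℂ → Mat N} (h : HasRep sdMinus X) : HasRep sdPlus fun z => cj (X z) := by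
  obtain ⟨f, hf0, hfd, hf, hspan⟩ := h
  refine ⟨fun z => star (f z), fun z => star_ne_zero.2 (hf0 z), fun i z => ?_, fun i z => ?_,
    fun z => ?_⟩
  · exact (Complex.conjCLE : ℂ →L[ℝ] ℂ).differentiableAt.comp z (hfd i z)
  · rw [sdPlus_eq]
    refine sd_conj.trans ?_
    rw [map_neg, Complex.conj_I, neg_neg]
    exact (congrArg conj (hf i z)).trans (map_zero _)
  · apply le_antisymm
    · rintro _ ⟨x, rfl⟩
      have h1 : X z *ᵥ star x ∈ LinearMap.range (X z).mulVecLin := ⟨star x, rfl⟩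
      rw [hspan, Submodule.mem_span_singleton] at h1
      obtain ⟨a, ha⟩ := h1
      rw [Submodule.mem_span_singleton]
      refine ⟨star a, ?_⟩
      rw [← star_smul, ha, ← cj_mulVec, star_star]
      rfl
    · rw [Submodule.span_singleton_le_iff_mem]
      have h1 : f z ∈ LinearMap.range (X z).mulVecLin := by
        rw [hspan]; exact Submodule.mem_span_singleton_self _
      obtain ⟨x, hx⟩ := h1
      refine ⟨star x, ?_⟩
      change CPSigma.cj (X z) *ᵥ star x = star (f z)
      rw [cj_mulVec]
      exact congrArg star hx

lemma isAntiholomorphicProj_cjS {X : OnePoint ℂ → Mat N} (h : IsHolomorphicProj X) :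
    IsAntiholomorphicProj (cjS X) := by
  refine ⟨fun p => (h.1 p).cj, h.2.1.cj, ?_⟩
  rw [inv_cjS]
  exact h.2.2.cj

end Holomorphic

/-! ### Finiteness of the action -/

section Action

variable {N : ℕ}

lemma continuous_lagrangian {X : ℂ → Mat N} (h : ∀ z, MSmoothAt 1 X z) :
    Continuous (lagrangian X) := by
  have h1 : ∀ c, Continuous (dd c X) := fun c =>
    continuous_of_mSmoothAt fun z => (h z).dd (s := 0) (by norm_num)
  unfold lagrangian
  rw [dPlus_eq, dMinus_eq]
  exact ((h1 _).mul (h1 _)).matrix_trace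

/-- The Lagrangian density transforms like a density under the change of coordinates. -/
lemma lagrangian_aff {X : OnePoint ℂ → Mat N} (h : ∀ z, MSmoothAt 1 (CPSigma.inv X) z) {z : ℂ}
    (hz : z ≠ 0) : lagrangian (aff X) z =
      (-(z ^ 2)⁻¹ * -conj (z ^ 2)⁻¹) * lagrangian (CPSigma.inv X) z⁻¹ := by
  have he : aff X =ᶠ[𝓝 z] fun y => CPSigma.inv X y⁻¹ := by
    have := inv_eventuallyEq (X := flip X) hz
    rwa [inv_flip] at this
  have hd : MDiffAt (CPSigma.inv X) z⁻¹ := (h _).mdiffAt one_ne_zero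
  have h1 : dPlus (aff X) z = -(z ^ 2)⁻¹ • dPlus (CPSigma.inv X) z⁻¹ := by
    rw [← dPlus_comp_inv hz hd, dPlus_eq]; exact dd_congr he
  have h2 : dMinus (aff X) z = -conj (z ^ 2)⁻¹ • dMinus (CPSigma.inv X) z⁻¹ := by
    rw [← dMinus_comp_inv hz hd, dMinus_eq]; exact dd_congr he
  rw [lagrangian, h1, h2, smul_mul_smul_comm, Matrix.trace_smul, smul_eq_mul, lagrangian]

/-- The Lagrangian density is continuous and decays like `|z|⁻⁴`. -/
lemma integrable_lagrangian {X : OnePoint ℂ → Mat N} (h : ∀ z, MSmoothAt 1 (aff X) z)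
    (h' : ∀ z, MSmoothAt 1 (CPSigma.inv X) z) : Integrable (lagrangian (aff X)) := by
  have hc := continuous_lagrangian h
  obtain ⟨C, hC⟩ := (isCompact_closedBall (0 : ℂ) 1).exists_bound_of_continuousOn hc.continuousOn
  obtain ⟨D, hD⟩ := (isCompact_closedBall (0 : ℂ) 1).exists_bound_of_continuousOn
    (continuous_lagrangian h').continuousOn
  have hC0 : 0 ≤ C := (norm_nonneg _).trans (hC 0 (by simp))
  have hD0 : 0 ≤ D := (norm_nonneg _).trans (hD 0 (by simp))
  have hint : Integrable fun z : ℂ => (16 * (C + D)) * (1 + ‖z‖) ^ (-(4 : ℝ)) :=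
    (integrable_one_add_norm (by rw [Complex.finrank_real_complex]; norm_num)).const_mul _
  refine hint.mono' hc.aestronglyMeasurable (Eventually.of_forall fun z => ?_)
  have hpos : 0 < 1 + ‖z‖ := by positivity
  rw [Real.rpow_neg hpos.le, show (4 : ℝ) = ((4 : ℕ) : ℝ) by norm_num, Real.rpow_natCast,
    ← div_eq_mul_inv, le_div_iff₀ (by positivity)]
  by_cases hz : ‖z‖ ≤ 1
  · have h1 := hC z (by simpa using hz)
    have h2 : (1 + ‖z‖) ^ 4 ≤ 2 ^ 4 := by gcongr; linarith
    calc _ ≤ C * 2 ^ 4 := by gcongr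
      _ ≤ _ := by linarith
  · have hz1 : 1 < ‖z‖ := not_le.1 hz
    have hz0 : z ≠ 0 := by rintro rfl; simp at hz1; linarith
    have h1 := hD z⁻¹ (by simpa using inv_le_one_of_one_le₀ hz1.le)
    have h2 : (1 + ‖z‖) ^ 4 ≤ (2 * ‖z‖) ^ 4 := by gcongr; linarith
    have h3 : ‖lagrangian (aff X) z‖ = (‖z‖ ^ 4)⁻¹ * ‖lagrangian (CPSigma.inv X) z⁻¹‖ := by
      rw [lagrangian_aff h' hz0, norm_mul, norm_mul, norm_neg, norm_neg, RCLike.norm_conj, norm_inv,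
        norm_pow, ← mul_inv, ← pow_add]
    have h4 : 0 < ‖z‖ ^ 4 := by positivity
    rw [h3]
    calc _ ≤ (‖z‖ ^ 4)⁻¹ * D * (2 * ‖z‖) ^ 4 := by gcongr
      _ = 16 * D := by field_simp; ring
      _ ≤ _ := by linarith

lemma SphereHarmonic.isFiniteActionSolution {r : ℕ} (hr : 1 ≤ r) {X : OnePoint ℂ → Mat N}
    (h : SphereHarmonic r X) : IsFiniteActionSolution r X := by
  have hr1 : (1 : WithTop ℕ∞) ≤ (r : WithTop ℕ∞) := by exact_mod_cast hr
  exact ⟨h.rankOne, ⟨fun i j => contDiff_iff_contDiffAt.2 fun z => h.aff.smoothAt z i j,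
    fun i j => contDiff_iff_contDiffAt.2 fun z => h.inv.smoothAt z i j⟩, h.aff.eulerLagrange,
    integrable_lagrangian (fun z => (h.aff.smoothAt z).of_le hr1)
      fun z => (h.inv.smoothAt z).of_le hr1⟩

end Action

/-! ### Functions whose `∂₋`-derivatives vanish at a point -/

section Flat

variable {N : ℕ} {p : ℂ}

/-- The components are infinitely differentiable near `p`. -/
def SmoothNear (X : ℂ → Mat N) (p : ℂ) : Prop := ∀ᶠ z in 𝓝 p, MSmoothAt ∞ X z

/-- All iterated `∂₋`-derivatives of `X`, including `X` itself, vanish at `p`. -/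
def FlatAt (X : ℂ → Mat N) (p : ℂ) : Prop := ∀ k, dMinus^[k] X p = 0

lemma MSmoothAt.dMinus_infty {X : ℂ → Mat N} {z : ℂ} (h : MSmoothAt ∞ X z) :
    MSmoothAt ∞ (dMinus X) z := h.dd (by simp)

lemma MSmoothAt.mdiffAt_infty {X : ℂ → Mat N} {z : ℂ} (h : MSmoothAt ∞ X z) : MDiffAt X z :=
  h.mdiffAt (by simp)

lemma SmoothNear.dMinus {X : ℂ → Mat N} (h : SmoothNear X p) : SmoothNear (dMinus X) p :=
  h.mono fun _ hz => hz.dMinus_infty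

lemma SmoothNear.iterate {X : ℂ → Mat N} (h : SmoothNear X p) (k : ℕ) :
    SmoothNear (CPSigma.dMinus^[k] X) p := by
  induction k with
  | zero => exact h
  | succ k ih => rw [Function.iterate_succ_apply']; exact ih.dMinus

lemma SmoothNear.mul {X Y : ℂ → Mat N} (hX : SmoothNear X p) (hY : SmoothNear Y p) :
    SmoothNear (fun z => X z * Y z) p := by
  filter_upwards [hX, hY] with z h1 h2 using h1.mul h2

lemma SmoothNear.add {X Y : ℂ → Mat N} (hX : SmoothNear X p) (hY : SmoothNear Y p) :
    SmoothNear (fun z => X z + Y z) p := by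
  filter_upwards [hX, hY] with z h1 h2 using h1.add h2

lemma smoothNear_const (A : Mat N) : SmoothNear (fun _ => A) p :=
  Eventually.of_forall fun _ _ _ => contDiffAt_const

lemma dMinus_congr_eventually {X Y : ℂ → Mat N} (h : X =ᶠ[𝓝 p] Y) :
    dMinus X =ᶠ[𝓝 p] dMinus Y := by
  filter_upwards [h.eventuallyEq_nhds] with z hz using dd_congr hz

lemma iterate_dMinus_congr {X Y : ℂ → Mat N} (h : X =ᶠ[𝓝 p] Y) (k : ℕ) :
    dMinus^[k] X =ᶠ[𝓝 p] dMinus^[k] Y := by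
  induction k with
  | zero => exact h
  | succ k ih => simp only [Function.iterate_succ_apply']; exact dMinus_congr_eventually ih

lemma iterate_dMinus_add {X Y : ℂ → Mat N} (hX : SmoothNear X p) (hY : SmoothNear Y p) (k : ℕ) :
    dMinus^[k] (fun z => X z + Y z) =ᶠ[𝓝 p] fun z => dMinus^[k] X z + dMinus^[k] Y z := by
  induction k with
  | zero => exact EventuallyEq.rfl
  | succ k ih =>
    simp only [Function.iterate_succ_apply']
    refine (dMinus_congr_eventually ih).trans ?_
    filter_upwards [hX.iterate k, hY.iterate k] with z h1 h2
    exact dd_add h1.mdiffAt_infty h2.mdiffAt_infty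

lemma FlatAt.congr {X Y : ℂ → Mat N} (h : FlatAt X p) (he : X =ᶠ[𝓝 p] Y) : FlatAt Y p := fun k =>
  (iterate_dMinus_congr he k).self_of_nhds.symm.trans (h k)

lemma FlatAt.add {X Y : ℂ → Mat N} (h : FlatAt X p) (h' : FlatAt Y p) (hX : SmoothNear X p)
    (hY : SmoothNear Y p) : FlatAt (fun z => X z + Y z) p := fun k => by
  refine (iterate_dMinus_add hX hY k).self_of_nhds.trans ?_
  change CPSigma.dMinus^[k] X p + CPSigma.dMinus^[k] Y p = 0
  rw [h k, h' k, add_zero]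

lemma FlatAt.dMinus {X : ℂ → Mat N} (h : FlatAt X p) : FlatAt (dMinus X) p := fun k => h (k + 1)

/-- A family of functions vanishing at `p` that is closed under `∂₋` up to right multiples consists
of flat functions. -/
lemma flatAt_mul_of_family {W a : ℕ → ℂ → Mat N} (hW : ∀ i, SmoothNear (W i) p)
    (ha : ∀ i, SmoothNear (a i) p) (h0 : ∀ i, W i p = 0)
    (hd : ∀ i, dMinus (W i) =ᶠ[𝓝 p] fun z => W (i + 1) z + W i z * a i z) (i : ℕ)
    {G : ℂ → Mat N} (hG : SmoothNear G p) : FlatAt (fun z => W i z * G z) p := by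
  intro k
  induction k generalizing i G with
  | zero => change W i p * G p = 0; rw [h0, zero_mul]
  | succ k ih =>
    have e : dMinus (fun z => W i z * G z) =ᶠ[𝓝 p]
        fun z => W (i + 1) z * G z + W i z * (a i z * G z + dMinus G z) := by
      filter_upwards [hW i, hG, hd i] with z h1 h2 h3
      have : dMinus (fun z => W i z * G z) z = _ := dd_mul h1.mdiffAt_infty h2.mdiffAt_infty
      rw [this, ← dMinus_eq, h3]
      noncomm_ring
    have hs := ((ha i).mul hG).add hG.dMinus
    rw [Function.iterate_succ_apply, (iterate_dMinus_congr e k).self_of_nhds]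
    refine (iterate_dMinus_add ((hW (i + 1)).mul hG) ((hW i).mul hs) k).self_of_nhds.trans ?_
    exact (congrArg₂ _ (ih _ hG) (ih _ hs)).trans (add_zero 0)

lemma FlatAt.mul {X G : ℂ → Mat N} (h : FlatAt X p) (hX : SmoothNear X p) (hG : SmoothNear G p) :
    FlatAt (fun z => X z * G z) p :=
  flatAt_mul_of_family (W := fun i => CPSigma.dMinus^[i] X) (a := fun _ _ => 0)
    (fun i => hX.iterate i) (fun _ => smoothNear_const 0) h
    (fun i => Eventually.of_forall fun z => by
      simp only [mul_zero, add_zero, Function.iterate_succ_apply']) 0 hG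

lemma FlatAt.smul {X : ℂ → Mat N} (h : FlatAt X p) (hX : SmoothNear X p) {g : ℂ → ℂ}
    (hg : ∀ᶠ z in 𝓝 p, ContDiffAt ℝ ∞ g z) : FlatAt (fun z => g z • X z) p := by
  have h1 : SmoothNear (fun z => g z • (1 : Mat N)) p := by
    filter_upwards [hg] with z hz using MSmoothAt.smul hz fun _ _ => contDiffAt_const
  simpa using h.mul hX h1

lemma FlatAt.of_smul {X : ℂ → Mat N} {g : ℂ → ℂ} (h : FlatAt (fun z => g z • X z) p)
    (hX : SmoothNear X p) (hg : ∀ᶠ z in 𝓝 p, ContDiffAt ℝ ∞ g z) (hp : g p ≠ 0) : FlatAt X p := by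
  have hne := hg.self_of_nhds.continuousAt.eventually_ne hp
  have hs : SmoothNear (fun z => g z • X z) p := by
    filter_upwards [hg, hX] with z h1 h2 using h2.smul h1
  refine (h.smul hs (g := fun z => (g z)⁻¹) ?_).congr ?_
  · filter_upwards [hg, hne] with z h1 h2 using h1.inv h2
  · filter_upwards [hne] with z h1 using inv_smul_smul₀ h1 _

lemma contDiffAt_conj_sub (p z : ℂ) (r : WithTop ℕ∞) : ContDiffAt ℝ r (fun y => conj (y - p)) z :=
  contDiffAt_conj (contDiffAt_id.sub contDiffAt_const)

lemma sd_conj_sub (p z : ℂ) : sd Complex.I (fun y => conj (y - p)) z = 1 := by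
  rw [sd_conj, sd, fderiv_sub_const, fderiv_fun_id]
  norm_num

lemma iterate_dMinus_conj_smul {X : ℂ → Mat N} (hX : SmoothNear X p) (k : ℕ) :
    dMinus^[k + 1] (fun z => conj (z - p) • X z) =ᶠ[𝓝 p]
      fun z => conj (z - p) • dMinus^[k + 1] X z + (k + 1 : ℂ) • dMinus^[k] X z := by
  have key : ∀ {Y : ℂ → Mat N}, SmoothNear Y p → dMinus (fun z => conj (z - p) • Y z) =ᶠ[𝓝 p]
      fun z => conj (z - p) • dMinus Y z + Y z := fun {Y} hY => by
    filter_upwards [hY] with z hz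
    ext i j
    have := sd_mul (c := Complex.I) ((contDiffAt_conj_sub p z 1).differentiableAt (by norm_num))
      (hz.mdiffAt_infty i j)
    rw [sd_conj_sub, one_mul] at this
    exact this.trans (add_comm _ _)
  induction k with
  | zero => simpa using key hX
  | succ k ih =>
    rw [Function.iterate_succ_apply']
    refine (dMinus_congr_eventually ih).trans ?_
    have hs : SmoothNear (fun z => conj (z - p) • dMinus^[k + 1] X z) p := by
      filter_upwards [hX.iterate (k + 1)] with z hz using hz.smul (contDiffAt_conj_sub p z _)
    have hk := hX.iterate k
    have hs' : SmoothNear (fun z => (k + 1 : ℂ) • dMinus^[k] X z) p := by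
      filter_upwards [hk] with z hz using hz.smul contDiffAt_const
    filter_upwards [hs, hs', hk, key (hX.iterate (k + 1))] with z h1 h2 h3 h4
    have e1 : dMinus (fun z => conj (z - p) • dMinus^[k + 1] X z + (k + 1 : ℂ) • dMinus^[k] X z) z
        = dMinus (fun z => conj (z - p) • dMinus^[k + 1] X z) z +
          dMinus (fun z => (k + 1 : ℂ) • dMinus^[k] X z) z :=
      dd_add h1.mdiffAt_infty h2.mdiffAt_infty
    have e2 : dMinus (fun z => (k + 1 : ℂ) • dMinus^[k] X z) z =
        (k + 1 : ℂ) • dMinus^[k + 1] X z := by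
      rw [Function.iterate_succ_apply']
      ext i j
      have := sd_mul (c := Complex.I) (differentiableAt_const (k + 1 : ℂ)) (h3.mdiffAt_infty i j)
      rw [sd_const, zero_mul, zero_add] at this
      exact this
    rw [e1, e2, h4, ← Function.iterate_succ_apply' dMinus (k + 1) X, add_assoc]
    congr 1
    push_cast
    module

/-- Zeros of the form `conj (z - p) ^ k` can be divided out: `∂₋^{j+1} (conj (z - p) X)` equals
`(j + 1) ∂₋^j X` at `p`. -/
lemma FlatAt.of_conj_pow_smul {X : ℂ → Mat N} (k : ℕ)
    (h : FlatAt (fun z => conj (z - p) ^ k • X z) p) (hX : SmoothNear X p) : FlatAt X p := by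
  induction k with
  | zero => simpa using h
  | succ k ih =>
    refine ih fun j => ?_
    have hs : SmoothNear (fun z => conj (z - p) ^ k • X z) p := by
      filter_upwards [hX] with z hz using hz.smul ((contDiffAt_conj_sub p z _).pow k)
    have h1 := h (j + 1)
    simp only [pow_succ', mul_smul] at h1
    have h2 := (iterate_dMinus_conj_smul hs j).self_of_nhds.symm.trans h1
    dsimp only at h2
    rw [sub_self, map_zero, zero_smul, zero_add] at h2
    exact (smul_eq_zero.1 h2).resolve_left (Nat.cast_add_one_ne_zero j)

end Flat

/-! ### The span of the iterated covariant derivatives -/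

section CovariantSpan

variable {N : ℕ}

lemma HarmonicProj.mSmoothAt_infty {X : ℂ → Mat N} (h : ∀ r : ℕ, HarmonicProj (r + 2) X) (z : ℂ) :
    MSmoothAt ∞ X z := fun i j => contDiffAt_infty.2 fun r =>
  ((h r).smoothAt z i j).of_le (by exact_mod_cast Nat.le_add_right r 2)

lemma pow_smul_unique {E : Type*} [NormedAddCommGroup E] [NormedSpace ℂ E] {p : ℂ} {k l : ℕ}
    {B C : ℂ → E} (hB : ContinuousAt B p) (hC : ContinuousAt C p) (hB0 : B p ≠ 0) (hC0 : C p ≠ 0)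
    (h : ∀ᶠ z in 𝓝 p, (z - p) ^ k • B z = (z - p) ^ l • C z) : k = l ∧ B =ᶠ[𝓝 p] C := by
  wlog hkl : k ≤ l generalizing k l B C
  · obtain ⟨h1, h2⟩ := this hC hB hC0 hB0 (h.mono fun z hz => hz.symm) (by omega)
    exact ⟨h1.symm, h2.symm⟩
  obtain ⟨d, rfl⟩ := Nat.exists_eq_add_of_le hkl
  have h1 : ∀ᶠ z in 𝓝[≠] p, B z = (z - p) ^ d • C z := by
    filter_upwards [nhdsWithin_le_nhds h, self_mem_nhdsWithin] with z hz hne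
    rw [pow_add, mul_smul] at hz
    exact smul_right_injective E (pow_ne_zero k (sub_ne_zero.2 hne)) hz
  have hcont : ContinuousAt (fun z => (z - p) ^ d • C z) p := by fun_prop
  have h2 : B p = (p - p) ^ d • C p := eq_of_frequently_eq hB hcont (h1.frequently.filter_mono nhdsWithin_le_nhds)
  have hd : d = 0 := by
    by_contra hd
    rw [sub_self, zero_pow hd, zero_smul] at h2
    exact hB0 h2
  subst hd
  simp only [pow_zero, one_smul] at h1 h2
  exact ⟨rfl, by filter_upwards [eventually_nhdsWithin_iff.1 h1] with z hz
                 by_cases hzp : z = p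
                 · rw [hzp, h2]
                 · exact hz hzp⟩


/-- For a smooth harmonic projector, the nonvanishing factor of the second fundamental form is
smooth: by uniqueness of the factorization, those obtained for the various finite classes agree. -/
lemma exists_smooth_factor {X : ℂ → Mat N} (h : ∀ r : ℕ, HarmonicProj (r + 2) X)
    (hne : ∃ z, sff X z ≠ 0) (p : ℂ) : ∃ (k : ℕ) (B : ℂ → Mat N), SmoothNear B p ∧ B p ≠ 0 ∧
      ∀ᶠ z in 𝓝 p, sff X z = (z - p) ^ k • B z := by
  let _ : NormedRing (Mat N) := Matrix.linftyOpNormedRing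
  let _ : NormedAlgebra ℂ (Mat N) := Matrix.linftyOpNormedAlgebra
  obtain ⟨k, B, hB, hB0, hE⟩ := sff_eq_pow_smul (s := 1) le_rfl (h 0) hne p
  refine ⟨k, B, ?_, hB0, hE⟩
  filter_upwards [eventually_eventually_nhds.2 hE] with z hz
  by_cases hzp : z = p
  · subst hzp
    refine fun i j => contDiffAt_infty.2 fun r => ?_
    obtain ⟨k', B', hB', hB0', hE'⟩ := sff_eq_pow_smul (s := r + 1) (by omega) (h r) hne z
    have hu := pow_smul_unique hB.continuousAt hB'.continuousAt hB0 hB0' (k := k) (l := k') (by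
      filter_upwards [hE, hE'] with y h1 h2 using h1.symm.trans h2)
    exact (hB'.congr hu.2 i j).of_le (by exact_mod_cast Nat.le_succ r)
  · have hs : MSmoothAt ∞ (sff X) z := by
      have h1 : MSmoothAt ∞ X z := HarmonicProj.mSmoothAt_infty h z
      unfold sff
      rw [dPlus_eq]
      exact (h1.dd (by simp)).mul h1
    have hne : z - p ≠ 0 := sub_ne_zero.2 hzp
    refine (MSmoothAt.smul (f := fun y => ((y - p) ^ k)⁻¹) ?_ hs).congr ?_
    · exact ((contDiffAt_id.sub contDiffAt_const).pow k).inv (pow_ne_zero k hne)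
    · filter_upwards [hz, (continuous_sub_right p).continuousAt.eventually_ne hne] with y h1 h2
      rw [h1, inv_smul_smul₀ (pow_ne_zero k h2)]

/-- A sequence of mutually orthogonal smooth harmonic projectors in one chart, each of which
follows its predecessor, and whose first member is holomorphic. -/
structure Tower (n : ℕ) (X : ℕ → ℂ → Mat N) : Prop where
  harmonic : ∀ i ≤ n, ∀ r : ℕ, HarmonicProj (r + 2) (X i)
  next : ∀ i < n, Next (X i) (X (i + 1))
  first : ∀ z, dMinus (X 0) z * X 0 z = 0
  orth : ∀ i ≤ n, ∀ j ≤ n, i ≠ j → ∀ z, X i z * X j z = 0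

/-- The adjoint of the second fundamental form that enters the `i`-th member of a sequence. -/
def sffPrev (X : ℕ → ℂ → Mat N) (z : ℂ) : ℕ → Mat N
  | 0 => 0
  | i + 1 => (sff (X i) z)ᴴ

/-- The sum of the first `k` members of a sequence. -/
def partialSum (X : ℕ → ℂ → Mat N) (k : ℕ) (z : ℂ) : Mat N := ∑ j ∈ Finset.range k, X j z

/-- The matrix all of whose columns are `e`, by which statements about `M e` become statements about
products of matrices. -/
def colMat (e : Fin N → ℂ) : Mat N := Matrix.of fun i _ => e i

/-- The matrix all of whose rows are `r`. -/
def rowMat (r : Fin N → ℂ) : Mat N := Matrix.of fun _ j => r j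

lemma mul_colMat_apply (M : Mat N) (e : Fin N → ℂ) (i j : Fin N) :
    (M * colMat e) i j = (M *ᵥ e) i := rfl

lemma rowMat_mul_mulVec (M : Mat N) (r x : Fin N → ℂ) (i : Fin N) :
    ((rowMat r * M) *ᵥ x) i = r ⬝ᵥ (M *ᵥ x) := by
  rw [← Matrix.mulVec_mulVec]; rfl

lemma mulVec_mulVec_eq_of_mul_colMat {S M : Mat N} {e : Fin N → ℂ} (h : S * (M * colMat e) = M * colMat e) :
    S *ᵥ (M *ᵥ e) = M *ᵥ e := by
  ext i
  have := congrFun (congrFun h i) i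
  rw [← mul_assoc, mul_colMat_apply, mul_colMat_apply, ← Matrix.mulVec_mulVec] at this
  exact this

/-- Projecting by a family of projectors with holomorphic image commutes with covariant
`∂₋`-differentiation. -/
lemma mul_covariant_eq {S U : ℂ → Mat N} {z : ℂ} {e : Fin N → ℂ} (hS : MSmoothAt ∞ S z)
    (hU : MSmoothAt ∞ U z) (hSS : dMinus S z * S z = 0)
    (h : ∀ᶠ y in 𝓝 z, S y * (U y * colMat e) = U y * colMat e) (a : ℂ) :
    S z * ((dMinus U z - a • U z) * colMat e) = (dMinus U z - a • U z) * colMat e := by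
  have hW : MSmoothAt ∞ (fun y => U y * colMat e) z := hU.mul fun _ _ => contDiffAt_const
  have e1 : dMinus (fun y => U y * colMat e) z = dMinus U z * colMat e := by
    have := dd_mul (c := Complex.I) (Y := fun _ => colMat e) hU.mdiffAt_infty
      (fun _ _ => differentiableAt_const _)
    rwa [dd_const, mul_zero, add_zero] at this
  have e2 : dMinus (fun y => U y * colMat e) z = S z * (dMinus U z * colMat e) := by
    have h1 : dMinus (fun y => U y * colMat e) z = dMinus (fun y => S y * (U y * colMat e)) z :=
      dd_congr (h.mono fun y hy => hy.symm)
    have h2 : dMinus (fun y => S y * (U y * colMat e)) z = _ :=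
      dd_mul hS.mdiffAt_infty hW.mdiffAt_infty
    have h3 : dd Complex.I (fun y => U y * colMat e) z = _ := e1
    rw [h1, h2, ← dMinus_eq, ← h.self_of_nhds, ← mul_assoc, hSS, zero_mul, zero_add, dMinus_eq, h3]
    rfl
  rw [sub_mul, mul_sub, ← e2, e1, smul_mul_assoc, mul_smul_comm, h.self_of_nhds]

lemma contDiffAt_dotProduct_mulVec {r : WithTop ℕ∞} {M : ℂ → Mat N} {z : ℂ} (h : MSmoothAt r M z)
    (e : Fin N → ℂ) : ContDiffAt ℝ r (fun y => star e ⬝ᵥ (M y *ᵥ e)) z := by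
  simp only [dotProduct, Matrix.mulVec]
  exact ContDiffAt.sum fun i _ => contDiffAt_const.mul
    (ContDiffAt.sum fun j _ => (h i j).mul contDiffAt_const)

open scoped ComplexOrder in
lemma IsRankOneProj.dotProduct_mulVec_ne_zero {P : Mat N} (h : IsRankOneProj P) {e : Fin N → ℂ}
    (he : P *ᵥ e ≠ 0) : star e ⬝ᵥ (P *ᵥ e) ≠ 0 := by
  have h1 : star e ⬝ᵥ (P *ᵥ e) = star (P *ᵥ e) ⬝ᵥ (P *ᵥ e) := by
    conv_lhs => rw [← h.idem, ← Matrix.mulVec_mulVec]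
    rw [Matrix.star_mulVec, h.herm, Matrix.dotProduct_mulVec]
  rw [h1]
  exact dotProduct_star_self_eq_zero.not.2 he

lemma IsRankOneProj.trace_mul_colMat_ne_zero {P : Mat N} (h : IsRankOneProj P) {e : Fin N → ℂ}
    (he : P *ᵥ e ≠ 0) : (P * (colMat e * (colMat e)ᴴ)).trace ≠ 0 := by
  have h1 : (P * (colMat e * (colMat e)ᴴ)).trace = ((P * colMat e) * (P * colMat e)ᴴ).trace := by
    rw [Matrix.conjTranspose_mul, h.herm, ← mul_assoc (P * colMat e),
      Matrix.trace_mul_comm (P * colMat e * (colMat e)ᴴ) P, mul_assoc P, ← mul_assoc P P, h.idem]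
  rw [h1]
  refine trace_mul_conjTranspose_ne_zero fun h0 => he ?_
  ext i
  exact congrFun (congrFun h0 i) i

lemma sum_mul_of_orthogonal {ι : Type*} [DecidableEq ι] {s : Finset ι} {Q : ι → Mat N}
    (hi : ∀ i ∈ s, Q i * Q i = Q i) (h0 : ∀ i ∈ s, ∀ j ∈ s, i ≠ j → Q i * Q j = 0) :
    ∀ i ∈ s, (∑ j ∈ s, Q j) * Q i = Q i := fun i his => by
  rw [Finset.sum_mul, Finset.sum_eq_single i (fun j hj hji => h0 j hj i his hji)
    (fun h => absurd his h), hi i his]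

namespace Tower

variable {n : ℕ} {X : ℕ → ℂ → Mat N}

lemma rankOne (h : Tower n X) {i : ℕ} (hi : i ≤ n) (z : ℂ) : IsRankOneProj (X i z) :=
  (h.harmonic i hi 0).rankOne z

lemma mSmoothAt (h : Tower n X) {i : ℕ} (hi : i ≤ n) (z : ℂ) : MSmoothAt ∞ (X i) z :=
  HarmonicProj.mSmoothAt_infty (h.harmonic i hi) z

lemma mul_sffPrev_succ (h : Tower n X) {i : ℕ} (hi : i ≤ n) (z : ℂ) :
    X i z * sffPrev X z (i + 1) = sffPrev X z (i + 1) :=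
  mul_sff_conjTranspose (h.rankOne hi) z

lemma dMinus_eq (h : Tower n X) {i : ℕ} (hi : i ≤ n) (z : ℂ) :
    dMinus (X i) z = sffPrev X z (i + 1) - sffPrev X z i := by
  have h1 : dMinus (X i) z = dMinus (X i) z * X i z + X i z * dMinus (X i) z :=
    dd_eq_add (h.rankOne hi) (h.mSmoothAt hi z).mdiffAt_infty _
  have h2 : X i z * dMinus (X i) z = sffPrev X z (i + 1) :=
    (CPSigma.sff_conjTranspose (h.rankOne hi) z).symm
  have h3 : dMinus (X i) z * X i z = -sffPrev X z i := by
    cases i with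
    | zero => exact (h.first z).trans neg_zero.symm
    | succ i => exact (h.next i hi).back z
  rw [h1, h2, h3]
  abel

lemma mul_sffPrev_eq_zero (h : Tower n X) {i j : ℕ} (hi : i ≤ n) (hj : j < i) (z : ℂ) :
    X i z * sffPrev X z (j + 1) = 0 := by
  rw [← h.mul_sffPrev_succ (by omega), ← mul_assoc, h.orth i hi j (by omega) (by omega), zero_mul]

lemma sffPrev_mul_eq_zero (h : Tower n X) {i j : ℕ} (hi : i ≤ n) (hj : j ≤ i) (z : ℂ) :
    sffPrev X z (i + 1) * X j z = 0 := by
  have hd : ∀ {i}, i ≤ n → MDiffAt (X i) z := fun hi => (h.mSmoothAt hi z).mdiffAt_infty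
  obtain rfl | hlt := hj.eq_or_lt
  · exact CPSigma.sff_conjTranspose_mul (h.rankOne hi) (hd hi)
  · have h1 : dMinus (X i) z * X j z + X i z * dMinus (X j) z = 0 := by
      have h2 : dMinus (fun y => X i y * X j y) z = _ := dd_mul (hd hi) (hd (by omega))
      refine h2.symm.trans ?_
      rw [funext fun y => h.orth i hi j (by omega) (by omega) y]
      exact dd_const _ _ _
    have h3 : X i z * dMinus (X j) z = 0 := by
      rw [h.dMinus_eq (by omega), mul_sub, h.mul_sffPrev_eq_zero hi hlt, zero_sub, neg_eq_zero]
      cases j with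
      | zero => exact mul_zero _
      | succ j => exact h.mul_sffPrev_eq_zero hi (by omega) z
    rw [h3, add_zero] at h1
    change (sff (X i) z)ᴴ * X j z = 0
    rw [CPSigma.sff_conjTranspose (h.rankOne hi), mul_assoc, h1, mul_zero]

lemma mSmoothAt_partialSum (h : Tower n X) {k : ℕ} (hk : k ≤ n + 1) (z : ℂ) :
    MSmoothAt ∞ (partialSum X k) z := fun i j => by
  simp only [partialSum, Matrix.sum_apply]
  exact ContDiffAt.sum fun l hl => h.mSmoothAt (by have := Finset.mem_range.1 hl; omega) z i j

lemma dMinus_partialSum (h : Tower n X) {k : ℕ} (hk : k ≤ n + 1) (z : ℂ) :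
    dMinus (partialSum X k) z = sffPrev X z k := by
  induction k with
  | zero => exact dd_const Complex.I (0 : Mat N) z
  | succ k ih =>
    have h1 : dMinus (fun y => partialSum X k y + X k y) z = _ :=
      dd_add (h.mSmoothAt_partialSum (by omega) z).mdiffAt_infty
        (h.mSmoothAt (i := k) (by omega) z).mdiffAt_infty
    have h2 : partialSum X (k + 1) = fun y => partialSum X k y + X k y :=
      funext fun y => Finset.sum_range_succ _ _
    rw [h2, h1, ← CPSigma.dMinus_eq, ih (by omega), h.dMinus_eq (by omega)]
    abel

/-- The image of a partial sum is a holomorphic vector bundle. -/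
lemma dMinus_partialSum_mul (h : Tower n X) {k : ℕ} (hk : k ≤ n + 1) (z : ℂ) :
    dMinus (partialSum X k) z * partialSum X k z = 0 := by
  rw [h.dMinus_partialSum hk]
  cases k with
  | zero => exact zero_mul _
  | succ k =>
    rw [partialSum, Finset.mul_sum]
    exact Finset.sum_eq_zero fun j hj =>
      h.sffPrev_mul_eq_zero (by omega) (Nat.lt_succ_iff.1 (Finset.mem_range.1 hj)) z

lemma partialSum_mul (h : Tower n X) {k i : ℕ} (hk : k ≤ n + 1) (hi : i < k) (z : ℂ) :
    partialSum X k z * X i z = X i z :=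
  sum_mul_of_orthogonal (Q := fun j => X j z)
    (fun j hj => (h.rankOne (by have := Finset.mem_range.1 hj; omega) z).idem)
    (fun j hj l hl hjl => h.orth j (by have := Finset.mem_range.1 hj; omega) l
      (by have := Finset.mem_range.1 hl; omega) hjl z) i (Finset.mem_range.2 hi)

variable {e : Fin N → ℂ}

/-- The iterated covariant derivatives `D₋ᵏ P` of the last member of a sequence. -/
abbrev cov (X : ℕ → ℂ → Mat N) (n : ℕ) (e : Fin N → ℂ) (k : ℕ) : ℂ → Mat N :=
  (covD dMinus (X n) e)^[k] (X n)

lemma cov_succ (k : ℕ) (z : ℂ) : cov X n e (k + 1) z =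
    dMinus (cov X n e k) z - sesq (X n) e (X n) (dMinus (X n)) z • cov X n e k z := by
  rw [cov, Function.iterate_succ_apply']; rfl

lemma eventually_ne (h : Tower n X) {z : ℂ} (hz : X n z *ᵥ e ≠ 0) :
    ∀ᶠ y in 𝓝 z, X n y *ᵥ e ≠ 0 := by
  have hc : Continuous (X n) := continuous_of_mSmoothAt (h.mSmoothAt le_rfl)
  exact (hc.matrix_mulVec continuous_const).continuousAt.eventually_ne hz

lemma contDiffAt_sesq (h : Tower n X) {z : ℂ} (hz : X n z *ᵥ e ≠ 0) :
    ContDiffAt ℝ ∞ (sesq (X n) e (X n) (dMinus (X n))) z := by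
  have hs := h.mSmoothAt le_rfl z
  exact (contDiffAt_dotProduct_mulVec (hs.conjTranspose.mul hs.dMinus_infty) e).mul
    ((contDiffAt_dotProduct_mulVec hs e).inv ((h.rankOne le_rfl z).dotProduct_mulVec_ne_zero hz))

lemma mSmoothAt_cov (h : Tower n X) (k : ℕ) {z : ℂ} (hz : X n z *ᵥ e ≠ 0) :
    MSmoothAt ∞ (cov X n e k) z := by
  induction k with
  | zero => exact h.mSmoothAt le_rfl z
  | succ k ih =>
    have := ih.dMinus_infty.add (MSmoothAt.smul (h.contDiffAt_sesq hz).neg ih)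
    have e1 : cov X n e (k + 1) = fun y => dMinus (cov X n e k) y +
        (-sesq (X n) e (X n) (dMinus (X n)) y) • cov X n e k y := funext fun y => by
      rw [cov_succ, neg_smul, sub_eq_add_neg]
    rw [e1]
    exact this

lemma partialSum_mul_cov (h : Tower n X) (k : ℕ) {z : ℂ} (hz : X n z *ᵥ e ≠ 0) :
    partialSum X (n + 1) z * (cov X n e k z * colMat e) = cov X n e k z * colMat e := by
  induction k generalizing z with
  | zero =>
    rw [← mul_assoc]
    exact congrArg (· * colMat e) (h.partialSum_mul le_rfl (Nat.lt_succ_self n) z)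
  | succ k ih =>
    rw [cov_succ]
    exact mul_covariant_eq (h.mSmoothAt_partialSum le_rfl z) (h.mSmoothAt_cov k hz)
      (h.dMinus_partialSum_mul le_rfl z) ((h.eventually_ne hz).mono fun y hy => ih hy) _

/-- The covariant derivative removes the component of `∂₋P e` in the image of `P`. -/
lemma cov_one_mul (h : Tower n X) {z : ℂ} (hz : X n z *ᵥ e ≠ 0) :
    cov X n e 1 z * colMat e = -(sffPrev X z n * colMat e) := by
  have hR := h.rankOne le_rfl z
  have h1 : X n z * dMinus (X n) z * colMat e =
      sesq (X n) e (X n) (dMinus (X n)) z • (X n z * colMat e) := by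
    obtain ⟨v, hv, hPv, hspan⟩ := hR.exists_span
    obtain ⟨a, ha⟩ := hspan e
    obtain ⟨b, hb⟩ := hspan (dMinus (X n) z *ᵥ e)
    have hne := hR.dotProduct_mulVec_ne_zero hz
    ext i j
    rw [Matrix.smul_apply, mul_colMat_apply, mul_colMat_apply, ← Matrix.mulVec_mulVec, hb, sesq,
      hR.herm, ← Matrix.mulVec_mulVec, hb]
    rw [ha] at hne ⊢
    rw [dotProduct_smul, smul_eq_mul] at hne ⊢
    rw [dotProduct_smul, smul_eq_mul]
    have ha0 := left_ne_zero_of_mul hne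
    have hv0 := right_ne_zero_of_mul hne
    simp only [Pi.smul_apply, smul_eq_mul]
    field_simp
  have h2 : X n z * dMinus (X n) z = sffPrev X z (n + 1) :=
    (CPSigma.sff_conjTranspose (h.rankOne le_rfl) z).symm
  have h3 := h.dMinus_eq le_rfl z
  rw [h2] at h1
  rw [show (1 : ℕ) = 0 + 1 from rfl, cov_succ]
  change (dMinus (X n) z - _ • X n z) * _ = _
  rw [sub_mul, smul_mul_assoc, ← h1, h3]
  noncomm_ring

lemma partialSum_mul_cov_succ (h : Tower n X) (k : ℕ) {z : ℂ} (hz : X n z *ᵥ e ≠ 0) :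
    partialSum X n z * (cov X n e (k + 1) z * colMat e) = cov X n e (k + 1) z * colMat e := by
  induction k generalizing z with
  | zero =>
    rw [h.cov_one_mul hz, mul_neg, ← mul_assoc]
    cases n with
    | zero => simp [sffPrev]
    | succ n =>
      rw [← h.mul_sffPrev_succ (by omega), ← mul_assoc, h.partialSum_mul (by omega) (by omega)]
  | succ k ih =>
    rw [cov_succ]
    exact mul_covariant_eq (h.mSmoothAt_partialSum (by omega) z) (h.mSmoothAt_cov _ hz)
      (h.dMinus_partialSum_mul (by omega) z) ((h.eventually_ne hz).mono fun y hy => ih hy) _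

lemma smoothNear (h : Tower n X) {i : ℕ} (hi : i ≤ n) (z : ℂ) : SmoothNear (X i) z :=
  Eventually.of_forall (h.mSmoothAt hi)

/-- A covector `r` that annihilates all iterated covariant derivatives gives a flat function `r P`. -/
lemma flatAt_last (h : Tower n X) {z : ℂ} (hz : X n z *ᵥ e ≠ 0) {r : Fin N → ℂ}
    (hr : ∀ k, r ⬝ᵥ (cov X n e k z *ᵥ e) = 0) : FlatAt (fun y => rowMat r * X n y) z := by
  have hne := h.eventually_ne hz
  have hX := h.smoothNear le_rfl z
  have hcov : ∀ k, SmoothNear (cov X n e k) z := fun k => hne.mono fun y hy => h.mSmoothAt_cov k hy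
  have hW : ∀ k, SmoothNear (fun y => rowMat r * (cov X n e k y * colMat e)) z := fun k =>
    (smoothNear_const _).mul ((hcov k).mul (smoothNear_const _))
  have hflat := flatAt_mul_of_family (p := z)
    (W := fun k y => rowMat r * (cov X n e k y * colMat e))
    (a := fun _ y => sesq (X n) e (X n) (dMinus (X n)) y • (1 : Mat N)) hW
    (fun _ => hne.mono fun y hy => (MSmoothAt.smul (h.contDiffAt_sesq hy)
      fun _ _ => contDiffAt_const))
    (fun k => by ext i j; exact hr k)
    (fun k => by
      filter_upwards [hne] with y hy
      have hd : MDiffAt (cov X n e k) y := (h.mSmoothAt_cov k hy).mdiffAt_infty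
      have hc : ∀ A : Mat N, MDiffAt (fun _ => A) y := fun A _ _ => differentiableAt_const _
      have h1 : dMinus (fun y => cov X n e k y * colMat e) y = dMinus (cov X n e k) y * colMat e := by
        have := dd_mul (c := Complex.I) hd (hc (colMat e))
        rwa [dd_const, mul_zero, add_zero] at this
      have h2 : dMinus (fun y => rowMat r * (cov X n e k y * colMat e)) y =
          rowMat r * (dMinus (cov X n e k) y * colMat e) := by
        have h3 : MSmoothAt ∞ (fun y => cov X n e k y * colMat e) y :=
          (h.mSmoothAt_cov k hy).mul fun _ _ => contDiffAt_const
        have := dd_mul (c := Complex.I) (hc (rowMat r)) h3.mdiffAt_infty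
        rw [dd_const, zero_mul, zero_add] at this
        exact this.trans (congrArg _ h1)
      rw [h2, cov_succ, mul_smul_comm, mul_one, sub_mul, smul_mul_assoc, mul_sub, mul_smul_comm,
        sub_add_cancel]) 0
    (G := fun y => (colMat e)ᴴ * X n y) ((smoothNear_const _).mul hX)
  -- `P E E† P` is a multiple of `P` with the nonvanishing factor `N |P e|²`
  refine FlatAt.of_smul (g := fun y => (X n y * (colMat e * (colMat e)ᴴ)).trace)
    (hflat.congr ?_) ((smoothNear_const _).mul hX) ?_ ?_
  · refine Eventually.of_forall fun y => ?_
    change rowMat r * (X n y * colMat e) * ((colMat e)ᴴ * X n y) = _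
    dsimp only
    rw [← mul_smul_comm, ← (h.rankOne le_rfl y).mul_mul]
    simp only [mul_assoc]
  · exact (hX.mul (smoothNear_const (colMat e * (colMat e)ᴴ))).mono fun y hy => hy.trace
  · exact (h.rankOne le_rfl z).trace_mul_colMat_ne_zero hz

/-- Flatness descends along the sequence. The zeros of the second fundamental form, which are of
finite order, are divided out. -/
lemma flatAt_of_succ (h : Tower n X) {i : ℕ} (hi : i < n) {z : ℂ} {F : Mat N}
    (hf : FlatAt (fun y => F * X (i + 1) y) z) : FlatAt (fun y => F * X i y) z := by
  have hX := h.smoothNear hi.le z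
  have hX' := h.smoothNear (i := i + 1) hi z
  have hF : ∀ {Y : ℂ → Mat N}, SmoothNear Y z → SmoothNear (fun y => F * Y y) z := fun hY =>
    (smoothNear_const F).mul hY
  have hA : ∀ j ≤ n, SmoothNear (fun y => sffPrev X y (j + 1)) z := fun j hj => by
    have := (h.smoothNear hj z).mul (h.smoothNear hj z).dMinus
    refine this.mono fun y hy => hy.congr (Eventually.of_forall fun x => ?_)
    exact CPSigma.sff_conjTranspose (h.rankOne hj) x
  -- `∂₋(F X_{i+1}) = -F A_i† + F X_{i+1} A_{i+1}†`
  have h1 : FlatAt (fun y => F * sffPrev X y (i + 1)) z := by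
    have h2 := (hf.mul (hF hX') (hA (i + 1) hi)).add
      (hf.dMinus.smul (hF hX').dMinus (g := fun _ => -1)
        (Eventually.of_forall fun _ => contDiffAt_const))
      ((hF hX').mul (hA (i + 1) hi))
      ((hF hX').dMinus.mono fun y hy => hy.smul contDiffAt_const)
    refine h2.congr (Eventually.of_forall fun y => ?_)
    have h3 : dMinus (fun y => F * X (i + 1) y) y = F * dMinus (X (i + 1)) y := by
      have := dd_mul (c := Complex.I) (X := fun _ => F) (fun _ _ => differentiableAt_const _)
        (h.mSmoothAt (i := i + 1) hi y).mdiffAt_infty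
      rwa [dd_const, zero_mul, zero_add] at this
    change F * X (i + 1) y * sffPrev X y (i + 1 + 1) + (-1 : ℂ) • _ = F * sffPrev X y (i + 1)
    rw [h3, mul_assoc, h.mul_sffPrev_succ hi, h.dMinus_eq hi, neg_smul, one_smul, mul_sub]
    abel
  obtain ⟨p, hp⟩ := (h.next i hi).dense.nonempty
  obtain ⟨k, B, hB, hB0, hE⟩ := exists_smooth_factor (h.harmonic i hi.le) ⟨p, hp⟩ z
  have hBH : SmoothNear (fun y => (B y)ᴴ) z := hB.mono fun y hy => hy.conjTranspose
  have h2 : FlatAt (fun y => F * (B y)ᴴ) z := by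
    refine FlatAt.of_conj_pow_smul k (h1.congr ?_) (hF hBH)
    filter_upwards [hE] with y hy
    rw [sffPrev, hy, Matrix.conjTranspose_smul, mul_smul_comm, star_pow]
    rfl
  -- `B† B` is a multiple of `X_i` with a nonvanishing factor
  have hBX : ∀ᶠ y in 𝓝 z, B y * X i y = B y := by
    have h3 : ∀ᶠ y in 𝓝[≠] z, B y * X i y = B y := by
      filter_upwards [nhdsWithin_le_nhds hE, self_mem_nhdsWithin] with y hy hne
      have h4 := sff_mul_self (h.rankOne hi.le) y
      rw [hy, smul_mul_assoc] at h4
      exact smul_right_injective _ (pow_ne_zero k (sub_ne_zero.2 hne)) h4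
    have h5 : B z * X i z = B z :=
      eq_of_frequently_eq (hB.self_of_nhds.mul hX.self_of_nhds).continuousAt
        hB.self_of_nhds.continuousAt (h3.frequently.filter_mono nhdsWithin_le_nhds)
    filter_upwards [eventually_nhdsWithin_iff.1 h3] with y hy
    by_cases hyz : y = z
    · rw [hyz, h5]
    · exact hy hyz
  refine FlatAt.of_smul (g := fun y => (B y * (B y)ᴴ).trace) ((h2.mul (hF hBH) hB).congr ?_)
    (hF hX) ?_ ?_
  · filter_upwards [hBX] with y hy
    have hR := h.rankOne hi.le y
    have h6 : X i y * (B y)ᴴ = (B y)ᴴ := by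
      conv_rhs => rw [← hy, Matrix.conjTranspose_mul, hR.herm]
    have h7 := hR.mul_mul ((B y)ᴴ * B y)
    rw [← mul_assoc, h6, mul_assoc, hy, Matrix.trace_mul_comm] at h7
    rw [mul_assoc, h7, mul_smul_comm]
  · filter_upwards [hB] with y hy using (hy.mul hy.conjTranspose).trace
  · exact trace_mul_conjTranspose_ne_zero hB0

lemma flatAt_of_le (h : Tower n X) {i : ℕ} (hi : i ≤ n) {z : ℂ} {F : Mat N}
    (hf : FlatAt (fun y => F * X n y) z) : FlatAt (fun y => F * X i y) z := by
  induction hi using Nat.decreasingInduction with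
  | self => exact hf
  | of_succ i hi ih => exact h.flatAt_of_succ hi ih

/-- The iterated covariant derivatives of the last member span the images of all members. -/
theorem dotProduct_eq_zero (h : Tower n X) {z : ℂ} (hz : X n z *ᵥ e ≠ 0) {r : Fin N → ℂ}
    (hr : ∀ k, r ⬝ᵥ (cov X n e k z *ᵥ e) = 0) (x : Fin N → ℂ) :
    r ⬝ᵥ (partialSum X (n + 1) z *ᵥ x) = 0 := by
  rw [partialSum, Matrix.sum_mulVec, dotProduct_sum]
  refine Finset.sum_eq_zero fun i hi => ?_
  have h1 : rowMat r * X i z = 0 :=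
    h.flatAt_of_le (Nat.lt_succ_iff.1 (Finset.mem_range.1 hi)) (h.flatAt_last hz hr) 0
  by_cases hN : Nonempty (Fin N)
  · obtain ⟨j⟩ := hN
    rw [← rowMat_mul_mulVec _ _ _ j, h1, Matrix.zero_mulVec]; rfl
  · rw [not_nonempty_iff] at hN
    simp [dotProduct]

/-- The covariant derivatives of order at least one span the images of the members before the last:
a covector `r` that annihilates them may be replaced by `r S`, with `S` the projector to those
images, which annihilates the last member as well. -/
theorem dotProduct_eq_zero_of_succ (h : Tower n X) {z : ℂ} (hz : X n z *ᵥ e ≠ 0) {r : Fin N → ℂ}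
    (hr : ∀ k, r ⬝ᵥ (cov X n e (k + 1) z *ᵥ e) = 0) (x : Fin N → ℂ) :
    r ⬝ᵥ (partialSum X n z *ᵥ x) = 0 := by
  have hidem : partialSum X (n + 1) z * partialSum X n z = partialSum X n z := by
    conv_lhs => rw [partialSum.eq_def X n, Finset.mul_sum]
    exact Finset.sum_congr rfl fun i hi =>
      h.partialSum_mul le_rfl ((Finset.mem_range.1 hi).trans (Nat.lt_succ_self n)) z
  have hidem' : partialSum X n z * partialSum X n z = partialSum X n z := by
    conv_lhs => rw [partialSum.eq_def X n, Finset.mul_sum]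
    exact Finset.sum_congr rfl fun i hi =>
      h.partialSum_mul (Nat.le_succ n) (Finset.mem_range.1 hi) z
  have h0 : partialSum X n z * X n z = 0 := by
    rw [partialSum, Finset.sum_mul]
    exact Finset.sum_eq_zero fun j hj =>
      h.orth j (Finset.mem_range.1 hj).le n le_rfl (Finset.mem_range.1 hj).ne z
  have := h.dotProduct_eq_zero hz (r := r ᵥ* partialSum X n z) (fun k => ?_)
    (partialSum X n z *ᵥ x)
  · rwa [Matrix.mulVec_mulVec, hidem, ← Matrix.dotProduct_mulVec, Matrix.mulVec_mulVec, hidem']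
      at this
  · rw [← Matrix.dotProduct_mulVec]
    cases k with
    | zero =>
      change r ⬝ᵥ (partialSum X n z *ᵥ (X n z *ᵥ e)) = 0
      rw [Matrix.mulVec_mulVec, h0, Matrix.zero_mulVec, dotProduct_zero]
    | succ k => rw [mulVec_mulVec_eq_of_mul_colMat (h.partialSum_mul_cov_succ k hz), hr k]

end Tower

end CovariantSpan

/-! ### Complete sequences of harmonic projectors -/

section Complete

variable {N : ℕ}

lemma sff_cj_of_next {X Y : ℂ → Mat N} (h : Next X Y) (z : ℂ) :
    sff (fun y => cj (Y y)) z = -cj (sff X z)ᴴ := by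
  rw [sff, dPlus_cj, ← cj_mul, h.back]
  ext i j
  simp [cj]

lemma conjTranspose_cj (A : Mat N) : (cj A)ᴴ = cj Aᴴ := rfl

lemma Next.cj {X Y : ℂ → Mat N} (h : Next X Y) (hX : HarmonicProj 2 X) :
    Next (fun z => cj (Y z)) (fun z => cj (X z)) := by
  refine ⟨?_, fun z => ?_, fun z => ?_⟩
  · simp only [sff_cj_of_next h, ne_eq, neg_eq_zero, cj_eq_zero, Matrix.conjTranspose_eq_zero]
    exact h.dense
  · have h1 := (hX.rankOne z).mul_mul ((sff X z)ᴴ * sff X z)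
    rw [← mul_assoc, mul_sff_conjTranspose hX.rankOne, mul_assoc, sff_mul_self hX.rankOne] at h1
    rw [sff_cj_of_next h, Matrix.conjTranspose_neg, neg_mul_neg, conjTranspose_cj,
      Matrix.conjTranspose_conjTranspose, ← cj_mul, trace_cj, ← cj_smul, ← h1]
  · rw [dMinus_cj, ← cj_mul, sff_cj_of_next h, Matrix.conjTranspose_neg, neg_neg, conjTranspose_cj,
      Matrix.conjTranspose_conjTranspose]
    rfl

/-- Conjugation reverses the order in a sequence. -/
lemma NextS.cjS {X Y : OnePoint ℂ → Mat N} (h : NextS X Y) (hX : SphereHarmonic 2 X) :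
    NextS (cjS Y) (cjS X) := by
  refine ⟨h.aff.cj hX.aff, ?_⟩
  rw [inv_cjS, inv_cjS]
  exact h.inv.cj hX.inv

/-- Raising undoes lowering. -/
lemma NextS.raise_eq {X Y : OnePoint ℂ → Mat N} (h : NextS X Y) (hX : SphereHarmonic 2 X)
    (hY : SphereHarmonic 2 Y) : raise X = Y := by
  have := (h.cjS hX).lower_eq (hY.cjS le_rfl) (hX.cjS le_rfl)
  rw [lower_cjS] at this
  rw [← cjS_cjS (raise X), this, cjS_cjS]

/-- A sequence of smooth harmonic projectors on the sphere, each of which follows its predecessor,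
which starts with a holomorphic and ends with an antiholomorphic projector. -/
structure CompleteChain (M : ℕ) (R : ℕ → OnePoint ℂ → Mat N) : Prop where
  harmonic : ∀ i ≤ M, ∀ r : ℕ, SphereHarmonic (r + 2) (R i)
  next : ∀ i < M, NextS (R i) (R (i + 1))
  first : ∀ z, dMinus (aff (R 0)) z * aff (R 0) z = 0
  last : ∀ z, sff (aff (R M)) z = 0

namespace CompleteChain

variable {M : ℕ} {R : ℕ → OnePoint ℂ → Mat N}

lemma chain (h : CompleteChain M R) : Chain M R := ⟨fun i hi => h.harmonic i hi 0, h.next⟩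

/-- The conjugate sequence in reverse order. -/
lemma reverse (h : CompleteChain M R) : CompleteChain M fun i => cjS (R (M - i)) := by
  refine ⟨fun i _ r => (h.harmonic (M - i) (Nat.sub_le _ _) r).cjS (by omega), fun i hi => ?_,
    fun z => ?_, fun z => ?_⟩
  · have := (h.next (M - (i + 1)) (by omega)).cjS (h.harmonic _ (by omega) 0)
    rwa [show M - (i + 1) + 1 = M - i by omega] at this
  · change dMinus (fun y => cj (aff (R M) y)) z * cj (aff (R M) z) = 0
    rw [dMinus_cj, ← cj_mul]
    exact cj_eq_zero.2 (h.last z)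
  · simp only [Nat.sub_self]
    change dPlus (fun y => cj (aff (R 0) y)) z * cj (aff (R 0) z) = 0
    rw [dPlus_cj, ← cj_mul, h.first, cj_zero]

lemma lower_succ (h : CompleteChain M R) {i : ℕ} (hi : i < M) : lower (R (i + 1)) = R i :=
  (h.next i hi).lower_eq (h.harmonic i hi.le 0) (h.harmonic (i + 1) hi 0)

lemma raise_eq (h : CompleteChain M R) {i : ℕ} (hi : i < M) : raise (R i) = R (i + 1) :=
  (h.next i hi).raise_eq (h.harmonic i hi.le 0) (h.harmonic (i + 1) hi 0)

lemma raise_last (h : CompleteChain M R) : raise (R M) = 0 :=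
  (h.harmonic M le_rfl 0).raise_eq_zero h.last

lemma lower_first (h : CompleteChain M R) : lower (R 0) = 0 := by
  have := h.reverse.raise_last
  simp only [Nat.sub_self] at this
  rw [← cjS_cjS (R 0), lower_cjS, this, cjS_zero]

lemma iterate_raise (h : CompleteChain M R) {i : ℕ} (k : ℕ) (hi : i + k ≤ M) :
    raise^[k] (R i) = R (i + k) := by
  induction k with
  | zero => rfl
  | succ k ih => rw [Function.iterate_succ_apply', ih (by omega), h.raise_eq (by omega)]; rfl

lemma iterate_lower (h : CompleteChain M R) {i k : ℕ} (hi : i ≤ M) (hk : k ≤ i) :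
    lower^[k] (R i) = R (i - k) := by
  induction k with
  | zero => rfl
  | succ k ih =>
    rw [Function.iterate_succ_apply', ih (by omega), show i - k = i - (k + 1) + 1 by omega,
      h.lower_succ (by omega)]

lemma iterate_raise_eq_zero (h : CompleteChain M R) {i k : ℕ} (hi : i ≤ M) (hk : M < i + k) :
    raise^[k] (R i) = 0 := by
  obtain ⟨d, rfl⟩ : ∃ d, k = d + 1 + (M - i) := ⟨k - (M - i) - 1, by omega⟩
  rw [Function.iterate_add_apply, h.iterate_raise _ (by omega), show i + (M - i) = M by omega,
    Function.iterate_succ_apply, h.raise_last]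
  exact Function.iterate_fixed raise_zero d

lemma iterate_lower_eq_zero (h : CompleteChain M R) {i k : ℕ} (hi : i ≤ M) (hk : i < k) :
    lower^[k] (R i) = 0 := by
  obtain ⟨d, rfl⟩ : ∃ d, k = d + 1 + i := ⟨k - i - 1, by omega⟩
  rw [Function.iterate_add_apply, h.iterate_lower hi le_rfl, Nat.sub_self,
    Function.iterate_succ_apply, h.lower_first]
  exact Function.iterate_fixed lower_zero d

end CompleteChain

/-- A projector that is holomorphic in the affine chart is holomorphic at `∞`. -/
lemma SphereHarmonic.holoProj {X : OnePoint ℂ → Mat N} (hX : SphereHarmonic 2 X)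
    (h : ∀ z, dMinus (CPSigma.aff X) z * CPSigma.aff X z = 0) :
    HoloProj (CPSigma.aff X) ∧ HoloProj (CPSigma.inv X) := by
  refine ⟨⟨hX.aff.rankOne, fun z => (hX.aff.smoothAt z).of_le (by norm_num), h⟩,
    hX.inv.rankOne, fun z => (hX.inv.smoothAt z).of_le (by norm_num), fun w => ?_⟩
  have hs : ∀ w, MSmoothAt 1 (dMinus (CPSigma.inv X)) w := fun w =>
    (hX.inv.smoothAt w).dd (by norm_num)
  have hc : Continuous fun w => dMinus (CPSigma.inv X) w * CPSigma.inv X w :=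
    (continuous_of_mSmoothAt hs).mul (continuous_of_mSmoothAt hX.inv.smoothAt)
  refine congrFun (Continuous.ext_on (dense_compl_singleton (0 : ℂ)) hc continuous_const
    (g := fun _ => 0) fun w hw => ?_) w
  have hw0 : w ≠ 0 := hw
  have he := inv_eventuallyEq (X := X) hw0
  have h1 : dMinus (CPSigma.inv X) w = -conj (w ^ 2)⁻¹ • dMinus (CPSigma.aff X) w⁻¹ := by
    rw [← dMinus_comp_inv hw0 ((hX.aff.smoothAt _).mdiffAt (by norm_num))]
    exact dd_congr he
  change dMinus (CPSigma.inv X) w * CPSigma.inv X w = 0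
  rw [h1, he.self_of_nhds, smul_mul_assoc, h, smul_zero]

lemma CompleteChain.isHolomorphicProj {M : ℕ} {R : ℕ → OnePoint ℂ → Mat N}
    (h : CompleteChain M R) : IsHolomorphicProj (R 0) :=
  have h0 := h.harmonic 0 (Nat.zero_le _) 0
  isHolomorphicProj_of_holoProj h0.rankOne (h0.holoProj h.first).1 (h0.holoProj h.first).2

lemma CompleteChain.isAntiholomorphicProj {M : ℕ} {R : ℕ → OnePoint ℂ → Mat N}
    (h : CompleteChain M R) : IsAntiholomorphicProj (R M) := by
  have := isAntiholomorphicProj_cjS h.reverse.isHolomorphicProj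
  rwa [cjS_cjS] at this

/-- Holomorphic projectors are infinitely differentiable. -/
lemma SphereHarmonic.of_holomorphic {X : OnePoint ℂ → Mat N} (hX : SphereHarmonic 2 X)
    (h : ∀ z, dMinus (CPSigma.aff X) z * CPSigma.aff X z = 0) (r : ℕ) : SphereHarmonic r X :=
  ⟨⟨hX.aff.rankOne, (hX.holoProj h).1.mSmoothAt r, hX.aff.eulerLagrange⟩,
    ⟨hX.inv.rankOne, (hX.holoProj h).2.mSmoothAt r, hX.inv.eulerLagrange⟩⟩

section Termination

variable {r : ℕ} {Q : OnePoint ℂ → Mat N}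

lemma SphereHarmonic.iterate_raise (hQ : SphereHarmonic r Q) {m : ℕ} (hm : m + 2 ≤ r)
    (hne : ∀ k < m, ∃ z, sff (CPSigma.aff (raise^[k] Q)) z ≠ 0) :
    SphereHarmonic (r - m) (raise^[m] Q) := by
  induction m with
  | zero => exact hQ
  | succ m ih =>
    have h1 := ih (by omega) fun k hk => hne k (by omega)
    rw [show r - m = r - (m + 1) + 1 by omega] at h1
    rw [Function.iterate_succ_apply']
    exact h1.sphereHarmonic_raise (by omega) (hne m (Nat.lt_succ_self m))

lemma SphereHarmonic.of_le {s : ℕ} (hQ : SphereHarmonic r Q) (hs : s ≤ r) : SphereHarmonic s Q :=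
  have hs' : (s : WithTop ℕ∞) ≤ (r : WithTop ℕ∞) := by exact_mod_cast hs
  ⟨⟨hQ.aff.rankOne, fun z => (hQ.aff.smoothAt z).of_le hs', hQ.aff.eulerLagrange⟩,
    ⟨hQ.inv.rankOne, fun z => (hQ.inv.smoothAt z).of_le hs', hQ.inv.eulerLagrange⟩⟩

lemma SphereHarmonic.chain_iterate_raise (hQ : SphereHarmonic r Q) {m : ℕ} (hm : m + 2 ≤ r)
    (hne : ∀ k < m, ∃ z, sff (CPSigma.aff (raise^[k] Q)) z ≠ 0) :
    Chain m fun k => raise^[k] Q := by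
  have h1 : ∀ k ≤ m, SphereHarmonic (r - k) (raise^[k] Q) := fun k hk =>
    hQ.iterate_raise (by omega) fun l hl => hne l (by omega)
  refine ⟨fun k hk => (h1 k hk).of_le (by omega), fun k hk => ?_⟩
  have h2 := h1 k hk.le
  rw [show r - k = r - k - 1 + 1 by omega] at h2
  rw [Function.iterate_succ_apply']
  exact h2.nextS_raise (by omega) (hne k hk)

/-- Since the members of the sequence are mutually orthogonal, raising terminates. -/
lemma SphereHarmonic.exists_raise_last (hQ : SphereHarmonic (N + 2) Q) :
    ∃ m < N, (∀ z, sff (CPSigma.aff (raise^[m] Q)) z = 0) ∧ Chain m fun k => raise^[k] Q := by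
  classical
  have hex : ∃ m < N, ∀ z, sff (CPSigma.aff (raise^[m] Q)) z = 0 := by
    by_contra! hne
    exact (hQ.chain_iterate_raise (m := N) le_rfl hne).lt.false
  have hspec := Nat.find_spec hex
  refine ⟨Nat.find hex, hspec.1, hspec.2, hQ.chain_iterate_raise (by omega) fun k hk => ?_⟩
  by_contra! h0
  exact Nat.find_min hex hk ⟨by omega, h0⟩

end Termination

/-- Every harmonic projector on the sphere is a member of a complete sequence. -/
theorem SphereHarmonic.exists_completeChain {P : OnePoint ℂ → Mat N}
    (hP : SphereHarmonic (N + 2) P) :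
    ∃ (n m : ℕ) (R : ℕ → OnePoint ℂ → Mat N), CompleteChain (n + m) R ∧ R n = P := by
  obtain ⟨m, -, hm, hup⟩ := hP.exists_raise_last
  obtain ⟨n, -, hn, hdown⟩ := (hP.cjS (by omega)).exists_raise_last
  let R : ℕ → OnePoint ℂ → Mat N := fun j =>
    if j ≤ n then CPSigma.cjS (raise^[n - j] (CPSigma.cjS P)) else raise^[j - n] P
  have hle : ∀ {j}, j ≤ n → R j = CPSigma.cjS (raise^[n - j] (CPSigma.cjS P)) := fun h => if_pos h
  have hge : ∀ {j}, n ≤ j → R j = raise^[j - n] P := fun {j} h => by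
    obtain rfl | h := h.eq_or_lt
    · rw [hle le_rfl, Nat.sub_self]; exact cjS_cjS P
    · exact if_neg (by omega)
  have h2 : ∀ j ≤ n + m, SphereHarmonic 2 (R j) := fun j hj => by
    rcases le_total j n with h | h
    · rw [hle h]
      exact (hdown.harmonic (n - j) (Nat.sub_le _ _)).cjS le_rfl
    · rw [hge h]
      exact hup.harmonic (j - n) (by omega)
  have hnext : ∀ j < n + m, NextS (R j) (R (j + 1)) := fun j hj => by
    rcases lt_or_ge j n with h | h
    · rw [hle h.le, hle (j := j + 1) h, show n - j = n - (j + 1) + 1 by omega]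
      exact (hdown.next (n - (j + 1)) (by omega)).cjS (hdown.harmonic _ (Nat.sub_le _ _))
    · rw [hge h, hge (j := j + 1) (by omega), show j + 1 - n = j - n + 1 by omega]
      exact hup.next (j - n) (by omega)
  have hfirst : ∀ z, dMinus (CPSigma.aff (R 0)) z * CPSigma.aff (R 0) z = 0 := fun z => by
    rw [hle (Nat.zero_le _)]
    change dMinus (fun y => CPSigma.cj (CPSigma.aff (raise^[n] (CPSigma.cjS P)) y)) z *
      CPSigma.cj (CPSigma.aff (raise^[n] (CPSigma.cjS P)) z) = 0
    rw [dMinus_cj, ← cj_mul]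
    exact cj_eq_zero.2 (hn z)
  -- the first member is smooth as it is holomorphic, and raising preserves smoothness
  refine ⟨n, m, R, ⟨fun j hj => ?_, hnext, hfirst, fun z => ?_⟩, ?_⟩
  · induction j with
    | zero => exact fun r => (h2 0 hj).of_holomorphic hfirst _
    | succ j ih =>
      intro r
      have hj' := hnext j hj
      rw [← hj'.raise_eq (h2 j (by omega)) (h2 (j + 1) hj)]
      exact (ih (by omega) (r + 1)).sphereHarmonic_raise (by omega) hj'.aff.dense.nonempty
  · rw [hge (by omega), Nat.add_sub_cancel_left]
    exact hm z
  · rw [hge le_rfl, Nat.sub_self]; rfl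

end Complete

/-! ### The spaces `H` and `H^⊥` -/

section Spaces

variable {N : ℕ}

/-- A spanning criterion by duality: vectors fixed by `T` span the image of `T` if every covector
that annihilates them annihilates the image. -/
lemma span_eq_range {s : Set (Fin N → ℂ)} {T : Mat N} (h1 : ∀ v ∈ s, T *ᵥ v = v)
    (h2 : ∀ r : Fin N → ℂ, (∀ v ∈ s, r ⬝ᵥ v = 0) → ∀ x, r ⬝ᵥ (T *ᵥ x) = 0) :
    Submodule.span ℂ s = LinearMap.range T.mulVecLin := by
  refine le_antisymm (Submodule.span_le.2 fun v hv => ⟨v, h1 v hv⟩) ?_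
  rintro _ ⟨x, rfl⟩
  by_contra hx
  obtain ⟨f, hf, hle⟩ := Submodule.exists_le_ker_of_notMem hx
  have hfr : ∀ v, f v = (fun i => f (Pi.single i 1)) ⬝ᵥ v := fun v => by
    conv_lhs => rw [pi_eq_sum_univ' v, map_sum]
    refine Finset.sum_congr rfl fun i _ => ?_
    rw [map_smul, smul_eq_mul, mul_comm]
  apply hf
  rw [hfr]
  exact h2 _ (fun v hv => (hfr v).symm.trans (hle (Submodule.subset_span hv))) x

lemma finrank_range_of_idem {T : Mat N} (h : T * T = T) {k : ℕ} (ht : T.trace = k) :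
    Module.finrank ℂ (LinearMap.range T.mulVecLin) = k := by
  have hproj : LinearMap.IsProj (LinearMap.range T.mulVecLin) T.mulVecLin := by
    refine ⟨fun x => LinearMap.mem_range_self _ _, ?_⟩
    rintro _ ⟨x, rfl⟩
    simp [h]
  have h1 : LinearMap.trace ℂ (Fin N → ℂ) T.mulVecLin = k := by
    rw [← ht, ← Matrix.trace_toLin'_eq]
    rfl
  exact_mod_cast hproj.trace.symm.trans h1

lemma sesq_cj (P X Y : ℂ → Mat N) (e : Fin N → ℂ) (z : ℂ) :
    sesq (fun y => cj (P y)) (star e) (fun y => cj (X y)) (fun y => cj (Y y)) z =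
      conj (sesq P e X Y z) := by
  have h : ∀ M : Mat N, star (star e) ⬝ᵥ (cj M *ᵥ star e) = conj (star e ⬝ᵥ (M *ᵥ e)) := fun M => by
    rw [cj_mulVec]
    exact (Matrix.star_dotProduct_star _ _).trans (congrArg _ (dotProduct_comm _ _))
  rw [sesq, sesq, map_div₀, ← h, ← h, conjTranspose_cj, ← cj_mul]

lemma iterate_covD_cj (P : ℂ → Mat N) (e : Fin N → ℂ) (k : ℕ) :
    (covD dMinus (fun y => cj (P y)) (star e))^[k] (fun y => cj (P y)) =
      fun z => cj ((covD dPlus P e)^[k] P z) := by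
  induction k with
  | zero => rfl
  | succ k ih =>
    rw [Function.iterate_succ_apply', ih, Function.iterate_succ_apply']
    funext z
    have h : dMinus (fun y => cj (P y)) = fun y => cj (dPlus P y) := funext fun y => dMinus_cj
    rw [covD, dMinus_cj, h, sesq_cj, ← cj_smul, ← cj_sub]
    rfl

namespace CompleteChain

variable {M : ℕ} {R : ℕ → OnePoint ℂ → Mat N}

lemma tower (h : CompleteChain M R) {n : ℕ} (hn : n ≤ M) : Tower n fun i => aff (R i) :=
  ⟨fun i hi r => (h.harmonic i (hi.trans hn) r).aff, fun i hi => (h.next i (by omega)).aff,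
    h.first, fun i hi j hj hij z => h.chain.mul_eq_zero (hi.trans hn) (hj.trans hn) hij _⟩

variable {n m : ℕ} {e : Fin N → ℂ} {z : ℂ}

lemma spaceH_eq (h : CompleteChain (n + m) R) (hz : aff (R n) z *ᵥ e ≠ 0) :
    spaceH (aff (R n)) e z =
      LinearMap.range (∑ i ∈ Finset.range (n + 1), R i z).mulVecLin := by
  have hT := h.tower (n := n) (by omega)
  refine span_eq_range ?_ fun r hr x => hT.dotProduct_eq_zero hz (fun k => hr _ ⟨k, rfl⟩) x
  rintro _ ⟨k, rfl⟩
  exact mulVec_mulVec_eq_of_mul_colMat (hT.partialSum_mul_cov k hz)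

lemma spaceHperp_eq (h : CompleteChain (n + m) R) (hz : aff (R n) z *ᵥ e ≠ 0) :
    spaceHperp (aff (R n)) e z =
      LinearMap.range (∑ i ∈ Finset.range m, R (n + m - i) z).mulVecLin := by
  have hT := h.reverse.tower (n := m) (by omega)
  have hz' : aff (cjS (R (n + m - m))) z *ᵥ star e ≠ 0 := by
    rw [Nat.add_sub_cancel]
    change cj (aff (R n) z) *ᵥ star e ≠ 0
    rw [cj_mulVec]
    exact star_ne_zero.2 hz
  have hcov : ∀ k, Tower.cov (fun i => aff (cjS (R (n + m - i)))) m (star e) k z *ᵥ star e =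
      star ((covD dPlus (aff (R n)) e)^[k] (aff (R n)) z *ᵥ e) := fun k => by
    have h1 := congrFun (iterate_covD_cj (aff (R n)) e k) z
    rw [← cj_mulVec, ← h1]
    simp only [Tower.cov, Nat.add_sub_cancel]
    rfl
  have hsum : partialSum (fun i => aff (cjS (R (n + m - i)))) m z =
      cj (∑ i ∈ Finset.range m, R (n + m - i) z) := by
    ext i j
    simp [partialSum, cj, Matrix.sum_apply, aff, cjS]
  refine span_eq_range ?_ fun r hr x => ?_
  · rintro _ ⟨k, hk, rfl⟩
    obtain ⟨k, rfl⟩ := Nat.exists_eq_add_of_le' hk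
    have h1 := mulVec_mulVec_eq_of_mul_colMat (hT.partialSum_mul_cov_succ k hz')
    rw [hcov, hsum, cj_mulVec] at h1
    exact star_injective h1
  · have h1 := hT.dotProduct_eq_zero_of_succ hz' (r := star r) (fun k => ?_) (star x)
    · rw [hsum, cj_mulVec, Matrix.star_dotProduct_star, star_eq_zero, dotProduct_comm] at h1
      exact h1
    · rw [hcov, Matrix.star_dotProduct_star, dotProduct_comm, hr _ ⟨k + 1, by omega, rfl⟩,
        star_zero]

/-- Sums over sets of members multiply like the sets intersect. -/
lemma sum_mul_sum (h : CompleteChain M R) {s t : Finset ℕ} (hs : ∀ i ∈ s, i ≤ M)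
    (ht : ∀ i ∈ t, i ≤ M) (p : OnePoint ℂ) :
    (∑ i ∈ s, R i p) * ∑ j ∈ t, R j p = ∑ i ∈ s ∩ t, R i p := by
  rw [Finset.sum_mul_sum, ← Finset.sum_ite_mem]
  refine Finset.sum_congr rfl fun i hi => ?_
  split_ifs with hit
  · rw [Finset.sum_eq_single i
      (fun j hj hji => h.chain.mul_eq_zero (hs i hi) (ht j hj) hji.symm p)
      (fun h => absurd hit h), ((h.harmonic i (hs i hi) 0).rankOne p).idem]
  · exact Finset.sum_eq_zero fun j hj =>
      h.chain.mul_eq_zero (hs i hi) (ht j hj) (fun hij => hit (hij ▸ hj)) p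

lemma finrank_range_sum (h : CompleteChain M R) {s : Finset ℕ} (hs : ∀ i ∈ s, i ≤ M)
    (p : OnePoint ℂ) :
    Module.finrank ℂ (LinearMap.range (∑ i ∈ s, R i p).mulVecLin) = s.card := by
  refine finrank_range_of_idem (by rw [h.sum_mul_sum hs hs, Finset.inter_self]) ?_
  rw [Matrix.trace_sum, Finset.sum_congr rfl
    fun i hi => ((h.harmonic i (hs i hi) 0).rankOne p).trace_eq]
  simp

lemma conjTranspose_sum (h : CompleteChain M R) {s : Finset ℕ} (hs : ∀ i ∈ s, i ≤ M)
    (p : OnePoint ℂ) : (∑ i ∈ s, R i p)ᴴ = ∑ i ∈ s, R i p := by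
  rw [Matrix.conjTranspose_sum]
  exact Finset.sum_congr rfl fun i hi => ((h.harmonic i (hs i hi) 0).rankOne p).herm

/-- The iterated covariant derivatives of `R n` in the two directions span orthogonal spaces, the
images of the members of the sequence up to `R n` and beyond `R n`. -/
theorem spaces (h : CompleteChain (n + m) R) (hz : aff (R n) z *ᵥ e ≠ 0) :
    Module.finrank ℂ (spaceH (aff (R n)) e z) = n + 1 ∧
    Module.finrank ℂ (spaceHperp (aff (R n)) e z) = m ∧
    (∀ v ∈ spaceH (aff (R n)) e z, ∀ w ∈ spaceHperp (aff (R n)) e z, star v ⬝ᵥ w = 0) ∧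
    ∀ v ∈ spaceH (aff (R n)) e z ⊔ spaceHperp (aff (R n)) e z,
      (∑ i ∈ Finset.range (n + 1), R i z + ∑ k ∈ Finset.Icc 1 m, R (n + k) z) *ᵥ v = v := by
  have hT : ∑ i ∈ Finset.range m, R (n + m - i) z = ∑ i ∈ Finset.Ioc n (n + m), R i z :=
    Finset.sum_nbij' (fun i => n + m - i) (fun i => n + m - i)
      (fun i hi => by simp only [Finset.mem_range, Finset.mem_Ioc] at *; omega)
      (fun i hi => by simp only [Finset.mem_range, Finset.mem_Ioc] at *; omega)
      (fun i hi => by simp only [Finset.mem_range] at *; omega)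
      (fun i hi => by simp only [Finset.mem_Ioc] at *; omega) fun _ _ => rfl
  have hT' : ∑ k ∈ Finset.Icc 1 m, R (n + k) z = ∑ i ∈ Finset.Ioc n (n + m), R i z :=
    Finset.sum_nbij' (fun i => n + i) (fun i => i - n)
      (fun i hi => by simp only [Finset.mem_Icc, Finset.mem_Ioc] at *; omega)
      (fun i hi => by simp only [Finset.mem_Icc, Finset.mem_Ioc] at *; omega)
      (fun i hi => by omega)
      (fun i hi => by simp only [Finset.mem_Ioc] at *; omega) fun _ _ => rfl
  rw [h.spaceH_eq hz, h.spaceHperp_eq hz, hT, hT']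
  have hs : ∀ i ∈ Finset.range (n + 1), i ≤ n + m := fun i hi => by
    have := Finset.mem_range.1 hi; omega
  have ht : ∀ i ∈ Finset.Ioc n (n + m), i ≤ n + m := fun i hi => (Finset.mem_Ioc.1 hi).2
  have hdisj : Finset.range (n + 1) ∩ Finset.Ioc n (n + m) = ∅ := by
    ext i
    simp only [Finset.mem_inter, Finset.mem_range, Finset.mem_Ioc, Finset.notMem_empty, iff_false]
    omega
  have hSS := h.sum_mul_sum hs hs (z : OnePoint ℂ)
  have hST := h.sum_mul_sum hs ht (z : OnePoint ℂ)
  have hTS := h.sum_mul_sum ht hs (z : OnePoint ℂ)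
  have hTT := h.sum_mul_sum ht ht (z : OnePoint ℂ)
  rw [hdisj, Finset.sum_empty] at hST
  rw [Finset.inter_comm, hdisj, Finset.sum_empty] at hTS
  rw [Finset.inter_self] at hSS hTT
  refine ⟨by rw [h.finrank_range_sum hs, Finset.card_range],
    by rw [h.finrank_range_sum ht, Nat.card_Ioc, Nat.add_sub_cancel_left], ?_, ?_⟩
  · rintro _ ⟨v, rfl⟩ _ ⟨w, rfl⟩
    rw [Matrix.mulVecLin_apply, Matrix.mulVecLin_apply, Matrix.star_mulVec,
      ← Matrix.dotProduct_mulVec, h.conjTranspose_sum hs, Matrix.mulVec_mulVec, hST,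
      Matrix.zero_mulVec, dotProduct_zero]
  · intro v hv
    obtain ⟨_, ⟨a, rfl⟩, _, ⟨b, rfl⟩, rfl⟩ := Submodule.mem_sup.1 hv
    rw [Matrix.mulVecLin_apply, Matrix.mulVecLin_apply, Matrix.mulVec_add, Matrix.mulVec_mulVec,
      Matrix.mulVec_mulVec, add_mul, add_mul, hSS, hTS, hST, hTT, add_zero, zero_add]

end CompleteChain

end Spaces

end CPSigma

end

theorem theorem6 (N : ℕ) (P : OnePoint ℂ → CPSigma.Mat N)
    (hP : CPSigma.IsFiniteActionSolution (N + 2) P) :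
    ∃ (n m : ℕ) (P₀ Ptop : OnePoint ℂ → CPSigma.Mat N),
      n + m + 1 ≤ N ∧
      CPSigma.IsHolomorphicProj P₀ ∧
      CPSigma.IsAntiholomorphicProj Ptop ∧
      P = CPSigma.raise^[n] P₀ ∧
      P = CPSigma.lower^[m] Ptop ∧
      P₀ = CPSigma.lower^[m + n] Ptop ∧
      P₀ = CPSigma.lower^[n] P ∧
      Ptop = CPSigma.raise^[m] P ∧
      -- the nonzero members of the sequence are finite action solutions, the others vanish
      (∀ k ≤ n, CPSigma.IsFiniteActionSolution (N + 2 - k) (CPSigma.lower^[k] P)) ∧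
      (∀ k ≤ m, CPSigma.IsFiniteActionSolution (N + 2 - k) (CPSigma.raise^[k] P)) ∧
      (∀ k, n < k → CPSigma.lower^[k] P = 0) ∧
      (∀ k, m < k → CPSigma.raise^[k] P = 0) ∧
      -- mutual orthogonality
      (∀ j k, j ≠ k → ∀ p, CPSigma.lower^[j] P p * CPSigma.lower^[k] P p = 0) ∧
      (∀ j k, j ≠ k → ∀ p, CPSigma.raise^[j] P p * CPSigma.raise^[k] P p = 0) ∧
      (∀ j k, j + k ≠ 0 → ∀ p, CPSigma.lower^[j] P p * CPSigma.raise^[k] P p = 0) ∧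
      -- the sum of the projectors is the identity on the orthogonal sum of `H` and `H^⊥`
      (∀ (e : Fin N → ℂ) (z : ℂ), (CPSigma.aff P z).mulVec e ≠ 0 →
        Module.finrank ℂ (CPSigma.spaceH (CPSigma.aff P) e z) = n + 1 ∧
        Module.finrank ℂ (CPSigma.spaceHperp (CPSigma.aff P) e z) = m ∧
        (∀ v ∈ CPSigma.spaceH (CPSigma.aff P) e z,
          ∀ w ∈ CPSigma.spaceHperp (CPSigma.aff P) e z, star v ⬝ᵥ w = 0) ∧
        ∀ v ∈ CPSigma.spaceH (CPSigma.aff P) e z ⊔ CPSigma.spaceHperp (CPSigma.aff P) e z,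
          (∑ k ∈ Finset.range (n + 1), CPSigma.lower^[k] P (z : OnePoint ℂ) +
            ∑ k ∈ Finset.Icc 1 m, CPSigma.raise^[k] P (z : OnePoint ℂ)).mulVec v = v) := by
  obtain ⟨n, m, R, h, rfl⟩ :=
    (hP.sphereHarmonic (Nat.le_add_left 2 N)).exists_completeChain
  have hN : n + m < N := h.chain.lt
  have hraise : ∀ k ≤ m, CPSigma.raise^[k] (R n) = R (n + k) := fun k hk =>
    h.iterate_raise k (by omega)
  have hlower : ∀ k ≤ n, CPSigma.lower^[k] (R n) = R (n - k) := fun k hk =>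
    h.iterate_lower (by omega) hk
  have hraise0 : ∀ k, m < k → CPSigma.raise^[k] (R n) = 0 := fun k hk =>
    h.iterate_raise_eq_zero (by omega) (by omega)
  have hlower0 : ∀ k, n < k → CPSigma.lower^[k] (R n) = 0 := fun k hk =>
    h.iterate_lower_eq_zero (by omega) hk
  have hsol : ∀ i ≤ n + m, ∀ k ≤ N, CPSigma.IsFiniteActionSolution (N + 2 - k) (R i) :=
    fun i hi k hk => by
      rw [show N + 2 - k = N - k + 2 by omega]
      exact (h.harmonic i hi (N - k)).isFiniteActionSolution (by omega)
  refine ⟨n, m, R 0, R (n + m), hN, h.isHolomorphicProj, h.isAntiholomorphicProj, ?_, ?_, ?_, ?_,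
    (hraise m le_rfl).symm, fun k hk => ?_, fun k hk => ?_, hlower0, hraise0, fun j k hjk p => ?_,
    fun j k hjk p => ?_, fun j k hjk p => ?_, fun e z hz => ?_⟩
  · rw [h.iterate_raise n (by omega), zero_add]
  · rw [h.iterate_lower le_rfl (by omega), Nat.add_sub_cancel]
  · rw [h.iterate_lower le_rfl (by omega), show n + m - (m + n) = 0 by omega]
  · rw [hlower n le_rfl, Nat.sub_self]
  · rw [hlower k hk]
    exact hsol _ (by omega) k (by omega)
  · rw [hraise k hk]
    exact hsol _ (by omega) k (by omega)
  · rcases lt_or_ge n j with hj | hj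
    · rw [hlower0 j hj]; exact zero_mul _
    rcases lt_or_ge n k with hk | hk
    · rw [hlower0 k hk]; exact mul_zero _
    rw [hlower j hj, hlower k hk]
    exact h.chain.mul_eq_zero (by omega) (by omega) (by omega) p
  · rcases lt_or_ge m j with hj | hj
    · rw [hraise0 j hj]; exact zero_mul _
    rcases lt_or_ge m k with hk | hk
    · rw [hraise0 k hk]; exact mul_zero _
    rw [hraise j hj, hraise k hk]
    exact h.chain.mul_eq_zero (by omega) (by omega) (by omega) p
  · rcases lt_or_ge n j with hj | hj
    · rw [hlower0 j hj]; exact zero_mul _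
    rcases lt_or_ge m k with hk | hk
    · rw [hraise0 k hk]; exact mul_zero _
    rw [hlower j hj, hraise k hk]
    exact h.chain.mul_eq_zero (by omega) (by omega) (by omega) p
  · have hsum : ∑ k ∈ Finset.range (n + 1), CPSigma.lower^[k] (R n) (z : OnePoint ℂ) =
        ∑ i ∈ Finset.range (n + 1), R i (z : OnePoint ℂ) := by
      rw [← Finset.sum_range_reflect (fun i => R i (z : OnePoint ℂ))]
      refine Finset.sum_congr rfl fun k hk => ?_
      rw [hlower k (Nat.lt_succ_iff.1 (Finset.mem_range.1 hk))]
      rfl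
    have hsum' : ∑ k ∈ Finset.Icc 1 m, CPSigma.raise^[k] (R n) (z : OnePoint ℂ) =
        ∑ k ∈ Finset.Icc 1 m, R (n + k) (z : OnePoint ℂ) :=
      Finset.sum_congr rfl fun k hk => by rw [hraise k (Finset.mem_Icc.1 hk).2]
    rw [hsum, hsum']
    exact h.spaces hz
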